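/- **Setting.** Let $f=\frac1M\sum_{i=1}^M f_i$ on $\mathbb R^{d_1}\times\mathbb R^{d_2}$ with $f_i(x,y)=\mathbb E_{\xi\sim\mathcal D_i}[f_i(x,y;\xi)]$, where each $f_i(\cdot,\cdot;\xi)$ is differentiable. Assume, with constants $l,\mu,\sigma>0$ and $\sigma_G\ge 0$: 1. each $f_i$ is differentiable and $\|\nabla f_i(x_1,y_1)-\nabla f_i(x_2,y_2)\|\le l\,(\|x_1-x_2\|+\|y_1-y_2\|)$; 2. $\mathbb E\nabla f_i(x,y;\xi)=\nabla f_i(x,y)$ and $\mathbb E\|\nabla f_i(x,y;\xi)-\nabla f_i(x,y)\|^2\le\sigma^2$ for $\xi\sim\mathcal D_i$; 3. $\|\nabla f_i(x,y)-\nabla f(x,y)\|^2\le\sigma_G^2$ for all $i,x,y$; 4. $\max_y f(x,y)$ is attained for every $x$, and $\Phi(x)=\max_y f(x,y)\ge\Phi^*>-\infty$; 5. $\|\nabla_y f(x,y)\|^2\ge 2\mu\,(\Phi(x)-f(x,y))$ for all $x,y$, with $\mu\le l$. Write $\kappa=l/\mu\ \ (\ge 1)$. **Algorithm (FESS-GDA).**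 Start from $(x_0,y_0,z_0)$. In round $t=0,\dots,T-1$ a uniformly random set $S_t$ of $m$ clients ($1\le m\le M$) is drawn. Each $i\in S_t$ starts from $(x^1,y^1)=(x_t,y_t)$ and performs, for $k=1,\dots,K$, the steps $$x^{k+1}=x^k-\eta_{x,l}\nabla_x f_i(x^k,y^k;\xi^k_{t,i}),\qquad y^{k+1}=y^k+\eta_{y,l}\nabla_y f_i(x^k,y^k;\xi^k_{t,i}),$$ with fresh independent samples $\xi^k_{t,i}\sim\mathcal D_i$, giving $(x_{t,i}^{K+1},y_{t,i}^{K+1})$. The server sets $$x_{t+1}=x_t+\eta_{x,g}\Big(\tfrac1m\sum_{i\in S_t}x_{t,i}^{K+1}-x_t\Big)-\eta_{x,l}\eta_{x,g}Kp(x_t-z_t),$$ $$y_{t+1}=y_t+\eta_{y,g}\Big(\tfrac1m\sum_{i\in S_t}y_{t,i}^{K+1}-y_t\Big),\qquad z_{t+1}=z_t+\beta(x_{t+1}-z_t).$$ The per-client sample complexity is $KT$ and the communication complexity is $T$. Put $\eta_x=\eta_{x,g}\eta_{x,l}$, $\eta_y=\eta_{y,g}\eta_{y,l}$, $\hat f(x,y,z)=f(x,y)+l\|x-z\|^2$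 and $$V_0=\hat f(x_0,y_0,z_0)-2\min_x\hat f(x,y_0,z_0)+2\min_x\max_y\hat f(x,y,z_0),$$ and let $\Delta>0$ satisfy $V_0-\Phi^*\le\Delta$. **Theorem.** There are an absolute constant $c>0$ and a constant $C>0$ depending only on $l,\sigma,\sigma_G,\Delta$ such that the following holds for every $\varepsilon>0$ with $m\varepsilon^2\le\kappa$. Consider learning rates with $\eta_{x,l},\eta_{y,l}>0$ and $$p=2l,\quad \eta_y=\frac{\eta_x}{256},\quad \beta=\frac{\eta_yK\mu}{80000},$$ $$\eta_{x,l}\le\min\Big\{\tfrac{1}{2l\sqrt{2(2K-1)(K-1)}},\ \sqrt{\tfrac{\beta}{6144\,\eta_x p\,l^2K^3}},\ \tfrac{c\,\varepsilon}{Kl\sqrt{\kappa(\sigma_G^2+\sigma^2)}}\Big\},$$ $$\eta_{y,l}\le\min\Big\{\tfrac{1}{2l\sqrt{2(2K-1)(K-1)}},\ \sqrt{\tfrac{\eta_y}{3072\,\eta_x l^2K^2}},\ \tfrac{c\,\varepsilon}{Kl\sqrt{\kappa(\sigma_G^2+\sigma^2)}}\Big\}$$ (for $K=1$ the first bound is void).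 * *Full participation or homogeneous data* ($m=M$ or $\sigma_G=0$). There are $K,T\ge1$ with $\frac1C\,\kappa m^{-1}\varepsilon^{-2}\le K\le C\,\kappa m^{-1}\varepsilon^{-2}$, $KT\le C\,\kappa^2m^{-1}\varepsilon^{-4}$ and $T\le C\,\kappa\varepsilon^{-2}$ such that, for all such learning rates with $\eta_x=\min\big\{\frac{1}{1000Kl},\frac{\sqrt{m\Delta}}{\sigma\sqrt{KTl}}\big\}$, FESS-GDA finds an $(\varepsilon,\varepsilon/\sqrt\kappa)$-stationary point of $f$. * *Partial participation and heterogeneous data* ($m<M$ and $\sigma_G>0$). There are $K,T\ge1$ with $K\le C$, $KT\le C\,\kappa^2m^{-1}\varepsilon^{-4}$ and $T\le C\,\kappa^2m^{-1}\varepsilon^{-4}$ such that, for all such learning rates with $\eta_x=\min\big\{\frac{1}{1000Kl},\frac{\sqrt{m\Delta}}{\sigma\sqrt{Tl}\,K}\big\}$, FESS-GDA finds an $(\varepsilon,\varepsilon/\sqrt\kappa)$-stationary point of $f$. Here "finds" means $$\frac1T\sum_{t=0}^{T-1}\mathbb E\big[\|\nabla_xf(x_t,y_t)\|^2+\kappa\|\nabla_yf(x_t,y_t)\|^2\big]\le\varepsilon^2,$$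 i.e. a uniformly drawn iterate is $(\varepsilon,\varepsilon/\sqrt\kappa)$-stationary in mean square; in particular, for some $t<T$, with positive probability $\|\nabla_xf(x_t,y_t)\|\le\varepsilon$ and $\|\nabla_yf(x_t,y_t)\|\le\varepsilon/\sqrt\kappa$. -/

import Mathlib

open MeasureTheory ProbabilityTheory

universe u v

noncomputable section

namespace FedMinimax

/-- The Euclidean space `ℝ^d`. -/
abbrev Vec (d : ℕ) := EuclideanSpace ℝ (Fin d)

variable {d₁ d₂ : ℕ}

/-- Partial gradient `∇ₓ g (x, y)`. -/
def gradX (g : Vec d₁ → Vec d₂ → ℝ) (x : Vec d₁) (y : Vec d₂) : Vec d₁ :=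
  gradient (fun x' => g x' y) x

/-- Partial gradient `∇_y g (x, y)`. -/
def gradY (g : Vec d₁ → Vec d₂ → ℝ) (x : Vec d₁) (y : Vec d₂) : Vec d₂ :=
  gradient (fun y' => g x y') y

/-- The full gradient `∇ g (x, y) = (∇ₓ g (x, y), ∇_y g (x, y))`, with the Euclidean norm of
`ℝ^(d₁ + d₂)`. -/
def fullGrad (g : Vec d₁ → Vec d₂ → ℝ) (x : Vec d₁) (y : Vec d₂) :
    WithLp 2 (Vec d₁ × Vec d₂) :=
  WithLp.toLp 2 (gradX g x y, gradY g x y)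

/-- A federated stochastic problem with `M` clients: client `i` has the data distribution `D i` on
the sample space `Ξ` and the sample loss `loss i x y ξ`, which is differentiable in `(x, y)`, has a
measurable gradient and a finite mean. -/
structure Problem (d₁ d₂ M : ℕ) (Ξ : Type u) [MeasurableSpace Ξ] where
  D : Fin M → Measure Ξ
  isProbabilityMeasure_D : ∀ i, IsProbabilityMeasure (D i)
  loss : Fin M → Vec d₁ → Vec d₂ → Ξ → ℝ
  differentiable_loss : ∀ i ξ,
    Differentiable ℝ (fun w : Vec d₁ × Vec d₂ => loss i w.1 w.2 ξ)
  measurable_grad : ∀ i, Measurable (fun q : (Vec d₁ × Vec d₂) × Ξ =>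
    fullGrad (fun x y => loss i x y q.2) q.1.1 q.1.2)
  integrable_loss : ∀ i x y, Integrable (fun ξ => loss i x y ξ) (D i)

variable {M : ℕ} {Ξ : Type u} [MeasurableSpace Ξ]

namespace Problem

variable (Q : Problem d₁ d₂ M Ξ)

/-- The local objective `fᵢ (x, y) = 𝔼_{ξ ∼ Dᵢ} [loss i x y ξ]`. -/
def localObj (i : Fin M) (x : Vec d₁) (y : Vec d₂) : ℝ := ∫ ξ, Q.loss i x y ξ ∂(Q.D i)

/-- The global objective `f = (1 / M) ∑ᵢ fᵢ`. -/
def obj (x : Vec d₁) (y : Vec d₂) : ℝ := (1 / (M : ℝ)) * ∑ i, Q.localObj i x y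

/-- Every local objective is differentiable with an `l`-Lipschitz gradient, in the form
`‖∇fᵢ(x₁,y₁) - ∇fᵢ(x₂,y₂)‖ ≤ l (‖x₁ - x₂‖ + ‖y₁ - y₂‖)`. -/
def LipschitzSmooth (l : ℝ) : Prop :=
  ∀ i, Differentiable ℝ (fun w : Vec d₁ × Vec d₂ => Q.localObj i w.1 w.2) ∧
    ∀ (x₁ x₂ : Vec d₁) (y₁ y₂ : Vec d₂),
      ‖fullGrad (Q.localObj i) x₁ y₁ - fullGrad (Q.localObj i) x₂ y₂‖
        ≤ l * (‖x₁ - x₂‖ + ‖y₁ - y₂‖)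

/-- The stochastic gradients are unbiased with variance at most `σ²`. -/
def BoundedVariance (σ : ℝ) : Prop :=
  ∀ (i : Fin M) (x : Vec d₁) (y : Vec d₂),
    Integrable (fun ξ => fullGrad (fun x' y' => Q.loss i x' y' ξ) x y) (Q.D i) ∧
    ∫ ξ, fullGrad (fun x' y' => Q.loss i x' y' ξ) x y ∂(Q.D i) = fullGrad (Q.localObj i) x y ∧
    Integrable (fun ξ => ‖fullGrad (fun x' y' => Q.loss i x' y' ξ) x y
      - fullGrad (Q.localObj i) x y‖ ^ 2) (Q.D i) ∧
    ∫ ξ, ‖fullGrad (fun x' y' => Q.loss i x' y' ξ) x y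
      - fullGrad (Q.localObj i) x y‖ ^ 2 ∂(Q.D i) ≤ σ ^ 2

/-- Bounded heterogeneity of the clients; `σG = 0` is the case of homogeneous data. -/
def BoundedHeterogeneity (σG : ℝ) : Prop :=
  ∀ (i : Fin M) (x : Vec d₁) (y : Vec d₂),
    ‖fullGrad (Q.localObj i) x y - fullGrad Q.obj x y‖ ^ 2 ≤ σG ^ 2

end Problem

/-- `Φ x = max_y f (x, y)`. -/
def maxVal (f : Vec d₁ → Vec d₂ → ℝ) (x : Vec d₁) : ℝ := ⨆ y, f x y

/-- The Polyak–Łojasiewicz condition in `y`: for each `x` the maximum over `y` is attained, and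
`‖∇_y f (x, y)‖² ≥ 2 μ (max_{y'} f (x, y') - f (x, y))`. -/
def PLInY (f : Vec d₁ → Vec d₂ → ℝ) (μ : ℝ) : Prop :=
  (∀ x, ∃ ystar, ∀ y, f x y ≤ f x ystar) ∧
    ∀ x y, 2 * μ * (maxVal f x - f x y) ≤ ‖gradY f x y‖ ^ 2

/-- The smoothed objective `f̂ (x, y, z) = f (x, y) + (p / 2) ‖x - z‖²`. -/
def smoothed (f : Vec d₁ → Vec d₂ → ℝ) (p : ℝ) (x : Vec d₁) (y : Vec d₂) (z : Vec d₁) : ℝ :=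
  f x y + p / 2 * ‖x - z‖ ^ 2

/-- The potential `V = f̂ (x, y, z) - 2 Ψ (y, z) + 2 P (z)`, where `Ψ (y, z) = min_x f̂ (x, y, z)`
and `P (z) = min_x max_y f̂ (x, y, z)`. -/
def potential (f : Vec d₁ → Vec d₂ → ℝ) (p : ℝ) (x : Vec d₁) (y : Vec d₂) (z : Vec d₁) : ℝ :=
  smoothed f p x y z - 2 * (⨅ x', smoothed f p x' y z)
    + 2 * (⨅ x', ⨆ y', smoothed f p x' y' z)

/-- The stationarity measure in `y`, `l ‖P_Y (y + (1 / l) ∇_y f (x, y)) - y‖`; here `Y = ℝ^d₂`, so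
that the projection `P_Y` is the identity. -/
def stationarityY (f : Vec d₁ → Vec d₂ → ℝ) (l : ℝ) (x : Vec d₁) (y : Vec d₂) : ℝ :=
  l * ‖id (y + (1 / l) • gradY f x y) - y‖

/-- `(x, y)` is an `(ε₁, ε₂)`-stationary point of `f`. -/
def IsStationary (f : Vec d₁ → Vec d₂ → ℝ) (l ε₁ ε₂ : ℝ) (x : Vec d₁) (y : Vec d₂) : Prop :=
  ‖gradX f x y‖ ≤ ε₁ ∧ stationarityY f l x y ≤ ε₂

/-! ### The algorithm FESS-GDA (with `Y = ℝ^d₂`, where the projections are identities) -/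

/-- Local and global learning rates, smoothing step `β` and smoothing parameter `p`. -/
structure Params where
  ηxl : ℝ
  ηyl : ℝ
  ηxg : ℝ
  ηyg : ℝ
  β : ℝ
  p : ℝ

/-- The randomness of one round: the set of sampled clients, and the data sample `ξ i k` that client
`i` would use in its local step `k`. -/
abbrev Noise (M K : ℕ) (Ξ : Type u) := Finset (Fin M) × (Fin M → Fin K → Ξ)

/-- The law of the randomness of one round: the client set is uniform among the sets of `m` clients,
the data samples are independent, `ξ i k ∼ D i`, and independent of the client set. -/
def roundLaw (Q : Problem d₁ d₂ M Ξ) (m K : ℕ) : Measure (Noise M K Ξ) :=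
  haveI := Q.isProbabilityMeasure_D
  (uniformOn {S : Finset (Fin M) | S.card = m}).prod
    (Measure.pi fun i => Measure.pi fun _ : Fin K => Q.D i)

/-- `noise t`, `t = 0, 1, …`, is the randomness of the rounds: independent with law `roundLaw`. -/
structure IsRoundNoise (Q : Problem d₁ d₂ M Ξ) (m K : ℕ) {Ω : Type v} [MeasurableSpace Ω]
    (P : Measure Ω) (noise : ℕ → Ω → Noise M K Ξ) : Prop where
  measurable : ∀ t, Measurable (noise t)
  law : ∀ t, P.map (noise t) = roundLaw Q m K
  indep : iIndepFun noise P

/-- The local model of client `i` after `k` local stochastic gradient descent ascent steps started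
from the global model `w`, along the samples `ξ` (it is used for `k ≤ K`). -/
def localModel (Q : Problem d₁ d₂ M Ξ) (s : Params) {K : ℕ} (i : Fin M) (ξ : Fin K → Ξ)
    (w : Vec d₁ × Vec d₂) : ℕ → Vec d₁ × Vec d₂
  | 0 => w
  | k + 1 =>
    let v := localModel Q s i ξ w k
    if h : k < K then
      (v.1 - s.ηxl • gradX (fun x y => Q.loss i x y (ξ ⟨k, h⟩)) v.1 v.2,
        v.2 + s.ηyl • gradY (fun x y => Q.loss i x y (ξ ⟨k, h⟩)) v.1 v.2)
    else v

/-- The state `(x, y, z)` of the server. -/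
structure State (d₁ d₂ : ℕ) where
  x : Vec d₁
  y : Vec d₂
  z : Vec d₁

/-- One communication round with `m` participating clients and `K` local steps. -/
def round (Q : Problem d₁ d₂ M Ξ) (s : Params) (m : ℕ) {K : ℕ} (n : Noise M K Ξ)
    (w : State d₁ d₂) : State d₁ d₂ :=
  let x' := w.x
    + s.ηxg • ((1 / (m : ℝ)) • ∑ i ∈ n.1, (localModel Q s i (n.2 i) (w.x, w.y) K).1 - w.x)
    - (s.ηxl * s.ηxg * K * s.p) • (w.x - w.z)
  let y' := w.y
    + s.ηyg • ((1 / (m : ℝ)) • ∑ i ∈ n.1, (localModel Q s i (n.2 i) (w.x, w.y) K).2 - w.y)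
  { x := x'
    y := y'
    z := w.z + s.β • (x' - w.z) }

/-- The server state after `t` communication rounds, started from `w₀`. -/
def fessGDA (Q : Problem d₁ d₂ M Ξ) (s : Params) (m : ℕ) {K : ℕ} (w₀ : State d₁ d₂)
    {Ω : Type v} (noise : ℕ → Ω → Noise M K Ξ) : ℕ → Ω → State d₁ d₂
  | 0, _ => w₀
  | t + 1, ω => round Q s m (noise t ω) (fessGDA Q s m w₀ noise t ω)

/-- The admissible parameters, for a prescribed effective step size `ηx = ηxg * ηxl`:
`p = 2l`, `ηy = ηx / 256`, `β = ηy K μ / 80000` and small local learning rates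
`ηxl ≤ min {1 / (2l √(2(2K-1)(K-1))), √(β / (6144 ηx p l² K³)), c ε / (K l √(κ (σG² + σ²)))}`,
`ηyl ≤ min {1 / (2l √(2(2K-1)(K-1))), √(ηy / (3072 ηx l² K²)), c ε / (K l √(κ (σG² + σ²)))}`,
the first two bounds being written without divisions and roots. -/
structure Admissible (l μ σ σG ε c : ℝ) (K : ℕ) (ηx : ℝ) (s : Params) : Prop where
  p_eq : s.p = 2 * l
  ηxl_pos : 0 < s.ηxl
  ηyl_pos : 0 < s.ηyl
  ηx_eq : s.ηxg * s.ηxl = ηx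
  ηy_eq : s.ηyg * s.ηyl = ηx / 256
  β_eq : s.β = ηx / 256 * K * μ / 80000
  ηxl_le₁ : s.ηxl ^ 2 * (8 * l ^ 2 * ((2 * K - 1) * (K - 1))) ≤ 1
  ηxl_le₂ : s.ηxl ^ 2 * (6144 * ηx * s.p * l ^ 2 * K ^ 3) ≤ s.β
  ηxl_le₃ : s.ηxl ≤ c * ε / (K * l * √(l / μ * (σG ^ 2 + σ ^ 2)))
  ηyl_le₁ : s.ηyl ^ 2 * (8 * l ^ 2 * ((2 * K - 1) * (K - 1))) ≤ 1
  ηyl_le₂ : s.ηyl ^ 2 * (3072 * ηx * l ^ 2 * K ^ 2) ≤ ηx / 256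
  ηyl_le₃ : s.ηyl ≤ c * ε / (K * l * √(l / μ * (σG ^ 2 + σ ^ 2)))

/-- The first `T` iterates `w t = (x_t, y_t)` of a random run find an `(ε, ε / √κ)`-stationary point
of `f`: for the output `w τ` with `τ` uniform on `{0, …, T - 1}`, the mean of
`‖∇ₓ f‖² + κ (l ‖P_Y(y + (1/l) ∇_y f) - y‖)²` is at most `ε²`; in particular some iterate is an
`(ε, ε / √κ)`-stationary point with positive probability. -/
def FindsStationary {Ω : Type v} [MeasurableSpace Ω] (P : Measure Ω)
    (f : Vec d₁ → Vec d₂ → ℝ) (l κ ε : ℝ) (T : ℕ) (w : ℕ → Ω → State d₁ d₂) : Prop :=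
  (∀ t < T, Integrable (fun ω => ‖gradX f (w t ω).x (w t ω).y‖ ^ 2
    + κ * stationarityY f l (w t ω).x (w t ω).y ^ 2) P) ∧
  (1 / (T : ℝ)) * ∑ t ∈ Finset.range T,
    ∫ ω, (‖gradX f (w t ω).x (w t ω).y‖ ^ 2
      + κ * stationarityY f l (w t ω).x (w t ω).y ^ 2) ∂P ≤ ε ^ 2 ∧
  ∃ t < T, 0 < P {ω | IsStationary f l ε (ε / √κ) (w t ω).x (w t ω).y}

end FedMinimax

end

/-! The potential V = f̂ - 2Ψ + 2P with p = 2l is a Lyapunov function for the rounds. The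
regularizer l‖x - z‖² outweighs the l-weak convexity of f in x, so f̂(·, y, z) is strongly convex
and its minimizer xs(y, z) exists and is Lipschitz in (y, z). Moreover V ≥ Φ*, since f̂ ≥ Ψ, P ≥ Ψ
and P ≥ Φ*. Along a step f̂ decreases with ∇ₓf̂, the term -2Ψ turns ascent in y into descent of V,
and the shift of z contributes -lβ‖x - z‖². What remains is the distance between xs and the
minimizer xm of the max problem. The PL inequality bounds it by ‖∇_y f(xs, y)‖²/(μl)
(`error_bound`), and the factor β, proportional to μ, makes it harmless. This is
`potential_descent`.

The mean sample gradient of a round is the true gradient plus three errors (`mean_sampleGrad_eq`).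
Sample noise and client sampling have mean zero given the state, so they enter only through second
moments. In the regimes considered these are at most (σ² + σG²)/(mK), multiplied by l(ηx K)². The
drift of the local models is biased, but it is bounded along every sample path (`localModel_drift`).
The bounds on the local learning rates let the descent absorb its gradient part and make the rest a
small multiple of ε²/κ.

Hence each round lowers the expected potential by a constant times (ηy K/κ)(‖∇ₓf‖² + κ‖∇_y f‖²), up
to these noise terms (`lintegral_roundLaw_le`). The loss 1/κ comes from β, because ‖x - z‖ is needed
to recover ∇ₓf from ∇ₓf̂. Independence of the rounds allows telescoping (`lintegral_telescope`), and
`gap_add_noise_le` balances Δ against the noise through the choice of ηx and T. -/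

namespace FedMinimax

open scoped RealInnerProductSpace

/-! ### Smoothed objective, proximal points and descent of the potential. -/

section Deterministic

variable {d₁ d₂ : ℕ}

/-- First-order regularity of a minimax objective: quadratic error in the linearization, Lipschitz
partial gradients, and the PL inequality in the second variable. -/
structure SmoothPL (f : Vec d₁ → Vec d₂ → ℝ) (l μ Φstar : ℝ) : Prop where
  l_pos : 0 < l
  μ_pos : 0 < μ
  μ_le : μ ≤ l
  cont : Continuous fun w : Vec d₁ × Vec d₂ => f w.1 w.2
  approx : ∀ x y x' y', |f x' y' - f x y - ⟪gradX f x y, x' - x⟫ - ⟪gradY f x y, y' - y⟫|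
    ≤ l / 2 * (‖x' - x‖ + ‖y' - y‖) ^ 2
  lipX : ∀ x y x' y', ‖gradX f x y - gradX f x' y'‖ ≤ l * (‖x - x'‖ + ‖y - y'‖)
  lipY : ∀ x y x' y', ‖gradY f x y - gradY f x' y'‖ ≤ l * (‖x - x'‖ + ‖y - y'‖)
  pl : PLInY f μ
  bdd : ∀ x, Φstar ≤ maxVal f x

variable {f : Vec d₁ → Vec d₂ → ℝ} {l μ Φstar : ℝ}

/-- The gradient in `x` of the smoothed objective with `p = 2 l`. -/
noncomputable def smoothedGradX (f : Vec d₁ → Vec d₂ → ℝ) (l : ℝ) (x : Vec d₁) (y : Vec d₂) (z : Vec d₁) :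
    Vec d₁ := gradX f x y + (2 * l) • (x - z)

theorem norm_sub_sq_expand {E : Type*} [NormedAddCommGroup E] [InnerProductSpace ℝ E]
    (x x' z : E) : ‖x' - z‖ ^ 2 = ‖x - z‖ ^ 2 + 2 * ⟪x - z, x' - x⟫ + ‖x' - x‖ ^ 2 := by
  have : x' - z = (x - z) + (x' - x) := by abel
  rw [this, norm_add_sq_real]

namespace SmoothPL

theorem f_le_maxVal (h : SmoothPL f l μ Φstar) (x : Vec d₁) (y : Vec d₂) : f x y ≤ maxVal f x := by
  obtain ⟨ys, hys⟩ := h.pl.1 x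
  exact le_ciSup ⟨f x ys, by rintro _ ⟨y', rfl⟩; exact hys y'⟩ y

theorem exists_eq_maxVal (h : SmoothPL f l μ Φstar) (x : Vec d₁) : ∃ y, f x y = maxVal f x := by
  obtain ⟨ys, hys⟩ := h.pl.1 x
  exact ⟨ys, le_antisymm (h.f_le_maxVal x ys) (ciSup_le hys)⟩

theorem iSup_smoothed (h : SmoothPL f l μ Φstar) (p : ℝ) (x z : Vec d₁) :
    ⨆ y, smoothed f p x y z = maxVal f x + p / 2 * ‖x - z‖ ^ 2 := by
  obtain ⟨ys, hys⟩ := h.exists_eq_maxVal x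
  have hle : ∀ y, smoothed f p x y z ≤ maxVal f x + p / 2 * ‖x - z‖ ^ 2 := fun y => by
    unfold smoothed; linarith [h.f_le_maxVal x y]
  refine le_antisymm (ciSup_le hle) ?_
  calc _ = smoothed f p x ys z := by unfold smoothed; rw [hys]
    _ ≤ _ := le_ciSup (f := fun y => smoothed f p x y z)
      ⟨_, by rintro _ ⟨y', rfl⟩; exact hle y'⟩ ys

/-- The smoothed objective grows at least like a quadratic with curvature `l`. -/
theorem smoothed_lower (h : SmoothPL f l μ Φstar) (x x' : Vec d₁) (y : Vec d₂) (z : Vec d₁) :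
    smoothed f (2 * l) x y z + ⟪smoothedGradX f l x y z, x' - x⟫ + l / 2 * ‖x' - x‖ ^ 2
      ≤ smoothed f (2 * l) x' y z := by
  have h1 := (abs_le.1 (h.approx x y x' y)).1
  simp only [sub_self, inner_zero_right, norm_zero, add_zero, sub_zero] at h1
  unfold smoothed smoothedGradX
  rw [norm_sub_sq_expand x x' z, inner_add_left, inner_smul_left]
  simp only [conj_trivial]
  linarith

theorem smoothed_upper (h : SmoothPL f l μ Φstar) (x x' : Vec d₁) (y : Vec d₂) (z : Vec d₁) :
    smoothed f (2 * l) x' y z ≤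
      smoothed f (2 * l) x y z + ⟪smoothedGradX f l x y z, x' - x⟫ + 3 * l / 2 * ‖x' - x‖ ^ 2 := by
  have h1 := (abs_le.1 (h.approx x y x' y)).2
  simp only [sub_self, inner_zero_right, norm_zero, add_zero, sub_zero] at h1
  unfold smoothed smoothedGradX
  rw [norm_sub_sq_expand x x' z, inner_add_left, inner_smul_left]
  simp only [conj_trivial]
  linarith

theorem continuous_smoothed (h : SmoothPL f l μ Φstar) (p : ℝ) :
    Continuous fun w : Vec d₁ × Vec d₂ × Vec d₁ => smoothed f p w.1 w.2.1 w.2.2 := by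
  have := h.cont
  have h2 : Continuous fun w : Vec d₁ × Vec d₂ × Vec d₁ => f w.1 w.2.1 :=
    h.cont.comp (continuous_fst.prodMk (continuous_fst.comp continuous_snd))
  unfold smoothed
  fun_prop

theorem exists_compl_norm_bound {l b C : ℝ} (hl : 0 < l) :
    ∃ R : ℝ, 0 ≤ R ∧ ∀ r : ℝ, R < r → C < -b * r + l * r ^ 2 := by
  -- The quotient makes l r exceed |b| + |C| + 1 and the added 1 makes r > 1; multiplying the two
  -- gives l r² - b r > C.
  refine ⟨(|b| + |C| + 1) / l + 1, by positivity, fun r hr => ?_⟩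
  have h0 : 0 ≤ (|b| + |C| + 1) / l := by positivity
  have h1 : 1 < r := by linarith
  have h2 : |b| + |C| + 1 < l * r := by
    have : (|b| + |C| + 1) / l < r := by linarith
    rw [div_lt_iff₀ hl] at this; linarith
  have h3 := le_abs_self b
  have h4 := le_abs_self C
  have h5 := abs_nonneg C
  nlinarith [mul_lt_mul_of_pos_right h2 (by linarith : 0 < r)]

/-- A lower semicontinuous function with quadratic growth has a minimizer. -/
theorem exists_minimizer_of_growth {F : Vec d₁ → ℝ} (hF : LowerSemicontinuous F) {l b A : ℝ}
    (hl : 0 < l) (z : Vec d₁) (hgrow : ∀ x, A - b * ‖x - z‖ + l * ‖x - z‖ ^ 2 ≤ F x) :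
    ∃ xs, ∀ x, F xs ≤ F x := by
  obtain ⟨R, hR0, hR⟩ := exists_compl_norm_bound (b := b) (C := F z - A) hl
  obtain ⟨xs, -, hmin⟩ := LowerSemicontinuousOn.exists_isMinOn (s := Metric.closedBall z R) (f := F)
    ⟨z, Metric.mem_closedBall_self hR0⟩ (isCompact_closedBall z R) (hF.lowerSemicontinuousOn _)
  refine ⟨xs, fun x => ?_⟩
  by_cases hx : x ∈ Metric.closedBall z R
  · exact hmin hx
  · rw [Metric.mem_closedBall, dist_eq_norm, not_le] at hx
    have h1 := hR _ hx
    have h2 := hgrow x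
    have h3 : F xs ≤ F z := hmin (Metric.mem_closedBall_self hR0)
    linarith

theorem exists_minimizer (h : SmoothPL f l μ Φstar) (y : Vec d₂) (z : Vec d₁) :
    ∃ xs, ∀ x, smoothed f (2 * l) xs y z ≤ smoothed f (2 * l) x y z := by
  have hc : Continuous fun x : Vec d₁ => smoothed f (2 * l) x y z :=
    (h.continuous_smoothed (2 * l)).comp
      (continuous_id.prodMk (continuous_const (y := (y, z))))
  refine exists_minimizer_of_growth hc.lowerSemicontinuous (l := l / 2)
    (b := ‖smoothedGradX f l z y z‖) (A := smoothed f (2 * l) z y z) (half_pos h.l_pos) z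
    fun x => ?_
  have h1 := h.smoothed_lower z x y z
  have h2 := neg_le_of_abs_le (abs_real_inner_le_norm (smoothedGradX f l z y z) (x - z))
  linarith

theorem grad_eq_zero_of_minimizer (h : SmoothPL f l μ Φstar) {y : Vec d₂} {z xs : Vec d₁}
    (hxs : ∀ x, smoothed f (2 * l) xs y z ≤ smoothed f (2 * l) x y z) :
    smoothedGradX f l xs y z = 0 := by
  set u := smoothedGradX f l xs y z
  have hl := h.l_pos
  -- The step 1/(3l) minimizes the upper quadratic model; it would lower the value by ‖u‖²/(6l),
  -- which minimality forbids unless u = 0.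
  have h1 := h.smoothed_upper xs (xs - (1 / (3 * l)) • u) y z
  have h2 := hxs (xs - (1 / (3 * l)) • u)
  rw [sub_sub_cancel_left, inner_neg_right, inner_smul_right, norm_neg, norm_smul,
    real_inner_self_eq_norm_sq, mul_pow, Real.norm_eq_abs, sq_abs] at h1
  have h3 : 3 * l / 2 * ((1 / (3 * l)) ^ 2 * ‖u‖ ^ 2) = (1 / (3 * l) * ‖u‖ ^ 2) / 2 := by
    field_simp
  have h4 : 1 / (3 * l) * ‖u‖ ^ 2 ≤ 0 := by linarith
  have h5 : ‖u‖ ^ 2 ≤ 0 := by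
    by_contra hc
    have : 0 < 1 / (3 * l) * ‖u‖ ^ 2 := mul_pos (by positivity) (not_le.1 hc)
    linarith
  have h6 : ‖u‖ = 0 := by nlinarith [norm_nonneg u]
  exact norm_eq_zero.1 h6

theorem minimizer_growth (h : SmoothPL f l μ Φstar) {y : Vec d₂} {z xs : Vec d₁}
    (hxs : ∀ x, smoothed f (2 * l) xs y z ≤ smoothed f (2 * l) x y z) (x : Vec d₁) :
    smoothed f (2 * l) xs y z + l / 2 * ‖x - xs‖ ^ 2 ≤ smoothed f (2 * l) x y z := by
  have := h.smoothed_lower xs x y z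
  rw [h.grad_eq_zero_of_minimizer hxs, inner_zero_left] at this
  linarith

theorem lowerSemicontinuous_maxVal (h : SmoothPL f l μ Φstar) :
    LowerSemicontinuous (maxVal f) := by
  refine lowerSemicontinuous_ciSup (fun x => ?_) (fun y => ?_)
  · exact ⟨maxVal f x, by rintro _ ⟨y, rfl⟩; exact h.f_le_maxVal x y⟩
  · exact (h.cont.comp (continuous_id.prodMk continuous_const)).lowerSemicontinuous

theorem exists_minimizer_max (h : SmoothPL f l μ Φstar) (z : Vec d₁) :
    ∃ xs, ∀ x, maxVal f xs + l * ‖xs - z‖ ^ 2 ≤ maxVal f x + l * ‖x - z‖ ^ 2 := by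
  refine exists_minimizer_of_growth (F := fun x => maxVal f x + l * ‖x - z‖ ^ 2) ?_ (l := l)
    (b := 0) (A := Φstar) h.l_pos z fun x => ?_
  · refine h.lowerSemicontinuous_maxVal.add (Continuous.lowerSemicontinuous ?_)
    fun_prop
  · have := h.bdd x
    simpa using this

/-- A supremum of strongly convex functions is strongly convex. Evaluating at the midpoint w with a
maximizer `ys` of f(w, ·) makes the linear terms towards the two ends cancel, so `maxVal f` is never
differentiated. The price is the modulus l/4 instead of l/2. -/
theorem minimizer_max_growth (h : SmoothPL f l μ Φstar) {z xs : Vec d₁}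
    (hxs : ∀ x, maxVal f xs + l * ‖xs - z‖ ^ 2 ≤ maxVal f x + l * ‖x - z‖ ^ 2) (x : Vec d₁) :
    maxVal f xs + l * ‖xs - z‖ ^ 2 + l / 4 * ‖x - xs‖ ^ 2 ≤ maxVal f x + l * ‖x - z‖ ^ 2 := by
  set w : Vec d₁ := (1 / 2 : ℝ) • (x + xs) with hw
  obtain ⟨ys, hys⟩ := h.exists_eq_maxVal w
  have h1 := h.smoothed_lower w x ys z
  have h2 := h.smoothed_lower w xs ys z
  have e1 : x - w = (1 / 2 : ℝ) • (x - xs) := by rw [hw]; module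
  have e2 : xs - w = -((1 / 2 : ℝ) • (x - xs)) := by rw [hw]; module
  rw [e1, norm_smul] at h1
  rw [e2, inner_neg_right, norm_neg, norm_smul] at h2
  norm_num [mul_pow] at h1 h2
  have h3 := hxs w
  have h4 := h.f_le_maxVal x ys
  have h5 := h.f_le_maxVal xs ys
  unfold smoothed at h1 h2
  rw [hys] at h1 h2
  nlinarith

/-- Error bound: the PL inequality controls the distance between the two proximal points. -/
theorem error_bound (h : SmoothPL f l μ Φstar) {y : Vec d₂} {z xs xm : Vec d₁}
    (hxs : ∀ x, smoothed f (2 * l) xs y z ≤ smoothed f (2 * l) x y z)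
    (hxm : ∀ x, maxVal f xm + l * ‖xm - z‖ ^ 2 ≤ maxVal f x + l * ‖x - z‖ ^ 2) :
    μ * l * ‖xs - xm‖ ^ 2 ≤ ‖gradY f xs y‖ ^ 2 := by
  have h1 := h.minimizer_max_growth hxm xs
  have h2 := h.minimizer_growth hxs xm
  have h3 := h.f_le_maxVal xm y
  have h4 := h.pl.2 xs y
  have hl := h.l_pos
  have hμ := h.μ_pos
  unfold smoothed at h2
  rw [norm_sub_rev xm xs] at h2
  -- The growth l/4 of the max problem around `xm` and the growth l/2 of f̂ around `xs` add up;
  -- f(xm, y) ≤ Φ(xm) removes everything except the PL gap at `xs`.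
  have h5 : 3 * l / 4 * ‖xs - xm‖ ^ 2 ≤ maxVal f xs - f xs y := by linarith
  have h6 := mul_le_mul_of_nonneg_left h5 hμ.le
  have h7 : 0 ≤ μ * l * ‖xs - xm‖ ^ 2 := by positivity
  linarith

/-- The term 2l(x - xs) in the difference of the two gradients dominates the change of ∇ₓf, which is
at most l‖x - xs‖. -/
theorem norm_sub_minimizer_le (h : SmoothPL f l μ Φstar) {y : Vec d₂} {z xs : Vec d₁}
    (hxs : ∀ x, smoothed f (2 * l) xs y z ≤ smoothed f (2 * l) x y z) (x : Vec d₁) :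
    l * ‖x - xs‖ ≤ ‖smoothedGradX f l x y z‖ := by
  have h0 := h.grad_eq_zero_of_minimizer hxs
  have h1 : (2 * l) • (x - xs) =
      smoothedGradX f l x y z - (gradX f x y - gradX f xs y) - smoothedGradX f l xs y z := by
    unfold smoothedGradX; module
  rw [h0, sub_zero] at h1
  have h2 := norm_sub_le (smoothedGradX f l x y z) (gradX f x y - gradX f xs y)
  rw [← h1, norm_smul, Real.norm_of_nonneg (by linarith [h.l_pos])] at h2
  have h3 := h.lipX x y xs y
  rw [sub_self, norm_zero, add_zero] at h3
  linarith

theorem minimizer_lipschitz (h : SmoothPL f l μ Φstar) {y y' : Vec d₂} {z z' xs xs' : Vec d₁}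
    (hxs : ∀ x, smoothed f (2 * l) xs y z ≤ smoothed f (2 * l) x y z)
    (hxs' : ∀ x, smoothed f (2 * l) xs' y' z' ≤ smoothed f (2 * l) x y' z') :
    ‖xs' - xs‖ ≤ ‖y' - y‖ + 2 * ‖z' - z‖ := by
  have h0 := h.grad_eq_zero_of_minimizer hxs
  have h0' := h.grad_eq_zero_of_minimizer hxs'
  have hl := h.l_pos
  have h1 : (2 * l) • (xs' - xs) = (2 * l) • (z' - z) - (gradX f xs' y' - gradX f xs y)
      + (smoothedGradX f l xs' y' z' - smoothedGradX f l xs y z) := by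
    unfold smoothedGradX; module
  rw [h0, h0', sub_zero, add_zero] at h1
  have h2 := norm_sub_le ((2 * l) • (z' - z)) (gradX f xs' y' - gradX f xs y)
  rw [← h1, norm_smul, norm_smul, Real.norm_of_nonneg (by linarith)] at h2
  have h3 := h.lipX xs' y' xs y
  have h4 : l * ‖xs' - xs‖ ≤ l * (‖y' - y‖ + 2 * ‖z' - z‖) := by linarith
  exact le_of_mul_le_mul_left h4 hl

theorem iInf_smoothed {y : Vec d₂} {z xs : Vec d₁}
    (hxs : ∀ x, smoothed f (2 * l) xs y z ≤ smoothed f (2 * l) x y z) :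
    ⨅ x, smoothed f (2 * l) x y z = smoothed f (2 * l) xs y z :=
  le_antisymm (ciInf_le ⟨_, by rintro _ ⟨x, rfl⟩; exact hxs x⟩ xs) (le_ciInf hxs)

theorem iInf_iSup_smoothed (h : SmoothPL f l μ Φstar) {z xm : Vec d₁}
    (hxm : ∀ x, maxVal f xm + l * ‖xm - z‖ ^ 2 ≤ maxVal f x + l * ‖x - z‖ ^ 2) :
    ⨅ x, ⨆ y, smoothed f (2 * l) x y z = maxVal f xm + l * ‖xm - z‖ ^ 2 := by
  have e : ∀ x, ⨆ y, smoothed f (2 * l) x y z = maxVal f x + l * ‖x - z‖ ^ 2 := fun x => by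
    rw [h.iSup_smoothed]; ring
  simp only [e]
  exact le_antisymm (ciInf_le ⟨_, by rintro _ ⟨x, rfl⟩; exact hxm x⟩ xm) (le_ciInf hxm)

/-- Write V = (f̂ - Ψ) + (P - Ψ) + P: the brackets are nonnegative and P ≥ Φ*. -/
theorem le_potential (h : SmoothPL f l μ Φstar) (x : Vec d₁) (y : Vec d₂) (z : Vec d₁) :
    Φstar ≤ potential f (2 * l) x y z := by
  obtain ⟨xs, hxs⟩ := h.exists_minimizer y z
  obtain ⟨xm, hxm⟩ := h.exists_minimizer_max z
  unfold potential
  rw [iInf_smoothed hxs, h.iInf_iSup_smoothed hxm]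
  have h1 := hxs x
  have h2 := hxs xm
  have h3 := h.f_le_maxVal xm y
  have h4 := h.bdd xm
  have h5 : 0 ≤ l * ‖xm - z‖ ^ 2 := mul_nonneg h.l_pos.le (sq_nonneg _)
  unfold smoothed at *
  linarith

/-- An infimum of continuous functions is upper semicontinuous, hence measurable. For P the inner
supremum is first evaluated, which leaves for each fixed x a function continuous in z. -/
theorem measurable_potential (h : SmoothPL f l μ Φstar) :
    Measurable fun w : Vec d₁ × Vec d₂ × Vec d₁ => potential f (2 * l) w.1 w.2.1 w.2.2 := by
  unfold potential
  have hc := h.continuous_smoothed (2 * l)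
  refine (hc.measurable.sub (Measurable.const_mul ?_ 2)).add (Measurable.const_mul ?_ 2)
  · refine UpperSemicontinuous.measurable (upperSemicontinuous_ciInf (fun w => ?_) fun x => ?_)
    · obtain ⟨xs, hxs⟩ := h.exists_minimizer w.2.1 w.2.2
      exact ⟨_, by rintro _ ⟨x, rfl⟩; exact hxs x⟩
    · exact (hc.comp (continuous_const.prodMk continuous_snd)).upperSemicontinuous
  · have e : ∀ x z, ⨆ y, smoothed f (2 * l) x y z = maxVal f x + 2 * l / 2 * ‖x - z‖ ^ 2 :=
      fun x z => h.iSup_smoothed _ x z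
    simp only [e]
    refine UpperSemicontinuous.measurable (upperSemicontinuous_ciInf (fun w => ?_) fun x => ?_)
    · obtain ⟨xs, hxs⟩ := h.exists_minimizer_max w.2.2
      refine ⟨maxVal f xs + l * ‖xs - w.2.2‖ ^ 2, ?_⟩
      rintro _ ⟨x, rfl⟩
      have := hxs x
      dsimp only
      linarith
    · refine Continuous.upperSemicontinuous ?_
      fun_prop

theorem smoothed_step_le (h : SmoothPL f l μ Φstar) (β : ℝ) (x x' z : Vec d₁) (y y' : Vec d₂) :
    smoothed f (2 * l) x' y' (z + β • (x' - z)) ≤ smoothed f (2 * l) x y z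
      + ⟪smoothedGradX f l x y z, x' - x⟫ + ⟪gradY f x y, y' - y⟫
      + 2 * l * ‖x' - x‖ ^ 2 + l * ‖y' - y‖ ^ 2 + l * ((1 - β) ^ 2 - 1) * ‖x' - z‖ ^ 2 := by
  have h1 := (abs_le.1 (h.approx x y x' y')).2
  have h2 := norm_sub_sq_expand x x' z
  have h3 : x' - (z + β • (x' - z)) = (1 - β) • (x' - z) := by module
  have h4 : ‖x' - (z + β • (x' - z))‖ ^ 2 = (1 - β) ^ 2 * ‖x' - z‖ ^ 2 := by
    rw [h3, norm_smul, mul_pow, Real.norm_eq_abs, sq_abs]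
  have h5 : ⟪smoothedGradX f l x y z, x' - x⟫ = ⟪gradX f x y, x' - x⟫
      + 2 * l * ⟪x - z, x' - x⟫ := by
    unfold smoothedGradX; rw [inner_add_left, inner_smul_left]; simp
  unfold smoothed
  rw [h4, h5]
  have h6 : (‖x' - x‖ + ‖y' - y‖) ^ 2 ≤ 2 * ‖x' - x‖ ^ 2 + 2 * ‖y' - y‖ ^ 2 := by
    linarith [sq_nonneg (‖x' - x‖ - ‖y' - y‖)]
  have h7 := mul_le_mul_of_nonneg_left h6 (half_pos h.l_pos).le
  have h8 := congrArg (l * ·) h2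
  linarith

/-- With x' the new minimizer this is a one-sided Danskin estimate: Ψ changes in y at rate ∇_y f(xs,
y), up to a quadratic error. At `xs` the x-gradient of f̂ for the new y' is only the increment of
∇ₓf, of size l‖y' - y‖, and Young's inequality absorbs it into the curvature l/2. -/
theorem smoothed_minimizer_step_ge (h : SmoothPL f l μ Φstar) {x' z z' xs : Vec d₁} {y y' : Vec d₂}
    (hxs : ∀ x, smoothed f (2 * l) xs y z ≤ smoothed f (2 * l) x y z) :
    smoothed f (2 * l) xs y z + ⟪gradY f xs y, y' - y⟫ - l * ‖y' - y‖ ^ 2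
      + l * (‖x' - z'‖ ^ 2 - ‖x' - z‖ ^ 2) ≤ smoothed f (2 * l) x' y' z' := by
  have h1 := h.smoothed_lower xs x' y' z
  have h2 : smoothedGradX f l xs y' z = gradX f xs y' - gradX f xs y := by
    have := h.grad_eq_zero_of_minimizer hxs
    rw [← sub_zero (smoothedGradX f l xs y' z), ← this]; unfold smoothedGradX; module
  have h3 := neg_le_of_abs_le
    (abs_real_inner_le_norm (smoothedGradX f l xs y' z) (x' - xs))
  have h4 : ‖smoothedGradX f l xs y' z‖ ≤ l * ‖y' - y‖ := by
    rw [h2]; simpa using h.lipX xs y' xs y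
  have h5 := mul_le_mul_of_nonneg_right h4 (norm_nonneg (x' - xs))
  have h6 := (abs_le.1 (h.approx xs y xs y')).1
  simp only [sub_self, inner_zero_right, norm_zero, zero_add, sub_zero] at h6
  have h7 : l * (‖y' - y‖ * ‖x' - xs‖) ≤ l * ((‖y' - y‖ ^ 2 + ‖x' - xs‖ ^ 2) / 2) :=
    mul_le_mul_of_nonneg_left (by linarith [sq_nonneg (‖y' - y‖ - ‖x' - xs‖)]) h.l_pos.le
  unfold smoothed at *
  linarith

/-- The map v ↦ ‖v - z'‖² - ‖v - z‖² is affine, so the left side equals 2⟪xs' - xm, z' - z⟫. This is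
how the shift of z enters 2P - 2Ψ. -/
theorem prox_cross_term_le (h : SmoothPL f l μ Φstar) {z z' xs xs' xm : Vec d₁} {y y' : Vec d₂}
    (hxs : ∀ x, smoothed f (2 * l) xs y z ≤ smoothed f (2 * l) x y z)
    (hxs' : ∀ x, smoothed f (2 * l) xs' y' z' ≤ smoothed f (2 * l) x y' z') :
    (‖xm - z'‖ ^ 2 - ‖xm - z‖ ^ 2) - (‖xs' - z'‖ ^ 2 - ‖xs' - z‖ ^ 2)
      ≤ 2 * (‖z' - z‖ * (‖y' - y‖ + 2 * ‖z' - z‖ + ‖xs - xm‖)) := by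
  have e : ∀ v : Vec d₁, ‖v - z'‖ ^ 2 - ‖v - z‖ ^ 2 = ‖z' - z‖ ^ 2 - 2 * ⟪v - z, z' - z⟫ := by
    intro v
    have : v - z' = (v - z) - (z' - z) := by abel
    rw [this, norm_sub_sq_real]; ring
  have e2 : xs' - z - (xm - z) = (xs' - xs) + (xs - xm) := by abel
  have h1 : ⟪xs' - z, z' - z⟫ - ⟪xm - z, z' - z⟫
      ≤ ‖z' - z‖ * (‖y' - y‖ + 2 * ‖z' - z‖ + ‖xs - xm‖) := by
    rw [← inner_sub_left, e2]
    refine (real_inner_le_norm _ _).trans ?_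
    rw [mul_comm]
    refine mul_le_mul_of_nonneg_left ?_ (norm_nonneg _)
    have h2 := norm_add_le (xs' - xs) (xs - xm)
    have h3 := h.minimizer_lipschitz hxs hxs'
    linarith
  rw [e, e]
  linarith

/-- Here r = ‖x' - z‖, D = ‖y' - y‖ and d = ‖xs - xm‖. Of the decrease -2lβr², about half is spent
on the cross term and lβr² is kept. -/
theorem step_scalar_bound {l β r D d : ℝ} (hl : 0 < l) (hβ : 0 < β) (hβ1 : β ≤ 1 / 100) :
    l * ((1 - β) ^ 2 - 1) * r ^ 2 + 4 * l * (β * r * (D + 2 * (β * r) + d))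
      ≤ l * D ^ 2 - l * β * r ^ 2 + 16 * l * β * d ^ 2 := by
  have hlβ : 0 < l * β := mul_pos hl hβ
  have hD1 : l * β * (4 * r * D) ≤ l * β * (r ^ 2 / 4 + 16 * D ^ 2) :=
    mul_le_mul_of_nonneg_left (by linarith [sq_nonneg (r / 2 - 4 * D)]) hlβ.le
  have hd1 : l * β * (4 * r * d) ≤ l * β * (r ^ 2 / 4 + 16 * d ^ 2) :=
    mul_le_mul_of_nonneg_left (by linarith [sq_nonneg (r / 2 - 4 * d)]) hlβ.le
  have hb2 : l * β * (β * r ^ 2) ≤ l * β * (1 / 100 * r ^ 2) :=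
    mul_le_mul_of_nonneg_left (mul_le_mul_of_nonneg_right hβ1 (sq_nonneg _)) hlβ.le
  have hβD : l * D ^ 2 * (16 * β) ≤ l * D ^ 2 * 1 :=
    mul_le_mul_of_nonneg_left (by linarith) (by positivity)
  have hr2 : 0 ≤ l * β * r ^ 2 := by positivity
  linarith

/-- Effect on the potential of replacing `(x, y)` by `(x', y')` and `z` by `z + β (x' - z)`. -/
theorem potential_step (h : SmoothPL f l μ Φstar) {β : ℝ} (hβ : 0 < β) (hβ1 : β ≤ 1 / 100)
    {x z xs : Vec d₁} {y : Vec d₂}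
    (hxs : ∀ x, smoothed f (2 * l) xs y z ≤ smoothed f (2 * l) x y z)
    (x' : Vec d₁) (y' : Vec d₂) :
    potential f (2 * l) x' y' (z + β • (x' - z)) ≤ potential f (2 * l) x y z
      + ⟪smoothedGradX f l x y z, x' - x⟫
      + ⟪gradY f x y - (2 : ℝ) • gradY f xs y, y' - y⟫
      + 2 * l * ‖x' - x‖ ^ 2 + 4 * l * ‖y' - y‖ ^ 2 - l * β * ‖x' - z‖ ^ 2
      + 16 * β / μ * ‖gradY f xs y‖ ^ 2 := by
  have hl := h.l_pos
  have hμ := h.μ_pos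
  have hfhat := h.smoothed_step_le β x x' z y y'
  have hΔz : ‖z + β • (x' - z) - z‖ = β * ‖x' - z‖ := by
    rw [add_sub_cancel_left, norm_smul, Real.norm_of_nonneg hβ.le]
  generalize z + β • (x' - z) = z' at *
  obtain ⟨xs', hxs'⟩ := h.exists_minimizer y' z'
  obtain ⟨xm, hxm⟩ := h.exists_minimizer_max z
  obtain ⟨xm', hxm'⟩ := h.exists_minimizer_max z'
  have hpsi := h.smoothed_minimizer_step_ge (x' := xs') (y' := y') (z' := z') hxs
  have hcross := h.prox_cross_term_le (xm := xm) hxs hxs'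
  -- The old point `xm` as competitor at z' bounds P(z') from above.
  have hP := hxm' xm
  have herr : 16 * l * β * ‖xs - xm‖ ^ 2 ≤ 16 * β / μ * ‖gradY f xs y‖ ^ 2 := by
    have h1 := h.error_bound hxs hxm
    rw [div_mul_eq_mul_div, le_div_iff₀ hμ]
    have := mul_le_mul_of_nonneg_left h1 (by positivity : 0 ≤ 16 * β)
    linarith
  have hinner : ⟪gradY f x y - (2 : ℝ) • gradY f xs y, y' - y⟫
      = ⟪gradY f x y, y' - y⟫ - 2 * ⟪gradY f xs y, y' - y⟫ := by
    rw [inner_sub_left, inner_smul_left]; simp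
  rw [hΔz] at hcross
  have hsc := step_scalar_bound (r := ‖x' - z‖) (D := ‖y' - y‖) (d := ‖xs - xm‖) hl hβ hβ1
  have hcross' := mul_le_mul_of_nonneg_left hcross hl.le
  unfold potential
  rw [iInf_smoothed hxs, iInf_smoothed hxs', h.iInf_iSup_smoothed hxm,
    h.iInf_iSup_smoothed hxm', hinner]
  linarith

end SmoothPL

theorem norm_add_three_sq_le {E : Type*} [SeminormedAddCommGroup E] (A B C : E) :
    ‖A + B + C‖ ^ 2 ≤ 3 * (‖A‖ ^ 2 + ‖B‖ ^ 2 + ‖C‖ ^ 2) := by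
  have h1 := norm_add₃_le (a := A) (b := B) (c := C)
  have h2 := pow_le_pow_left₀ (norm_nonneg _) h1 2
  linarith [sq_nonneg (‖A‖ - ‖B‖), sq_nonneg (‖B‖ - ‖C‖), sq_nonneg (‖A‖ - ‖C‖)]

theorem norm_add_sq_le_two {E : Type*} [SeminormedAddCommGroup E] (A B : E) :
    ‖A + B‖ ^ 2 ≤ 2 * ‖A‖ ^ 2 + 2 * ‖B‖ ^ 2 := by
  have h2 := pow_le_pow_left₀ (norm_nonneg _) (norm_add_le A B) 2
  linarith [sq_nonneg (‖A‖ - ‖B‖)]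

theorem norm_sub_sq_le_two {E : Type*} [SeminormedAddCommGroup E] (A B : E) :
    ‖A - B‖ ^ 2 ≤ 2 * ‖A‖ ^ 2 + 2 * ‖B‖ ^ 2 := by
  simpa [sub_eq_add_neg] using norm_add_sq_le_two A (-B)

namespace SmoothPL

/-- Descent of the potential along an inexact step. The error of the search direction is the sum
of a noise part `A`, a bias part `B` and a sampling part `C`. -/
theorem potential_descent (h : SmoothPL f l μ Φstar) {a b β : ℝ} (ha : 0 < a)
    (ha1 : a * (1000 * l) ≤ 1) (hb : b = a / 256) (hβ : β = b * μ / 80000)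
    {x z xs : Vec d₁} {y : Vec d₂}
    (hxs : ∀ x, smoothed f (2 * l) xs y z ≤ smoothed f (2 * l) x y z)
    {x' Ax Bx Cx : Vec d₁} {y' Ay By Cy : Vec d₂}
    (hx' : x' = x - a • (smoothedGradX f l x y z + (Ax + Bx + Cx)))
    (hy' : y' = y + b • (gradY f x y + (Ay + By + Cy))) :
    potential f (2 * l) x' y' (z + β • (x' - z)) ≤ potential f (2 * l) x y z
      - a / 2 * ‖smoothedGradX f l x y z‖ ^ 2 - b / 4 * ‖gradY f x y‖ ^ 2
      - l * β / 2 * ‖x - z‖ ^ 2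
      - a * ⟪smoothedGradX f l x y z, Ax + Cx⟫
      + b * ⟪gradY f x y - (2 : ℝ) • gradY f xs y, Ay + Cy⟫
      + 2 * a * (‖Bx‖ ^ 2 + ‖By‖ ^ 2)
      + 18 * l * a ^ 2 * (‖Ax‖ ^ 2 + ‖Ay‖ ^ 2 + (‖Cx‖ ^ 2 + ‖Cy‖ ^ 2)) := by
  have hl := h.l_pos
  have hμ := h.μ_pos
  have hb0 : 0 < b := by rw [hb]; positivity
  have hβ0 : 0 < β := by rw [hβ]; positivity
  have hβ1 : β ≤ 1 / 100 := by
    rw [hβ, hb]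
    have := mul_le_mul_of_nonneg_left h.μ_le ha.le
    linarith
  have hstep := h.potential_step (x := x) hβ0 hβ1 hxs x' y'
  have hdist := h.norm_sub_minimizer_le hxs x
  have hlip := h.lipY x y xs y
  generalize smoothedGradX f l x y z = u at *
  generalize gradY f x y = g at *
  generalize gradY f xs y = G at *
  -- This lets ∇_y f at the proximal point be exchanged for ∇_y f at x, at the cost of ‖∇ₓf̂‖.
  have hgG : ‖g - G‖ ≤ ‖u‖ := by
    rw [sub_self, norm_zero, add_zero] at hlip
    exact hlip.trans hdist
  have hΔx : x' - x = -(a • (u + (Ax + Bx + Cx))) := by rw [hx']; abel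
  have hΔy : y' - y = b • (g + (Ay + By + Cy)) := by rw [hy']; abel
  -- Only the bias B is estimated by Young's inequality. A and C stay linear, because their
  -- contributions vanish in expectation.
  have h1 : ⟪u, x' - x⟫ ≤ -(3 / 4) * (a * ‖u‖ ^ 2) - a * ⟪u, Ax + Cx⟫ + a * ‖Bx‖ ^ 2 := by
    have e : u + (Ax + Bx + Cx) = u + (Ax + Cx) + Bx := by abel
    rw [hΔx, inner_neg_right, inner_smul_right, e, inner_add_right, inner_add_right,
      real_inner_self_eq_norm_sq]
    have h2 := neg_le_of_abs_le (abs_real_inner_le_norm u Bx)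
    have h3 : -⟪u, Bx⟫ ≤ ‖u‖ ^ 2 / 4 + ‖Bx‖ ^ 2 := by linarith [sq_nonneg (‖u‖ / 2 - ‖Bx‖)]
    have h4 := mul_le_mul_of_nonneg_left h3 ha.le
    linarith
  -- Since g - 2G = 2(g - G) - g, the step along g yields -b‖g‖² plus multiples of b‖u‖², which the
  -- descent a‖u‖² pays for because b = a/256.
  have h2 : ⟪g - (2 : ℝ) • G, y' - y⟫ ≤ -(3 / 8) * (b * ‖g‖ ^ 2) + 3 * (b * ‖u‖ ^ 2)
      + b * ⟪g - (2 : ℝ) • G, Ay + Cy⟫ + 3 * (b * ‖By‖ ^ 2) := by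
    have e : g + (Ay + By + Cy) = g + By + (Ay + Cy) := by abel
    have e2 : g - (2 : ℝ) • G = (2 : ℝ) • (g - G) - g := by module
    have hU := pow_le_pow_left₀ (norm_nonneg _) hgG 2
    have h3 : ⟪g - (2 : ℝ) • G, g⟫ ≤ -(1 / 2) * ‖g‖ ^ 2 + 2 * ‖u‖ ^ 2 := by
      rw [e2, inner_sub_left, inner_smul_left, real_inner_self_eq_norm_sq]
      simp only [conj_trivial]
      have := real_inner_le_norm (g - G) g
      linarith [sq_nonneg (2 * ‖g - G‖ - ‖g‖)]
    have h4 : ⟪g - (2 : ℝ) • G, By⟫ ≤ 1 / 8 * ‖g‖ ^ 2 + ‖u‖ ^ 2 + 3 * ‖By‖ ^ 2 := by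
      rw [e2, inner_sub_left, inner_smul_left]
      simp only [conj_trivial]
      have h5 := real_inner_le_norm (g - G) By
      have h6 := neg_le_of_abs_le (abs_real_inner_le_norm g By)
      linarith [sq_nonneg (‖g - G‖ - ‖By‖), sq_nonneg (‖g‖ / 2 - 2 * ‖By‖),
        sq_nonneg (‖g‖ / 2 - ‖By‖), sq_nonneg ‖By‖]
    rw [hΔy, inner_smul_right, e, inner_add_right, inner_add_right]
    have h5 := mul_le_mul_of_nonneg_left (add_le_add h3 h4) hb0.le
    linarith
  have h3 : ‖x' - x‖ ^ 2 ≤ a ^ 2 * (2 * ‖u‖ ^ 2 + 6 * (‖Ax‖ ^ 2 + ‖Bx‖ ^ 2 + ‖Cx‖ ^ 2)) := by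
    rw [hΔx, norm_neg, norm_smul, mul_pow, Real.norm_eq_abs, sq_abs]
    refine mul_le_mul_of_nonneg_left ?_ (sq_nonneg _)
    linarith [norm_add_sq_le_two u (Ax + Bx + Cx), norm_add_three_sq_le Ax Bx Cx]
  have h4 : ‖y' - y‖ ^ 2 ≤ b ^ 2 * (2 * ‖g‖ ^ 2 + 6 * (‖Ay‖ ^ 2 + ‖By‖ ^ 2 + ‖Cy‖ ^ 2)) := by
    rw [hΔy, norm_smul, mul_pow, Real.norm_eq_abs, sq_abs]
    refine mul_le_mul_of_nonneg_left ?_ (sq_nonneg _)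
    linarith [norm_add_sq_le_two g (Ay + By + Cy), norm_add_three_sq_le Ay By Cy]
  -- The choice β = bμ/80000 turns the error-bound term into (b/5000)‖G‖².
  have h5 : 16 * β / μ * ‖G‖ ^ 2 ≤ 1 / 2500 * (b * ‖g‖ ^ 2 + b * ‖u‖ ^ 2) := by
    have e : 16 * β / μ = b / 5000 := by rw [hβ]; field_simp; norm_num
    have h6 : ‖G‖ ^ 2 ≤ 2 * ‖g‖ ^ 2 + 2 * ‖u‖ ^ 2 := by
      have h7 := norm_sub_sq_le_two g (g - G)
      rw [sub_sub_cancel] at h7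
      have := pow_le_pow_left₀ (norm_nonneg _) hgG 2
      linarith
    rw [e]
    have := mul_le_mul_of_nonneg_left h6 (by positivity : 0 ≤ b / 5000)
    linarith
  have h6 : ‖x - z‖ ^ 2 ≤ 2 * ‖x' - z‖ ^ 2 + 2 * ‖x' - x‖ ^ 2 := by
    have := norm_sub_sq_le_two (x' - z) (x' - x)
    rwa [sub_sub_sub_cancel_left] at this
  have h7 := mul_le_mul_of_nonneg_left h6 (by positivity : 0 ≤ l * β / 2)
  have h8 : l * β * ‖x' - x‖ ^ 2 ≤ l * ‖x' - x‖ ^ 2 :=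
    mul_le_mul_of_nonneg_right (by nlinarith) (sq_nonneg _)
  have h9 := mul_le_mul_of_nonneg_left h3 (by positivity : 0 ≤ 3 * l)
  have h10 := mul_le_mul_of_nonneg_left h4 (by positivity : 0 ≤ 4 * l)
  -- By the bound on a, second-order terms cost at most a thousandth of first-order ones.
  have hq : ∀ w : ℝ, 0 ≤ w → l * a ^ 2 * w ≤ a * w / 1000 := fun w hw => by
    have := mul_le_mul_of_nonneg_left ha1 (mul_nonneg ha.le hw)
    linarith
  have hq1 := hq _ (sq_nonneg ‖u‖)
  have hq2 := hq _ (sq_nonneg ‖g‖)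
  have hq3 := hq _ (sq_nonneg ‖Bx‖)
  have hq4 := hq _ (sq_nonneg ‖By‖)
  have p1 : 0 ≤ l * a ^ 2 * ‖Ay‖ ^ 2 := by positivity
  have p2 : 0 ≤ l * a ^ 2 * ‖Cy‖ ^ 2 := by positivity
  have p3 : 0 ≤ a * ‖u‖ ^ 2 := by positivity
  have p4 : 0 ≤ a * ‖g‖ ^ 2 := by positivity
  have p5 : 0 ≤ a * ‖Bx‖ ^ 2 := by positivity
  have p6 : 0 ≤ a * ‖By‖ ^ 2 := by positivity
  clear hq hx' hy' hβ
  subst hb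
  linarith

end SmoothPL

end Deterministic

end FedMinimax

namespace FedMinimax

open scoped RealInnerProductSpace

/-! ### From smoothness of the clients to smoothness of the average. -/

section Regularity

variable {d₁ d₂ : ℕ}

theorem hasGradientAt_gradX {g : Vec d₁ → Vec d₂ → ℝ}
    (hg : Differentiable ℝ fun w : Vec d₁ × Vec d₂ => g w.1 w.2) (x : Vec d₁) (y : Vec d₂) :
    HasGradientAt (fun x' => g x' y) (gradX g x y) x := by
  refine DifferentiableAt.hasGradientAt ?_
  have : Differentiable ℝ fun x' : Vec d₁ => (x', y) := by fun_prop
  exact (hg.comp this) x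

theorem hasGradientAt_gradY {g : Vec d₁ → Vec d₂ → ℝ}
    (hg : Differentiable ℝ fun w : Vec d₁ × Vec d₂ => g w.1 w.2) (x : Vec d₁) (y : Vec d₂) :
    HasGradientAt (fun y' => g x y') (gradY g x y) y := by
  refine DifferentiableAt.hasGradientAt ?_
  have : Differentiable ℝ fun y' : Vec d₂ => (x, y') := by fun_prop
  exact (hg.comp this) y

theorem fderiv_apply_eq_inner {g : Vec d₁ → Vec d₂ → ℝ}
    (hg : Differentiable ℝ fun w : Vec d₁ × Vec d₂ => g w.1 w.2) (x v : Vec d₁) (y w : Vec d₂) :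
    fderiv ℝ (fun w : Vec d₁ × Vec d₂ => g w.1 w.2) (x, y) (v, w)
      = ⟪gradX g x y, v⟫ + ⟪gradY g x y, w⟫ := by
  have h := (hg (x, y)).hasFDerivAt
  have h1 := (HasFDerivAt.comp (g := fun w : Vec d₁ × Vec d₂ => g w.1 w.2)
    (f := fun e => (e, y)) x h (hasFDerivAt_prodMk_left x y)).unique
    (hasGradientAt_gradX hg x y).hasFDerivAt
  have h2 := (HasFDerivAt.comp (g := fun w : Vec d₁ × Vec d₂ => g w.1 w.2)
    (f := fun e => (x, e)) y h (hasFDerivAt_prodMk_right x y)).unique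
    (hasGradientAt_gradY hg x y).hasFDerivAt
  have h1' := DFunLike.congr_fun h1 v
  have h2' := DFunLike.congr_fun h2 w
  simp only [ContinuousLinearMap.comp_apply, ContinuousLinearMap.inl_apply,
    ContinuousLinearMap.inr_apply, InnerProductSpace.toDual_apply_apply] at h1' h2'
  rw [← h1', ← h2', ← map_add]
  simp

theorem norm_fst_le (v : WithLp 2 (Vec d₁ × Vec d₂)) : ‖v.fst‖ ≤ ‖v‖ := by
  refine le_of_sq_le_sq ?_ (norm_nonneg _)
  rw [WithLp.prod_norm_sq_eq_of_L2]; linarith [sq_nonneg ‖v.snd‖]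

theorem norm_snd_le (v : WithLp 2 (Vec d₁ × Vec d₂)) : ‖v.snd‖ ≤ ‖v‖ := by
  refine le_of_sq_le_sq ?_ (norm_nonneg _)
  rw [WithLp.prod_norm_sq_eq_of_L2]; linarith [sq_nonneg ‖v.fst‖]

theorem norm_le_fst_add_snd (v : WithLp 2 (Vec d₁ × Vec d₂)) : ‖v‖ ≤ ‖v.fst‖ + ‖v.snd‖ := by
  refine le_of_sq_le_sq ?_ (by positivity)
  rw [WithLp.prod_norm_sq_eq_of_L2]
  nlinarith [norm_nonneg v.fst, norm_nonneg v.snd]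

/-- Linearization error of a function with Lipschitz gradient. -/
theorem abs_sub_linear_le {g : Vec d₁ → Vec d₂ → ℝ} {l : ℝ}
    (hg : Differentiable ℝ fun w : Vec d₁ × Vec d₂ => g w.1 w.2)
    (hL : ∀ (x₁ x₂ : Vec d₁) (y₁ y₂ : Vec d₂),
      ‖fullGrad g x₁ y₁ - fullGrad g x₂ y₂‖ ≤ l * (‖x₁ - x₂‖ + ‖y₁ - y₂‖))
    (x : Vec d₁) (y : Vec d₂) (x' : Vec d₁) (y' : Vec d₂) :
    |g x' y' - g x y - ⟪gradX g x y, x' - x⟫ - ⟪gradY g x y, y' - y⟫|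
      ≤ l / 2 * (‖x' - x‖ + ‖y' - y‖) ^ 2 := by
  set q : WithLp 2 (Vec d₁ × Vec d₂) := WithLp.toLp 2 (x' - x, y' - y) with hq
  set D := ‖x' - x‖ + ‖y' - y‖ with hD
  set c := ⟪gradX g x y, x' - x⟫ + ⟪gradY g x y, y' - y⟫ with hc
  -- φ is the linearization error along the segment. Its derivative is at most l D² t, so comparison
  -- with l D² t²/2 gives the bound at t = 1.
  set φ : ℝ → ℝ := fun t => g (x + t • (x' - x)) (y + t • (y' - y)) - g x y - t * c with hφ
  set φ' : ℝ → ℝ := fun t => ⟪fullGrad g (x + t • (x' - x)) (y + t • (y' - y)) - fullGrad g x y, q⟫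
  have hqD : ‖q‖ ≤ D := norm_le_fst_add_snd q
  have hder : ∀ t, HasDerivAt φ (φ' t) t := by
    intro t
    have hline : HasDerivAt (fun t : ℝ => (x + t • (x' - x), y + t • (y' - y)))
        (x' - x, y' - y) t := by
      have h1 : HasDerivAt (fun t : ℝ => x + t • (x' - x)) (x' - x) t := by
        simpa using ((hasDerivAt_id t).smul_const (x' - x)).const_add x
      have h2 : HasDerivAt (fun t : ℝ => y + t • (y' - y)) (y' - y) t := by
        simpa using ((hasDerivAt_id t).smul_const (y' - y)).const_add y
      exact h1.prodMk h2
    have h3 := (hg (x + t • (x' - x), y + t • (y' - y))).hasFDerivAt.comp_hasDerivAt t hline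
    rw [fderiv_apply_eq_inner hg] at h3
    have h4 := (h3.sub_const (g x y)).sub ((hasDerivAt_id t).mul_const c)
    refine h4.congr_deriv ?_
    simp only [φ', q, inner_sub_left, WithLp.prod_inner_apply, fullGrad, hc, one_mul]
  have hbound : ∀ t ∈ Set.Ico (0 : ℝ) 1, ‖φ' t‖ ≤ l * D ^ 2 * t := by
    intro t ht
    refine (norm_inner_le_norm _ _).trans ?_
    have h1 := hL (x + t • (x' - x)) x (y + t • (y' - y)) y
    rw [add_sub_cancel_left, add_sub_cancel_left, norm_smul, norm_smul,
      Real.norm_of_nonneg ht.1] at h1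
    have h2 := mul_le_mul h1 hqD (norm_nonneg _) ((norm_nonneg _).trans h1)
    calc _ ≤ _ := h2
      _ = _ := by rw [hD]; ring
  have h := image_norm_le_of_norm_deriv_right_le_deriv_boundary (f := φ) (f' := φ') (a := 0)
    (b := 1) (B := fun t => l * D ^ 2 * (t ^ 2 / 2)) (B' := fun t => l * D ^ 2 * t)
    (fun t _ => (hder t).continuousAt.continuousWithinAt)
    (fun t _ => (hder t).hasDerivWithinAt) (by simp [φ])
    (fun t => by
      have := ((hasDerivAt_pow 2 t).div_const 2).const_mul (l * D ^ 2)
      exact this.congr_deriv (by norm_num)) hbound (Set.right_mem_Icc.2 zero_le_one)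
  rw [Real.norm_eq_abs] at h
  have e : φ 1 = g x' y' - g x y - ⟪gradX g x y, x' - x⟫ - ⟪gradY g x y, y' - y⟫ := by
    simp only [hφ, hc, one_smul, add_sub_cancel]; ring
  rw [e] at h
  calc _ ≤ _ := h
    _ = _ := by ring

variable {M : ℕ} {Ξ : Type u} [MeasurableSpace Ξ] {Q : Problem d₁ d₂ M Ξ} {l : ℝ}

theorem differentiable_obj (h : Q.LipschitzSmooth l) :
    Differentiable ℝ fun w : Vec d₁ × Vec d₂ => Q.obj w.1 w.2 := by
  unfold Problem.obj
  exact (Differentiable.fun_sum fun i _ => (h i).1).const_mul _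

theorem fullGrad_obj (h : Q.LipschitzSmooth l) (x : Vec d₁) (y : Vec d₂) :
    fullGrad Q.obj x y = (1 / (M : ℝ)) • ∑ i, fullGrad (Q.localObj i) x y := by
  have hX : gradX Q.obj x y = (1 / (M : ℝ)) • ∑ i, gradX (Q.localObj i) x y := by
    have h1 : HasGradientAt (fun x' => Q.obj x' y)
        ((1 / (M : ℝ)) • ∑ i, gradX (Q.localObj i) x y) x := by
      have h2 := (HasFDerivAt.fun_sum (u := Finset.univ) fun i _ =>
        (hasGradientAt_gradX (h i).1 x y).hasFDerivAt).const_mul (1 / (M : ℝ))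
      rw [hasGradientAt_iff_hasFDerivAt, map_smul, map_sum]
      exact h2
    exact h1.gradient
  have hY : gradY Q.obj x y = (1 / (M : ℝ)) • ∑ i, gradY (Q.localObj i) x y := by
    have h1 : HasGradientAt (fun y' => Q.obj x y')
        ((1 / (M : ℝ)) • ∑ i, gradY (Q.localObj i) x y) y := by
      have h2 := (HasFDerivAt.fun_sum (u := Finset.univ) fun i _ =>
        (hasGradientAt_gradY (h i).1 x y).hasFDerivAt).const_mul (1 / (M : ℝ))
      rw [hasGradientAt_iff_hasFDerivAt, map_smul, map_sum]
      exact h2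
    exact h1.gradient
  unfold fullGrad
  rw [hX, hY, ← WithLp.toLp_sum, ← WithLp.toLp_smul]
  congr 1
  ext1 <;> simp [Prod.fst_sum, Prod.snd_sum]

theorem sum_fullGrad_sub_obj (h : Q.LipschitzSmooth l) (hM : 0 < M) (x : Vec d₁) (y : Vec d₂) :
    ∑ i, (fullGrad (Q.localObj i) x y - fullGrad Q.obj x y) = 0 := by
  have : (M : ℝ) ≠ 0 := by positivity
  rw [Finset.sum_sub_distrib, Finset.sum_const, Finset.card_univ, Fintype.card_fin,
    fullGrad_obj h, ← Nat.cast_smul_eq_nsmul ℝ, smul_smul, mul_one_div_cancel this, one_smul,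
    sub_self]

theorem fullGrad_obj_lipschitz (h : Q.LipschitzSmooth l) (hM : 0 < M) (x₁ x₂ : Vec d₁)
    (y₁ y₂ : Vec d₂) :
    ‖fullGrad Q.obj x₁ y₁ - fullGrad Q.obj x₂ y₂‖ ≤ l * (‖x₁ - x₂‖ + ‖y₁ - y₂‖) := by
  have hM' : (M : ℝ) ≠ 0 := by positivity
  rw [fullGrad_obj h, fullGrad_obj h, ← smul_sub, ← Finset.sum_sub_distrib, norm_smul,
    Real.norm_of_nonneg (by positivity)]
  have h1 : ‖∑ i, (fullGrad (Q.localObj i) x₁ y₁ - fullGrad (Q.localObj i) x₂ y₂)‖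
      ≤ ∑ _i : Fin M, l * (‖x₁ - x₂‖ + ‖y₁ - y₂‖) :=
    norm_sum_le_of_le _ fun i _ => (h i).2 x₁ x₂ y₁ y₂
  rw [Finset.sum_const, Finset.card_univ, Fintype.card_fin, nsmul_eq_mul] at h1
  calc _ ≤ 1 / (M : ℝ) * (M * (l * (‖x₁ - x₂‖ + ‖y₁ - y₂‖))) :=
        mul_le_mul_of_nonneg_left h1 (by positivity)
    _ = _ := by field_simp

theorem smoothPL_obj {μ Φstar : ℝ} (h : Q.LipschitzSmooth l) (hM : 0 < M) (hl : 0 < l)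
    (hμ : 0 < μ) (hμl : μ ≤ l) (hPL : PLInY Q.obj μ) (hΦ : ∀ x, Φstar ≤ maxVal Q.obj x) :
    SmoothPL Q.obj l μ Φstar where
  l_pos := hl
  μ_pos := hμ
  μ_le := hμl
  cont := (differentiable_obj h).continuous
  approx := abs_sub_linear_le (differentiable_obj h) (fullGrad_obj_lipschitz h hM)
  lipX x y x' y' :=
    (norm_fst_le (fullGrad Q.obj x y - fullGrad Q.obj x' y')).trans
      (fullGrad_obj_lipschitz h hM x x' y y')
  lipY x y x' y' :=
    (norm_snd_le (fullGrad Q.obj x y - fullGrad Q.obj x' y')).trans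
      (fullGrad_obj_lipschitz h hM x x' y y')
  pl := hPL
  bdd := hΦ

end Regularity

end FedMinimax

namespace FedMinimax

open scoped RealInnerProductSpace

/-! ### Resampling one coordinate and orthogonality in L². -/

section ProductMeasure

/-- Resampling one coordinate of a product of probability measures preserves the product. -/
theorem measurePreserving_update {ι : Type*} [Fintype ι] [DecidableEq ι] {α : ι → Type*}
    [∀ i, MeasurableSpace (α i)] (μ : ∀ i, Measure (α i)) [∀ i, IsProbabilityMeasure (μ i)]
    (k : ι) :
    MeasurePreserving (fun q : (∀ i, α i) × α k => Function.update q.1 k q.2)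
      ((Measure.pi μ).prod (μ k)) (Measure.pi μ) := by
  have hmeas : Measurable (fun q : (∀ i, α i) × α k => Function.update q.1 k q.2) :=
    measurable_update'
  refine ⟨hmeas, (Measure.pi_eq fun s hs => ?_).symm⟩
  rw [Measure.map_apply hmeas (MeasurableSet.univ_pi hs)]
  have hpre : (fun q : (∀ i, α i) × α k => Function.update q.1 k q.2) ⁻¹' (Set.univ.pi s)
      = (Set.univ.pi (Function.update s k Set.univ)) ×ˢ s k := by
    ext ⟨ξ, a⟩
    simp only [Set.mem_preimage, Set.mem_univ_pi, Set.mem_prod]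
    constructor
    · intro h
      refine ⟨fun i => ?_, by simpa using h k⟩
      by_cases hi : i = k
      · subst hi; simp
      · simpa [hi] using h i
    · rintro ⟨h, hk⟩ i
      by_cases hi : i = k
      · subst hi; simpa using hk
      · simpa [hi] using h i
  rw [hpre, Measure.prod_prod, Measure.pi_pi,
    ← Finset.mul_prod_erase Finset.univ (fun i => μ i (Function.update s k Set.univ i))
      (Finset.mem_univ k),
    ← Finset.mul_prod_erase Finset.univ (fun i => μ i (s i)) (Finset.mem_univ k)]
  simp only [Function.update_self, measure_univ, one_mul]
  rw [mul_comm]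
  congr 1
  refine Finset.prod_congr rfl fun i hi => ?_
  rw [Function.update_of_ne (Finset.ne_of_mem_erase hi)]

theorem lintegral_pi_update {ι : Type*} [Fintype ι] [DecidableEq ι] {α : ι → Type*}
    [∀ i, MeasurableSpace (α i)] (μ : ∀ i, Measure (α i)) [∀ i, IsProbabilityMeasure (μ i)]
    (k : ι) {φ : (∀ i, α i) → ENNReal} (hφ : Measurable φ) :
    ∫⁻ ξ, φ ξ ∂(Measure.pi μ) = ∫⁻ ξ, ∫⁻ a, φ (Function.update ξ k a) ∂(μ k) ∂(Measure.pi μ) := by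
  have h := measurePreserving_update μ k
  rw [← h.lintegral_comp hφ]
  exact lintegral_prod _ (hφ.comp h.measurable).aemeasurable

/-- Integrating over one resampled coordinate plays the role of conditioning on all the others.
Every mean-zero and orthogonality claim for the noise rests on it, without filtrations. -/
theorem integral_pi_eq_zero_of_update {ι : Type*} [Fintype ι] [DecidableEq ι] {α : ι → Type*}
    [∀ i, MeasurableSpace (α i)] (μ : ∀ i, Measure (α i)) [∀ i, IsProbabilityMeasure (μ i)]
    (k : ι) {φ : (∀ i, α i) → ℝ} (hφ : Integrable φ (Measure.pi μ))
    (h0 : ∀ ξ, ∫ a, φ (Function.update ξ k a) ∂(μ k) = 0) :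
    ∫ ξ, φ ξ ∂(Measure.pi μ) = 0 := by
  have h := measurePreserving_update μ k
  have h1 : ∫ ξ, φ ξ ∂(Measure.pi μ)
      = ∫ q, φ (Function.update q.1 k q.2) ∂((Measure.pi μ).prod (μ k)) := by
    conv_lhs => rw [← h.map_eq]
    rw [integral_map h.measurable.aemeasurable]
    rw [h.map_eq]; exact hφ.aestronglyMeasurable
  rw [h1]
  refine (integral_prod _ (h.integrable_comp_of_integrable hφ)).trans ?_
  simp [h0]

theorem integrable_inner_of_memLp {Ω E : Type*} [MeasurableSpace Ω] {P : Measure Ω}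
    [NormedAddCommGroup E] [InnerProductSpace ℝ E] {X Y : Ω → E} (hX : MemLp X 2 P)
    (hY : MemLp Y 2 P) : Integrable (fun ω => ⟪X ω, Y ω⟫) P := by
  refine Integrable.mono' ((hX.integrable_norm_pow (p := 2) two_ne_zero).add
    (hY.integrable_norm_pow (p := 2) two_ne_zero)) (hX.1.inner hY.1) (ae_of_all _ fun ω => ?_)
  refine (norm_inner_le_norm _ _).trans ?_
  simp only [Pi.add_apply]
  nlinarith [sq_nonneg (‖X ω‖ - ‖Y ω‖), sq_nonneg ‖X ω‖, sq_nonneg ‖Y ω‖]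

theorem integral_norm_sum_sq {Ω E ι : Type*} [MeasurableSpace Ω] {P : Measure Ω}
    [NormedAddCommGroup E] [InnerProductSpace ℝ E] (s : Finset ι) {X : ι → Ω → E}
    (hX : ∀ i ∈ s, MemLp (X i) 2 P)
    (horth : ∀ i ∈ s, ∀ j ∈ s, i ≠ j → ∫ ω, ⟪X i ω, X j ω⟫ ∂P = 0) :
    ∫ ω, ‖∑ i ∈ s, X i ω‖ ^ 2 ∂P = ∑ i ∈ s, ∫ ω, ‖X i ω‖ ^ 2 ∂P := by
  have h1 : ∀ ω, ‖∑ i ∈ s, X i ω‖ ^ 2 = ∑ i ∈ s, ∑ j ∈ s, ⟪X i ω, X j ω⟫ := fun ω => by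
    rw [← real_inner_self_eq_norm_sq, sum_inner]
    exact Finset.sum_congr rfl fun i _ => inner_sum _ _ _
  simp only [h1]
  rw [integral_finsetSum _ fun i hi => integrable_finsetSum _ fun j hj =>
    integrable_inner_of_memLp (hX i hi) (hX j hj)]
  refine Finset.sum_congr rfl fun i hi => ?_
  rw [integral_finsetSum _ fun j hj => integrable_inner_of_memLp (hX i hi) (hX j hj),
    Finset.sum_eq_single_of_mem i hi fun j hj hij => horth i hi j hj hij.symm]
  simp only [real_inner_self_eq_norm_sq]

end ProductMeasure

/-! ### Uniform sampling of m clients without replacement. -/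

section ClientSampling

variable {M : ℕ}

/-- Relabelling the clients permutes the m-subsets. Transpositions then show that the number of
subsets containing a given client, or a given pair, does not depend on the choice, so no binomial
coefficients are needed. -/
theorem card_filter_powersetCard_perm (m : ℕ) (e : Equiv.Perm (Fin M)) (p p' : Finset (Fin M) → Prop)
    [DecidablePred p] [DecidablePred p'] (h : ∀ S, p S ↔ p' (S.map e.toEmbedding)) :
    ((Finset.powersetCard m Finset.univ).filter p).card
      = ((Finset.powersetCard m Finset.univ).filter p').card := by
  refine Finset.card_bij (fun S _ => S.map e.toEmbedding) ?_ ?_ ?_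
  · intro S hS
    simp only [Finset.mem_filter, Finset.mem_powersetCard_univ] at hS ⊢
    exact ⟨by rw [Finset.card_map]; exact hS.1, (h S).1 hS.2⟩
  · intro S _ S' _ hSS
    exact Finset.map_injective _ hSS
  · intro S hS
    simp only [Finset.mem_filter, Finset.mem_powersetCard_univ] at hS
    have e1 : (S.map e.symm.toEmbedding).map e.toEmbedding = S := by
      ext x; simp
    refine ⟨S.map e.symm.toEmbedding, ?_, e1⟩
    simp only [Finset.mem_filter, Finset.mem_powersetCard_univ]
    exact ⟨by rw [Finset.card_map]; exact hS.1, (h _).2 (by rw [e1]; exact hS.2)⟩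

theorem card_filter_mem_eq (m : ℕ) (i j : Fin M) :
    ((Finset.powersetCard m Finset.univ).filter fun S : Finset (Fin M) => i ∈ S).card
      = ((Finset.powersetCard m Finset.univ).filter fun S : Finset (Fin M) => j ∈ S).card := by
  refine card_filter_powersetCard_perm m (Equiv.swap i j) _ _ fun S => ?_
  simp [Finset.mem_map_equiv]

theorem card_filter_mem_pair_eq (m : ℕ) {i j j' : Fin M} (hj : j ≠ i) (hj' : j' ≠ i) :
    ((Finset.powersetCard m Finset.univ).filter
        fun S : Finset (Fin M) => i ∈ S ∧ j ∈ S).card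
      = ((Finset.powersetCard m Finset.univ).filter
        fun S : Finset (Fin M) => i ∈ S ∧ j' ∈ S).card := by
  refine card_filter_powersetCard_perm m (Equiv.swap j j') _ _ fun S => ?_
  simp [Finset.mem_map_equiv, Equiv.swap_apply_of_ne_of_ne hj.symm hj'.symm]

variable {E : Type*} [NormedAddCommGroup E] [InnerProductSpace ℝ E]

theorem sum_powersetCard_sum_eq_zero (m : ℕ) {v : Fin M → ℝ} (hv : ∑ i, v i = 0) :
    ∑ S ∈ Finset.powersetCard m (Finset.univ : Finset (Fin M)), ∑ i ∈ S, v i = 0 := by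
  have h1 : ∀ S : Finset (Fin M), ∑ i ∈ S, v i = ∑ i, if i ∈ S then v i else 0 := fun S => by
    rw [← Finset.sum_filter]; simp
  simp only [h1]
  rw [Finset.sum_comm]
  simp only [← Finset.sum_filter, Finset.sum_const, nsmul_eq_mul]
  rcases isEmpty_or_nonempty (Fin M) with hM | ⟨⟨i₀⟩⟩
  · simp
  · simp only [fun i => card_filter_mem_eq m i i₀]
    rw [← Finset.mul_sum, hv, mul_zero]

/-- Sampling without replacement has at most the variance of sampling with replacement. -/
theorem sum_powersetCard_norm_sum_sq_le (m : ℕ) {v : Fin M → E} (hv : ∑ i, v i = 0) {G : ℝ}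
    (hG : ∀ i, ‖v i‖ ^ 2 ≤ G) :
    ∑ S ∈ Finset.powersetCard m (Finset.univ : Finset (Fin M)), ‖∑ i ∈ S, v i‖ ^ 2
      ≤ (Finset.powersetCard m (Finset.univ : Finset (Fin M))).card * (m * G) := by
  set PS := Finset.powersetCard m (Finset.univ : Finset (Fin M)) with hPS
  have h1 : ∀ S : Finset (Fin M), ‖∑ i ∈ S, v i‖ ^ 2
      = ∑ i, ∑ j, if i ∈ S ∧ j ∈ S then ⟪v i, v j⟫ else 0 := fun S => by
    rw [← real_inner_self_eq_norm_sq, sum_inner]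
    simp only [inner_sum]
    have h2 : ∀ i, (∑ j, if i ∈ S ∧ j ∈ S then ⟪v i, v j⟫ else 0)
        = if i ∈ S then ∑ j ∈ S, ⟪v i, v j⟫ else 0 := fun i => by
      by_cases hi : i ∈ S
      · simp [hi]
      · simp [hi]
    simp only [h2, ← Finset.sum_filter]
    simp
  have h3 : ∀ i, ∑ j, ∑ S ∈ PS, (if i ∈ S ∧ j ∈ S then ⟪v i, v j⟫ else 0)
      ≤ ∑ S ∈ PS, if i ∈ S then ‖v i‖ ^ 2 else 0 := by
    intro i
    obtain ⟨c, hc0, hc⟩ : ∃ c : ℝ, 0 ≤ c ∧ ∀ j, j ≠ i →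
        ((PS.filter fun S : Finset (Fin M) => i ∈ S ∧ j ∈ S).card : ℝ) = c := by
      by_cases hex : ∃ j₀, j₀ ≠ i
      · obtain ⟨j₀, hj₀⟩ := hex
        exact ⟨_, Nat.cast_nonneg _, fun j hj => by rw [card_filter_mem_pair_eq m hj hj₀]⟩
      · exact ⟨0, le_rfl, fun j hj => absurd ⟨j, hj⟩ hex⟩
    rw [← Finset.add_sum_erase _ _ (Finset.mem_univ i)]
    -- All pairs {i, j} are counted c times and the other vectors sum to -v i, so the off-diagonal
    -- part is nonpositive and can be dropped.
    have h4 : ∑ j ∈ Finset.univ.erase i, ∑ S ∈ PS, (if i ∈ S ∧ j ∈ S then ⟪v i, v j⟫ else 0)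
        = -(c * ‖v i‖ ^ 2) := by
      have h5 : ∑ j ∈ Finset.univ.erase i, ⟪v i, v j⟫ = -‖v i‖ ^ 2 := by
        rw [← inner_sum, Finset.sum_erase_eq_sub (Finset.mem_univ i), hv, zero_sub, inner_neg_right,
          real_inner_self_eq_norm_sq]
      rw [← mul_neg, ← h5, Finset.mul_sum]
      refine Finset.sum_congr rfl fun j hj => ?_
      rw [← Finset.sum_filter, Finset.sum_const, nsmul_eq_mul, hc j (Finset.ne_of_mem_erase hj)]
    rw [h4]
    simp only [and_self, real_inner_self_eq_norm_sq]
    have := mul_nonneg hc0 (sq_nonneg ‖v i‖)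
    linarith
  calc ∑ S ∈ PS, ‖∑ i ∈ S, v i‖ ^ 2
      = ∑ i, ∑ j, ∑ S ∈ PS, (if i ∈ S ∧ j ∈ S then ⟪v i, v j⟫ else 0) := by
        simp only [h1]
        rw [Finset.sum_comm]
        exact Finset.sum_congr rfl fun i _ => Finset.sum_comm
    _ ≤ ∑ i, ∑ S ∈ PS, (if i ∈ S then ‖v i‖ ^ 2 else 0) := Finset.sum_le_sum fun i _ => h3 i
    _ = ∑ S ∈ PS, ∑ i ∈ S, ‖v i‖ ^ 2 := by
        rw [Finset.sum_comm]
        refine Finset.sum_congr rfl fun S _ => ?_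
        rw [← Finset.sum_filter]; simp
    _ ≤ ∑ S ∈ PS, (m * G : ℝ) := by
        refine Finset.sum_le_sum fun S hS => ?_
        have hcard : S.card = m := (Finset.mem_powersetCard.1 hS).2
        calc _ ≤ ∑ _i ∈ S, G := Finset.sum_le_sum fun i _ => hG i
          _ = _ := by rw [Finset.sum_const, nsmul_eq_mul, hcard]
    _ = _ := by rw [Finset.sum_const, nsmul_eq_mul]

theorem lintegral_uniformOn_card (m : ℕ) (φ : Finset (Fin M) → ENNReal) :
    ∫⁻ S, φ S ∂(uniformOn {S : Finset (Fin M) | S.card = m})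
      = ((Finset.powersetCard m (Finset.univ : Finset (Fin M))).card : ENNReal)⁻¹
        * ∑ S ∈ Finset.powersetCard m (Finset.univ : Finset (Fin M)), φ S := by
  have hset : {S : Finset (Fin M) | S.card = m}
      = ↑(Finset.powersetCard m (Finset.univ : Finset (Fin M))) := by
    ext S; simp
  rw [hset, uniformOn, ProbabilityTheory.cond, lintegral_smul_measure, Measure.count_apply_finset,
    lintegral_finset]
  simp

theorem lintegral_ofReal_uniformOn_card {m : ℕ} (hm : m ≤ M) {φ : Finset (Fin M) → ℝ}
    (hφ : ∀ S : Finset (Fin M), S.card = m → 0 ≤ φ S) :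
    ∫⁻ S, ENNReal.ofReal (φ S) ∂(uniformOn {S : Finset (Fin M) | S.card = m})
      = ENNReal.ofReal (((Finset.powersetCard m (Finset.univ : Finset (Fin M))).card : ℝ)⁻¹
        * ∑ S ∈ Finset.powersetCard m (Finset.univ : Finset (Fin M)), φ S) := by
  have hpos : 0 < (Finset.powersetCard m (Finset.univ : Finset (Fin M))).card := by
    rw [Finset.card_powersetCard, Finset.card_univ, Fintype.card_fin]
    exact Nat.choose_pos hm
  rw [lintegral_uniformOn_card, ENNReal.ofReal_mul (by positivity),
    ENNReal.ofReal_inv_of_pos (by positivity), ENNReal.ofReal_natCast,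
    ENNReal.ofReal_sum_of_nonneg]
  intro S hS
  exact hφ S (Finset.mem_powersetCard.1 hS).2

end ClientSampling

end FedMinimax

namespace FedMinimax

open scoped RealInnerProductSpace

/-! ### Gradient noise of the local steps: mean, orthogonality, variance. -/

section LocalSteps

variable {d₁ d₂ M : ℕ} {Ξ : Type u} [MeasurableSpace Ξ]

instance (Q : Problem d₁ d₂ M Ξ) (i : Fin M) : IsProbabilityMeasure (Q.D i) :=
  Q.isProbabilityMeasure_D i

/-- The stochastic gradient of client `i` at `v` for the sample `ξ`. -/
noncomputable def sampleGrad (Q : Problem d₁ d₂ M Ξ) (i : Fin M) (v : Vec d₁ × Vec d₂) (ξ : Ξ) :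
    WithLp 2 (Vec d₁ × Vec d₂) := fullGrad (fun x y => Q.loss i x y ξ) v.1 v.2

/-- The gradient of the local objective of client `i` at `v`. -/
noncomputable def localGrad (Q : Problem d₁ d₂ M Ξ) (i : Fin M) (v : Vec d₁ × Vec d₂) :
    WithLp 2 (Vec d₁ × Vec d₂) := fullGrad (Q.localObj i) v.1 v.2

/-- The gradient noise in the local step `k` of client `i`. -/
noncomputable def gradNoise (Q : Problem d₁ d₂ M Ξ) (s : Params) (i : Fin M)
    (w : Vec d₁ × Vec d₂) {K : ℕ} (k : Fin K) (ξ : Fin K → Ξ) : WithLp 2 (Vec d₁ × Vec d₂) :=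
  sampleGrad Q i (localModel Q s i ξ w k) (ξ k) - localGrad Q i (localModel Q s i ξ w k)

variable {Q : Problem d₁ d₂ M Ξ} {s : Params} {i : Fin M} {K : ℕ} {l σ : ℝ}

theorem localModel_succ (ξ : Fin K → Ξ) (w : Vec d₁ × Vec d₂) (k : Fin K) :
    localModel Q s i ξ w (k + 1) =
      ((localModel Q s i ξ w k).1
          - s.ηxl • (sampleGrad Q i (localModel Q s i ξ w k) (ξ k)).fst,
        (localModel Q s i ξ w k).2
          + s.ηyl • (sampleGrad Q i (localModel Q s i ξ w k) (ξ k)).snd) := by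
  rw [localModel, dif_pos k.2]
  rfl

/-- Adaptedness: after k steps only the samples with index below k have been used, so resampling
index j = k is still harmless. -/
theorem localModel_update (ξ : Fin K → Ξ) (w : Vec d₁ × Vec d₂) (j : Fin K) (a : Ξ) {k : ℕ}
    (hk : k ≤ j) : localModel Q s i (Function.update ξ j a) w k = localModel Q s i ξ w k := by
  induction k with
  | zero => rfl
  | succ k ih =>
    have hkj : k < j := hk
    have hkK : k < K := hkj.trans j.2
    have h1 := localModel_succ (Q := Q) (s := s) (i := i) ξ w ⟨k, hkK⟩
    have h2 := localModel_succ (Q := Q) (s := s) (i := i) (Function.update ξ j a) w ⟨k, hkK⟩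
    simp only at h1 h2
    rw [h1, h2, ih hkj.le, Function.update_of_ne (fun h => by simp [← h] at hkj)]

theorem measurable_sampleGrad (i : Fin M) :
    Measurable fun q : (Vec d₁ × Vec d₂) × Ξ => sampleGrad Q i q.1 q.2 := Q.measurable_grad i

theorem measurable_fst_withLp :
    Measurable fun v : WithLp 2 (Vec d₁ × Vec d₂) => v.fst :=
  (WithLp.fstL 2 ℝ (Vec d₁) (Vec d₂)).continuous.measurable

theorem measurable_snd_withLp :
    Measurable fun v : WithLp 2 (Vec d₁ × Vec d₂) => v.snd :=
  (WithLp.sndL 2 ℝ (Vec d₁) (Vec d₂)).continuous.measurable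

theorem measurable_localModel (s : Params) (i : Fin M) (k : ℕ) :
    Measurable fun q : (Fin K → Ξ) × (Vec d₁ × Vec d₂) => localModel Q s i q.1 q.2 k := by
  induction k with
  | zero => exact measurable_snd
  | succ k ih =>
    by_cases hk : k < K
    · have e := fun q : (Fin K → Ξ) × (Vec d₁ × Vec d₂) =>
        localModel_succ (Q := Q) (s := s) (i := i) q.1 q.2 ⟨k, hk⟩
      simp only at e
      simp only [e]
      have h1 : Measurable fun q : (Fin K → Ξ) × (Vec d₁ × Vec d₂) =>
          sampleGrad Q i (localModel Q s i q.1 q.2 k) (q.1 ⟨k, hk⟩) :=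
        (measurable_sampleGrad i).comp (ih.prodMk ((measurable_pi_apply _).comp measurable_fst))
      exact (ih.fst.sub ((measurable_fst_withLp.comp h1).const_smul s.ηxl)).prodMk
        (ih.snd.add ((measurable_snd_withLp.comp h1).const_smul s.ηyl))
    · simp only [localModel, dif_neg hk]
      exact ih

theorem continuous_of_norm_sub_le {E : Type*} [SeminormedAddCommGroup E]
    {F : Vec d₁ × Vec d₂ → E}
    (hF : ∀ v v', ‖F v - F v'‖ ≤ l * (‖v.1 - v'.1‖ + ‖v.2 - v'.2‖)) : Continuous F := by
  rw [continuous_iff_continuousAt]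
  intro v
  rw [ContinuousAt, tendsto_iff_norm_sub_tendsto_zero]
  refine squeeze_zero (fun _ => norm_nonneg _) (fun v' => hF v' v) ?_
  have h : Continuous fun v' : Vec d₁ × Vec d₂ => l * (‖v'.1 - v.1‖ + ‖v'.2 - v.2‖) := by fun_prop
  simpa using h.tendsto v

theorem continuous_localGrad (h : Q.LipschitzSmooth l) (i : Fin M) :
    Continuous (localGrad Q i) :=
  continuous_of_norm_sub_le fun v v' => (h i).2 v.1 v'.1 v.2 v'.2

theorem measurable_gradNoise (h : Q.LipschitzSmooth l) (s : Params) (i : Fin M)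
    (w : Vec d₁ × Vec d₂) (k : Fin K) : Measurable (gradNoise Q s i w k) := by
  have h1 : Measurable fun ξ : Fin K → Ξ => localModel Q s i ξ w k :=
    (measurable_localModel s i k).comp (measurable_id.prodMk measurable_const)
  exact ((measurable_sampleGrad i).comp (h1.prodMk (measurable_pi_apply k))).sub
    ((continuous_localGrad h i).measurable.comp h1)

theorem gradNoise_update_self (w : Vec d₁ × Vec d₂) (k : Fin K) (ξ : Fin K → Ξ) (a : Ξ) :
    gradNoise Q s i w k (Function.update ξ k a)
      = sampleGrad Q i (localModel Q s i ξ w k) a - localGrad Q i (localModel Q s i ξ w k) := by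
  unfold gradNoise
  rw [localModel_update ξ w k a le_rfl, Function.update_self]

theorem gradNoise_update_of_lt (w : Vec d₁ × Vec d₂) {j k : Fin K} (hjk : j < k)
    (ξ : Fin K → Ξ) (a : Ξ) :
    gradNoise Q s i w j (Function.update ξ k a) = gradNoise Q s i w j ξ := by
  unfold gradNoise
  rw [localModel_update ξ w k a (show (j : ℕ) ≤ k from hjk.le), Function.update_of_ne hjk.ne]

/-- The law of the data samples of one client in one round. -/
noncomputable abbrev clientLaw (Q : Problem d₁ d₂ M Ξ) (K : ℕ) (i : Fin M) :
    Measure (Fin K → Ξ) := Measure.pi fun _ : Fin K => Q.D i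

/-- Resampling the k-th sample leaves the point of evaluation fixed, and there the variance bound
applies. -/
theorem lintegral_gradNoise_sq_le (h : Q.LipschitzSmooth l) (hσ : Q.BoundedVariance σ)
    (s : Params) (i : Fin M) (w : Vec d₁ × Vec d₂) (k : Fin K) :
    ∫⁻ ξ, ENNReal.ofReal (‖gradNoise Q s i w k ξ‖ ^ 2) ∂(clientLaw Q K i)
      ≤ ENNReal.ofReal (σ ^ 2) := by
  rw [lintegral_pi_update (fun _ : Fin K => Q.D i) k
    ((measurable_gradNoise h s i w k).norm.pow_const 2).ennreal_ofReal]
  simp only [gradNoise_update_self]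
  calc _ ≤ ∫⁻ _, ENNReal.ofReal (σ ^ 2) ∂(clientLaw Q K i) := by
        refine lintegral_mono fun ξ => ?_
        obtain ⟨-, -, h3, h4⟩ := hσ i (localModel Q s i ξ w k).1 (localModel Q s i ξ w k).2
        exact (ofReal_integral_eq_lintegral_ofReal h3 (ae_of_all _ fun _ => sq_nonneg _)).ge.trans
          (ENNReal.ofReal_le_ofReal h4)
    _ = _ := by simp

theorem integrable_gradNoise_sq (h : Q.LipschitzSmooth l) (hσ : Q.BoundedVariance σ)
    (s : Params) (i : Fin M) (w : Vec d₁ × Vec d₂) (k : Fin K) :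
    Integrable (fun ξ => ‖gradNoise Q s i w k ξ‖ ^ 2) (clientLaw Q K i) := by
  refine ⟨((measurable_gradNoise h s i w k).norm.pow_const 2).aestronglyMeasurable, ?_⟩
  rw [hasFiniteIntegral_iff_ofReal (ae_of_all _ fun _ => sq_nonneg _)]
  exact (lintegral_gradNoise_sq_le h hσ s i w k).trans_lt ENNReal.ofReal_lt_top

theorem memLp_gradNoise (h : Q.LipschitzSmooth l) (hσ : Q.BoundedVariance σ)
    (s : Params) (i : Fin M) (w : Vec d₁ × Vec d₂) (k : Fin K) :
    MemLp (gradNoise Q s i w k) 2 (clientLaw Q K i) :=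
  (memLp_two_iff_integrable_sq_norm
    (measurable_gradNoise h s i w k).aestronglyMeasurable).2 (integrable_gradNoise_sq h hσ s i w k)

theorem integral_gradNoise_sq_le (h : Q.LipschitzSmooth l) (hσ : Q.BoundedVariance σ)
    (s : Params) (i : Fin M) (w : Vec d₁ × Vec d₂) (k : Fin K) :
    ∫ ξ, ‖gradNoise Q s i w k ξ‖ ^ 2 ∂(clientLaw Q K i) ≤ σ ^ 2 := by
  rw [integral_eq_lintegral_of_nonneg_ae (ae_of_all _ fun _ => sq_nonneg _)
    (integrable_gradNoise_sq h hσ s i w k).1]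
  exact ENNReal.toReal_le_of_le_ofReal (sq_nonneg _) (lintegral_gradNoise_sq_le h hσ s i w k)

theorem integral_inner_sampleGrad_sub (hσ : Q.BoundedVariance σ) (i : Fin M)
    (v : Vec d₁ × Vec d₂) (q : WithLp 2 (Vec d₁ × Vec d₂)) :
    ∫ a, ⟪q, sampleGrad Q i v a - localGrad Q i v⟫ ∂(Q.D i) = 0 := by
  obtain ⟨h1, h2, -, -⟩ := hσ i v.1 v.2
  have h3 : Integrable (fun a => sampleGrad Q i v a - localGrad Q i v) (Q.D i) :=
    h1.sub (integrable_const _)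
  rw [integral_inner h3]
  have h4 : ∫ a, (sampleGrad Q i v a - localGrad Q i v) ∂(Q.D i) = 0 := by
    refine (integral_sub h1 (integrable_const (localGrad Q i v))).trans ?_
    rw [h2]
    simp [localGrad]
  rw [h4, inner_zero_right]

theorem integral_inner_gradNoise (h : Q.LipschitzSmooth l) (hσ : Q.BoundedVariance σ)
    (s : Params) (i : Fin M) (w : Vec d₁ × Vec d₂) (k : Fin K)
    (q : WithLp 2 (Vec d₁ × Vec d₂)) :
    ∫ ξ, ⟪q, gradNoise Q s i w k ξ⟫ ∂(clientLaw Q K i) = 0 := by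
  refine integral_pi_eq_zero_of_update (fun _ : Fin K => Q.D i) k
    (integrable_inner_of_memLp (memLp_const q) (memLp_gradNoise h hσ s i w k)) fun ξ => ?_
  simp only [gradNoise_update_self]
  exact integral_inner_sampleGrad_sub hσ i _ q

/-- Resampling the later of the two samples leaves the earlier noise fixed and gives the later one
mean zero. -/
theorem integral_inner_gradNoise_of_ne (h : Q.LipschitzSmooth l) (hσ : Q.BoundedVariance σ)
    (s : Params) (i : Fin M) (w : Vec d₁ × Vec d₂) {j k : Fin K} (hjk : j ≠ k) :
    ∫ ξ, ⟪gradNoise Q s i w j ξ, gradNoise Q s i w k ξ⟫ ∂(clientLaw Q K i) = 0 := by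
  wlog hlt : j < k generalizing j k
  · simp only [fun ξ => real_inner_comm (gradNoise Q s i w k ξ) (gradNoise Q s i w j ξ)]
    exact this hjk.symm (lt_of_le_of_ne (not_lt.1 hlt) hjk.symm)
  refine integral_pi_eq_zero_of_update (fun _ : Fin K => Q.D i) k
    (integrable_inner_of_memLp (memLp_gradNoise h hσ s i w j)
      (memLp_gradNoise h hσ s i w k)) fun ξ => ?_
  simp only [gradNoise_update_self, gradNoise_update_of_lt w hlt]
  exact integral_inner_sampleGrad_sub hσ i _ _

theorem integral_norm_sum_gradNoise_sq_le (h : Q.LipschitzSmooth l) (hσ : Q.BoundedVariance σ)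
    (s : Params) (i : Fin M) (w : Vec d₁ × Vec d₂) :
    ∫ ξ, ‖∑ k : Fin K, gradNoise Q s i w k ξ‖ ^ 2 ∂(clientLaw Q K i) ≤ K * σ ^ 2 := by
  rw [integral_norm_sum_sq _ (fun k _ => memLp_gradNoise h hσ s i w k)
    fun j _ k _ hjk => integral_inner_gradNoise_of_ne h hσ s i w hjk]
  calc _ ≤ ∑ _k : Fin K, σ ^ 2 :=
        Finset.sum_le_sum fun k _ => integral_gradNoise_sq_le h hσ s i w k
    _ = _ := by simp

/-- The law of the data samples of all clients in one round. -/
noncomputable abbrev dataLaw (Q : Problem d₁ d₂ M Ξ) (K : ℕ) :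
    Measure (Fin M → Fin K → Ξ) := Measure.pi fun i => clientLaw Q K i

theorem memLp_sum_gradNoise (h : Q.LipschitzSmooth l) (hσ : Q.BoundedVariance σ)
    (s : Params) (w : Vec d₁ × Vec d₂) (i : Fin M) :
    MemLp (fun ξ : Fin M → Fin K → Ξ => ∑ k : Fin K, gradNoise Q s i w k (ξ i)) 2
      (dataLaw Q K) :=
  (memLp_finsetSum _ fun k _ => memLp_gradNoise h hσ s i w k).comp_measurePreserving
    (measurePreserving_eval (fun i => clientLaw Q K i) i)

theorem memLp_client_sum_gradNoise (h : Q.LipschitzSmooth l) (hσ : Q.BoundedVariance σ)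
    (s : Params) (w : Vec d₁ × Vec d₂) (S : Finset (Fin M)) :
    MemLp (fun ξ : Fin M → Fin K → Ξ => ∑ i ∈ S, ∑ k : Fin K, gradNoise Q s i w k (ξ i)) 2
      (dataLaw Q K) :=
  memLp_finsetSum _ fun i _ => memLp_sum_gradNoise h hσ s w i

theorem integral_dataLaw_eval (i : Fin M) {φ : (Fin K → Ξ) → ℝ}
    (hφ : AEStronglyMeasurable φ (clientLaw Q K i)) :
    ∫ ξ, φ (ξ i) ∂(dataLaw Q K) = ∫ ξ, φ ξ ∂(clientLaw Q K i) := by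
  have h := measurePreserving_eval (fun i => clientLaw Q K i) i
  rw [← h.map_eq, integral_map h.measurable.aemeasurable (by rw [h.map_eq]; exact hφ)]

theorem integral_inner_sum_gradNoise (h : Q.LipschitzSmooth l) (hσ : Q.BoundedVariance σ)
    (s : Params) (w : Vec d₁ × Vec d₂) (i : Fin M) (q : WithLp 2 (Vec d₁ × Vec d₂)) :
    ∫ ξ, ⟪q, ∑ k : Fin K, gradNoise Q s i w k ξ⟫ ∂(clientLaw Q K i) = 0 := by
  simp only [inner_sum]
  rw [integral_finsetSum _ fun k _ =>
    integrable_inner_of_memLp (memLp_const q) (memLp_gradNoise h hσ s i w k)]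
  exact Finset.sum_eq_zero fun k _ => integral_inner_gradNoise h hσ s i w k q

theorem integral_inner_client_sum_gradNoise (h : Q.LipschitzSmooth l) (hσ : Q.BoundedVariance σ)
    (s : Params) (w : Vec d₁ × Vec d₂) (S : Finset (Fin M)) (q : WithLp 2 (Vec d₁ × Vec d₂)) :
    ∫ ξ, ⟪q, ∑ i ∈ S, ∑ k : Fin K, gradNoise Q s i w k (ξ i)⟫ ∂(dataLaw Q K) = 0 := by
  simp only [inner_sum (𝕜 := ℝ) S]
  rw [integral_finsetSum _ fun i _ =>
    integrable_inner_of_memLp (memLp_const q) (memLp_sum_gradNoise h hσ s w i)]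
  refine Finset.sum_eq_zero fun i _ => ?_
  rw [integral_dataLaw_eval i (φ := fun ξ => ⟪q, ∑ k : Fin K, gradNoise Q s i w k ξ⟫)]
  · exact integral_inner_sum_gradNoise h hσ s w i q
  · exact (integrable_inner_of_memLp (memLp_const q)
      (memLp_finsetSum _ fun k _ => memLp_gradNoise h hσ s i w k)).1

/-- Noise is orthogonal between clients, by resampling the whole data of one client, and between the
steps of a client. The second moment thus grows like mK rather than (mK)², which is the source of
the speedup in m and K. -/
theorem integral_norm_client_sum_gradNoise_sq_le (h : Q.LipschitzSmooth l)
    (hσ : Q.BoundedVariance σ) (s : Params) (w : Vec d₁ × Vec d₂) (S : Finset (Fin M)) :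
    ∫ ξ, ‖∑ i ∈ S, ∑ k : Fin K, gradNoise Q s i w k (ξ i)‖ ^ 2 ∂(dataLaw Q K)
      ≤ S.card * (K * σ ^ 2) := by
  rw [integral_norm_sum_sq _ (fun i _ => memLp_sum_gradNoise h hσ s w i)]
  · calc _ ≤ ∑ _i ∈ S, K * σ ^ 2 := by
          refine Finset.sum_le_sum fun i _ => ?_
          rw [integral_dataLaw_eval i (φ := fun ξ => ‖∑ k : Fin K, gradNoise Q s i w k ξ‖ ^ 2)]
          · exact integral_norm_sum_gradNoise_sq_le h hσ s i w
          · exact ((memLp_finsetSum _ fun k _ => memLp_gradNoise h hσ s i w k).integrable_norm_pow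
              (p := 2) two_ne_zero).1
      _ = _ := by simp
  · intro i _ j _ hij
    refine integral_pi_eq_zero_of_update (fun i => clientLaw Q K i) j
      (integrable_inner_of_memLp (memLp_sum_gradNoise h hσ s w i)
        (memLp_sum_gradNoise h hσ s w j)) fun ξ => ?_
    simp only [Function.update_self, Function.update_of_ne hij]
    exact integral_inner_sum_gradNoise h hσ s w j _

theorem integrable_client_sum_sq (h : Q.LipschitzSmooth l)
    (hσ : Q.BoundedVariance σ) (s : Params) (w : Vec d₁ × Vec d₂) (S : Finset (Fin M)) :
    Integrable (fun ξ : Fin M → Fin K → Ξ => ∑ i ∈ S, ∑ k : Fin K, ‖gradNoise Q s i w k (ξ i)‖ ^ 2)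
      (dataLaw Q K) :=
  integrable_finsetSum _ fun i _ => integrable_finsetSum _ fun k _ =>
    (measurePreserving_eval (fun i => clientLaw Q K i) i).integrable_comp_of_integrable
      (integrable_gradNoise_sq h hσ s i w k)

theorem integral_client_sum_sq_le (h : Q.LipschitzSmooth l)
    (hσ : Q.BoundedVariance σ) (s : Params) (w : Vec d₁ × Vec d₂) (S : Finset (Fin M)) :
    ∫ ξ, ∑ i ∈ S, ∑ k : Fin K, ‖gradNoise Q s i w k (ξ i)‖ ^ 2 ∂(dataLaw Q K)
      ≤ S.card * (K * σ ^ 2) := by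
  have hi : ∀ (i : Fin M) (k : Fin K), Integrable
      (fun ξ : Fin M → Fin K → Ξ => ‖gradNoise Q s i w k (ξ i)‖ ^ 2) (dataLaw Q K) := fun i k =>
    (measurePreserving_eval (fun i => clientLaw Q K i) i).integrable_comp_of_integrable
      (integrable_gradNoise_sq h hσ s i w k)
  rw [integral_finsetSum _ fun i _ => integrable_finsetSum _ fun k _ => hi i k]
  calc _ ≤ ∑ _i ∈ S, K * σ ^ 2 := by
        refine Finset.sum_le_sum fun i _ => ?_
        rw [integral_finsetSum _ fun k _ => hi i k]
        calc _ ≤ ∑ _k : Fin K, σ ^ 2 := by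
              refine Finset.sum_le_sum fun k _ => ?_
              rw [integral_dataLaw_eval i (φ := fun ξ => ‖gradNoise Q s i w k ξ‖ ^ 2)
                (integrable_gradNoise_sq h hσ s i w k).1]
              exact integral_gradNoise_sq_le h hσ s i w k
          _ = _ := by simp
    _ = _ := by simp

end LocalSteps

end FedMinimax

namespace FedMinimax

open scoped RealInnerProductSpace

/-! ### Pathwise drift of the local models. -/

section Drift

variable {d₁ d₂ M : ℕ} {Ξ : Type u} [MeasurableSpace Ξ]
variable {Q : Problem d₁ d₂ M Ξ} {s : Params} {i : Fin M} {K : ℕ} {l σ : ℝ}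

theorem norm_sum_sq_le_card_mul {ι E : Type*} [SeminormedAddCommGroup E] (t : Finset ι)
    (v : ι → E) : ‖∑ i ∈ t, v i‖ ^ 2 ≤ t.card * ∑ i ∈ t, ‖v i‖ ^ 2 :=
  (pow_le_pow_left₀ (norm_nonneg _) (norm_sum_le _ _) 2).trans sq_sum_le_card_mul_sum_sq

/-- π is the norm of the x- or of the y-block. Treating the blocks separately weights ‖∇ₓfᵢ‖ by
`ηxl` alone and ‖∇_y fᵢ‖ by `ηyl` alone; this matters because only (`ηxl` l K)² is bounded by a
multiple of 1/κ. -/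
theorem norm_sampleGrad_le (h : Q.LipschitzSmooth l) (w v : Vec d₁ × Vec d₂) (ξ : Ξ)
    {π : WithLp 2 (Vec d₁ × Vec d₂) → ℝ} (hπ : ∀ a, π a ≤ ‖a‖)
    (hadd : ∀ a b, π (a + b) ≤ π a + π b) :
    π (sampleGrad Q i v ξ) ≤ ‖sampleGrad Q i v ξ - localGrad Q i v‖ + π (localGrad Q i w)
      + l * (‖v.1 - w.1‖ + ‖v.2 - w.2‖) := by
  have e : sampleGrad Q i v ξ = (sampleGrad Q i v ξ - localGrad Q i v)
      + (localGrad Q i w + (localGrad Q i v - localGrad Q i w)) := by abel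
  have h1 := hadd (sampleGrad Q i v ξ - localGrad Q i v)
    (localGrad Q i w + (localGrad Q i v - localGrad Q i w))
  have h2 := hadd (localGrad Q i w) (localGrad Q i v - localGrad Q i w)
  rw [← e] at h1
  have h3 := hπ (sampleGrad Q i v ξ - localGrad Q i v)
  have h4 := hπ (localGrad Q i v - localGrad Q i w)
  have h5 : ‖localGrad Q i v - localGrad Q i w‖ ≤ _ := (h i).2 v.1 w.1 v.2 w.2
  linarith

/-- Along every sample path the local models stay close to the global model. -/
theorem localModel_drift (h : Q.LipschitzSmooth l) (hl : 0 ≤ l) (hx : 0 ≤ s.ηxl)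
    (hy : 0 ≤ s.ηyl) (hη : (s.ηxl + s.ηyl) * K * l ≤ 1 / 2) (ξ : Fin K → Ξ)
    (w : Vec d₁ × Vec d₂) {k : ℕ} (hk : k ≤ K) :
    ‖(localModel Q s i ξ w k).1 - w.1‖ + ‖(localModel Q s i ξ w k).2 - w.2‖
      ≤ 2 * (s.ηxl * (∑ j : Fin K, ‖gradNoise Q s i w j ξ‖ + K * ‖(localGrad Q i w).fst‖)
        + s.ηyl * (∑ j : Fin K, ‖gradNoise Q s i w j ξ‖ + K * ‖(localGrad Q i w).snd‖)) := by
  set gx := ‖(localGrad Q i w).fst‖ with hgx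
  set gy := ‖(localGrad Q i w).snd‖ with hgy
  set W := ∑ j : Fin K, ‖gradNoise Q s i w j ξ‖ with hW
  set Z := s.ηxl * (W + K * gx) + s.ηyl * (W + K * gy) with hZ
  -- Extending the noise by zero beyond K permits induction over natural numbers instead of `Fin K`.
  set n : ℕ → ℝ := fun j => if hj : j < K then ‖gradNoise Q s i w ⟨j, hj⟩ ξ‖ else 0 with hn
  have hn0 : ∀ j, 0 ≤ n j := fun j => by
    simp only [hn]; split_ifs <;> positivity
  have hnW : ∀ k ≤ K, ∑ j ∈ Finset.range k, n j ≤ W := fun k hk => by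
    have e : W = ∑ j ∈ Finset.range K, n j := by
      rw [hW, Finset.sum_range]
      exact Finset.sum_congr rfl fun j _ => by simp [hn]
    rw [e]
    exact Finset.sum_le_sum_of_subset_of_nonneg (Finset.range_mono hk) fun j _ _ => hn0 j
  have hW0 : 0 ≤ W := by positivity
  have hZ0 : 0 ≤ Z := by positivity
  -- The induction closes on itself: a drift of at most 2Z enters the next steps with total weight
  -- (ηxl + ηyl) K l ≤ 1/2, so it adds at most Z, and noise and initial gradients add at most
  -- another Z.
  have hbound : ∀ k ≤ K, (s.ηxl + s.ηyl) * ∑ j ∈ Finset.range k, n j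
      + k * (s.ηxl * gx + s.ηyl * gy) + (s.ηxl + s.ηyl) * k * l * (2 * Z) ≤ 2 * Z := by
    intro k hk
    have hkR : (k : ℝ) ≤ K := by exact_mod_cast hk
    have h1 := mul_le_mul_of_nonneg_left (hnW k hk) (add_nonneg hx hy)
    have h2 : (k : ℝ) * (s.ηxl * gx + s.ηyl * gy) ≤ K * (s.ηxl * gx + s.ηyl * gy) :=
      mul_le_mul_of_nonneg_right hkR (by positivity)
    have h3 : (s.ηxl + s.ηyl) * k * l ≤ 1 / 2 :=
      le_trans (mul_le_mul_of_nonneg_right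
        (mul_le_mul_of_nonneg_left hkR (add_nonneg hx hy)) hl) hη
    have h4 := mul_le_mul_of_nonneg_right h3 (by positivity : 0 ≤ 2 * Z)
    linarith
  suffices hind : ∀ k ≤ K, ‖(localModel Q s i ξ w k).1 - w.1‖ + ‖(localModel Q s i ξ w k).2 - w.2‖
      ≤ (s.ηxl + s.ηyl) * ∑ j ∈ Finset.range k, n j
      + k * (s.ηxl * gx + s.ηyl * gy) + (s.ηxl + s.ηyl) * k * l * (2 * Z) from
    (hind k hk).trans (hbound k hk)
  intro k
  induction k with
  | zero => intro _; simp [localModel]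
  | succ k ih =>
    intro hkK
    have hk' : k < K := hkK
    have ihk := ih hk'.le
    have hsucc := localModel_succ (Q := Q) (s := s) (i := i) ξ w ⟨k, hk'⟩
    simp only at hsucc
    set v := localModel Q s i ξ w k with hv
    have hs2Z := ihk.trans (hbound k hk'.le)
    have hnk : n k = ‖sampleGrad Q i v (ξ ⟨k, hk'⟩) - localGrad Q i v‖ := by
      simp only [hn, dif_pos hk']; rfl
    have h1 := norm_sampleGrad_le h (i := i) w v (ξ ⟨k, hk'⟩) (π := fun a => ‖a.fst‖) norm_fst_le
      fun a b => norm_add_le a.fst b.fst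
    have h2 := norm_sampleGrad_le h (i := i) w v (ξ ⟨k, hk'⟩) (π := fun a => ‖a.snd‖) norm_snd_le
      fun a b => norm_add_le a.snd b.snd
    simp only [← hnk, ← hgx, ← hgy] at h1 h2
    have hl2 := mul_le_mul_of_nonneg_left hs2Z hl
    rw [hsucc]
    simp only
    have h3 : ‖v.1 - s.ηxl • (sampleGrad Q i v (ξ ⟨k, hk'⟩)).fst - w.1‖
        ≤ ‖v.1 - w.1‖ + s.ηxl * (n k + gx + l * (2 * Z)) := by
      have e : v.1 - s.ηxl • (sampleGrad Q i v (ξ ⟨k, hk'⟩)).fst - w.1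
          = (v.1 - w.1) - s.ηxl • (sampleGrad Q i v (ξ ⟨k, hk'⟩)).fst := by abel
      rw [e]
      refine (norm_sub_le _ _).trans ?_
      rw [norm_smul, Real.norm_of_nonneg hx]
      have := mul_le_mul_of_nonneg_left (h1.trans (add_le_add_right hl2 _)) hx
      linarith
    have h4 : ‖v.2 + s.ηyl • (sampleGrad Q i v (ξ ⟨k, hk'⟩)).snd - w.2‖
        ≤ ‖v.2 - w.2‖ + s.ηyl * (n k + gy + l * (2 * Z)) := by
      have e : v.2 + s.ηyl • (sampleGrad Q i v (ξ ⟨k, hk'⟩)).snd - w.2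
          = (v.2 - w.2) + s.ηyl • (sampleGrad Q i v (ξ ⟨k, hk'⟩)).snd := by abel
      rw [e]
      refine (norm_add_le _ _).trans ?_
      rw [norm_smul, Real.norm_of_nonneg hy]
      have := mul_le_mul_of_nonneg_left (h2.trans (add_le_add_right hl2 _)) hy
      linarith
    rw [Finset.sum_range_succ]
    push_cast
    linarith

theorem localGrad_drift_sq (h : Q.LipschitzSmooth l) (hl : 0 ≤ l) (hx : 0 ≤ s.ηxl)
    (hy : 0 ≤ s.ηyl) (hη : (s.ηxl + s.ηyl) * K * l ≤ 1 / 2) (ξ : Fin K → Ξ)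
    (w : Vec d₁ × Vec d₂) {k : ℕ} (hk : k ≤ K) :
    ‖localGrad Q i (localModel Q s i ξ w k) - localGrad Q i w‖ ^ 2
      ≤ 16 * l ^ 2 * ((s.ηxl ^ 2 + s.ηyl ^ 2) * (K * ∑ j : Fin K, ‖gradNoise Q s i w j ξ‖ ^ 2)
        + K ^ 2 * (s.ηxl ^ 2 * ‖(localGrad Q i w).fst‖ ^ 2
          + s.ηyl ^ 2 * ‖(localGrad Q i w).snd‖ ^ 2)) := by
  have h1 := localModel_drift h hl hx hy hη ξ w (i := i) hk
  have h2 : ‖localGrad Q i (localModel Q s i ξ w k) - localGrad Q i w‖ ≤ _ :=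
    (h i).2 (localModel Q s i ξ w k).1 w.1 (localModel Q s i ξ w k).2 w.2
  have h3 := h2.trans (mul_le_mul_of_nonneg_left h1 hl)
  have h4 := pow_le_pow_left₀ (norm_nonneg _) h3 2
  have hW : (∑ j : Fin K, ‖gradNoise Q s i w j ξ‖) ^ 2
      ≤ K * ∑ j : Fin K, ‖gradNoise Q s i w j ξ‖ ^ 2 := by
    simpa using sq_sum_le_card_mul_sum_sq (s := (Finset.univ : Finset (Fin K)))
      (f := fun j => ‖gradNoise Q s i w j ξ‖)
  generalize ∑ j : Fin K, ‖gradNoise Q s i w j ξ‖ = W at *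
  generalize ∑ j : Fin K, ‖gradNoise Q s i w j ξ‖ ^ 2 = W2 at *
  generalize ‖(localGrad Q i w).fst‖ = gx at *
  generalize ‖(localGrad Q i w).snd‖ = gy at *
  refine h4.trans ?_
  have h5 : (s.ηxl * (W + K * gx) + s.ηyl * (W + K * gy)) ^ 2
      ≤ 4 * ((s.ηxl ^ 2 + s.ηyl ^ 2) * W ^ 2 + K ^ 2 * (s.ηxl ^ 2 * gx ^ 2 + s.ηyl ^ 2 * gy ^ 2)) := by
    have key : ∀ p q r t : ℝ, (p + q + (r + t)) ^ 2 ≤ 4 * (p ^ 2 + q ^ 2 + (r ^ 2 + t ^ 2)) :=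
      fun p q r t => by
        linarith [sq_nonneg (p - q), sq_nonneg (p - r), sq_nonneg (p - t), sq_nonneg (q - r),
          sq_nonneg (q - t), sq_nonneg (r - t)]
    have := key (s.ηxl * W) (s.ηxl * (K * gx)) (s.ηyl * W) (s.ηyl * (K * gy))
    linarith
  have h6 := mul_le_mul_of_nonneg_left hW
    (by positivity : 0 ≤ 4 * (s.ηxl ^ 2 + s.ηyl ^ 2))
  have h7 := mul_le_mul_of_nonneg_left (h5.trans
    (by linarith : _ ≤ 4 * ((s.ηxl ^ 2 + s.ηyl ^ 2) * (K * W2)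
      + K ^ 2 * (s.ηxl ^ 2 * gx ^ 2 + s.ηyl ^ 2 * gy ^ 2)))) (by positivity : 0 ≤ 4 * l ^ 2)
  linarith

end Drift

/-! ### One round as an inexact gradient step. -/

section Round

variable {d₁ d₂ M : ℕ} {Ξ : Type u} [MeasurableSpace Ξ]
variable {Q : Problem d₁ d₂ M Ξ} {s : Params} {K m : ℕ} {l σ : ℝ}

theorem fst_finsetSum {ι : Type*} (t : Finset ι) (v : ι → WithLp 2 (Vec d₁ × Vec d₂)) :
    (∑ i ∈ t, v i).fst = ∑ i ∈ t, (v i).fst :=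
  map_sum (WithLp.fstL 2 ℝ (Vec d₁) (Vec d₂)) v t

theorem snd_finsetSum {ι : Type*} (t : Finset ι) (v : ι → WithLp 2 (Vec d₁ × Vec d₂)) :
    (∑ i ∈ t, v i).snd = ∑ i ∈ t, (v i).snd :=
  map_sum (WithLp.sndL 2 ℝ (Vec d₁) (Vec d₂)) v t

theorem localModel_sub_eq (i : Fin M) (ξ : Fin K → Ξ) (w : Vec d₁ × Vec d₂) :
    (localModel Q s i ξ w K).1
        = w.1 - s.ηxl • (∑ k : Fin K, sampleGrad Q i (localModel Q s i ξ w k) (ξ k)).fst ∧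
      (localModel Q s i ξ w K).2
        = w.2 + s.ηyl • (∑ k : Fin K, sampleGrad Q i (localModel Q s i ξ w k) (ξ k)).snd := by
  set H : ℕ → WithLp 2 (Vec d₁ × Vec d₂) := fun j =>
    if hj : j < K then sampleGrad Q i (localModel Q s i ξ w j) (ξ ⟨j, hj⟩) else 0 with hH
  have hsum : ∑ k : Fin K, sampleGrad Q i (localModel Q s i ξ w k) (ξ k)
      = ∑ j ∈ Finset.range K, H j := by
    rw [Finset.sum_range]
    exact Finset.sum_congr rfl fun j _ => by simp [hH]
  rw [hsum]
  suffices hind : ∀ k ≤ K, (localModel Q s i ξ w k).1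
        = w.1 - s.ηxl • (∑ j ∈ Finset.range k, H j).fst ∧
      (localModel Q s i ξ w k).2 = w.2 + s.ηyl • (∑ j ∈ Finset.range k, H j).snd from
    hind K le_rfl
  intro k
  induction k with
  | zero => intro _; simp [localModel]
  | succ k ih =>
    intro hk
    obtain ⟨ih1, ih2⟩ := ih (Nat.le_of_succ_le hk)
    have hsucc := localModel_succ (Q := Q) (s := s) (i := i) ξ w ⟨k, hk⟩
    simp only at hsucc
    have hHk : H k = sampleGrad Q i (localModel Q s i ξ w k) (ξ ⟨k, hk⟩) := by
      simp only [hH]; exact dif_pos hk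
    rw [Finset.sum_range_succ, hsucc, ← hHk]
    simp only [WithLp.add_fst, WithLp.add_snd, smul_add]
    rw [ih1, ih2]
    exact ⟨by abel, by abel⟩

/-- The part of the search direction of a round that is due to the sample noise. -/
noncomputable def noisePart (Q : Problem d₁ d₂ M Ξ) (s : Params) (m : ℕ) (v : Vec d₁ × Vec d₂)
    (n : Noise M K Ξ) : WithLp 2 (Vec d₁ × Vec d₂) :=
  (1 / (m * K : ℝ)) • ∑ i ∈ n.1, ∑ k : Fin K, gradNoise Q s i v k (n.2 i)

/-- The part of the search direction of a round that is due to the drift of the local models. -/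
noncomputable def driftPart (Q : Problem d₁ d₂ M Ξ) (s : Params) (m : ℕ) (v : Vec d₁ × Vec d₂)
    (n : Noise M K Ξ) : WithLp 2 (Vec d₁ × Vec d₂) :=
  (1 / (m * K : ℝ)) • ∑ i ∈ n.1, ∑ k : Fin K,
    (localGrad Q i (localModel Q s i (n.2 i) v k) - localGrad Q i v)

/-- The part of the search direction of a round that is due to the sampling of the clients. -/
noncomputable def samplingPart (Q : Problem d₁ d₂ M Ξ) (m : ℕ) (v : Vec d₁ × Vec d₂)
    (S : Finset (Fin M)) : WithLp 2 (Vec d₁ × Vec d₂) :=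
  (1 / (m : ℝ)) • ∑ i ∈ S, (localGrad Q i v - fullGrad Q.obj v.1 v.2)

/-- Each sample gradient is split at the local gradient of the current local model, the local
gradient of the global model, and the global gradient; the three differences average to the three
parts. -/
theorem mean_sampleGrad_eq (hm : 0 < m) (hK : 0 < K) (v : Vec d₁ × Vec d₂) (n : Noise M K Ξ)
    (hn : n.1.card = m) :
    (1 / (m * K : ℝ)) • ∑ i ∈ n.1, ∑ k : Fin K,
        sampleGrad Q i (localModel Q s i (n.2 i) v k) (n.2 i k)
      = fullGrad Q.obj v.1 v.2
        + (noisePart Q s m v n + driftPart Q s m v n + samplingPart Q m v n.1) := by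
  have hm' : (m : ℝ) ≠ 0 := by positivity
  have hK' : (K : ℝ) ≠ 0 := by positivity
  have e1 : ∀ i, ∑ k : Fin K, sampleGrad Q i (localModel Q s i (n.2 i) v k) (n.2 i k)
      = ∑ k : Fin K, gradNoise Q s i v k (n.2 i)
        + ∑ k : Fin K, (localGrad Q i (localModel Q s i (n.2 i) v k) - localGrad Q i v)
        + (K : ℝ) • (localGrad Q i v - fullGrad Q.obj v.1 v.2)
        + (K : ℝ) • fullGrad Q.obj v.1 v.2 := by
    intro i
    rw [add_assoc, ← smul_add, sub_add_cancel]
    have : (K : ℝ) • localGrad Q i v = ∑ _k : Fin K, localGrad Q i v := by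
      simp [Nat.cast_smul_eq_nsmul]
    rw [this, ← Finset.sum_add_distrib, ← Finset.sum_add_distrib]
    refine Finset.sum_congr rfl fun k _ => ?_
    unfold gradNoise; abel
  simp only [e1]
  rw [Finset.sum_add_distrib, Finset.sum_add_distrib, Finset.sum_add_distrib, Finset.sum_const, hn,
    ← Finset.smul_sum, ← Nat.cast_smul_eq_nsmul ℝ, smul_smul]
  unfold noisePart driftPart samplingPart
  rw [smul_add, smul_add, smul_add, smul_smul, smul_smul, one_div_mul_cancel (mul_ne_zero hm' hK'),
    show 1 / ((m : ℝ) * K) * K = 1 / m by field_simp, one_smul]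
  abel

theorem round_x (hm : 0 < m) (hK : 0 < K) (hp : s.p = 2 * l) (w : State d₁ d₂)
    (n : Noise M K Ξ) (hn : n.1.card = m) :
    (round Q s m n w).x = w.x - (s.ηxg * s.ηxl * K) • (smoothedGradX Q.obj l w.x w.y w.z
      + ((noisePart Q s m (w.x, w.y) n).fst + (driftPart Q s m (w.x, w.y) n).fst
        + (samplingPart Q m (w.x, w.y) n.1).fst)) := by
  have hm' : (m : ℝ) ≠ 0 := by positivity
  have hK' : (K : ℝ) ≠ 0 := by positivity
  have h1 := congrArg WithLp.fst (mean_sampleGrad_eq (Q := Q) (s := s) hm hK (w.x, w.y) n hn)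
  simp only [WithLp.add_fst, WithLp.smul_fst] at h1
  have h2 : (1 / (m : ℝ)) • ∑ i ∈ n.1, (localModel Q s i (n.2 i) (w.x, w.y) K).1 - w.x
      = -((s.ηxl * K) • ((1 / (m * K : ℝ)) • (∑ i ∈ n.1, ∑ k : Fin K,
          sampleGrad Q i (localModel Q s i (n.2 i) (w.x, w.y) k) (n.2 i k)).fst)) := by
    simp only [fun i => (localModel_sub_eq (Q := Q) (s := s) i (n.2 i) (w.x, w.y)).1]
    rw [Finset.sum_sub_distrib, Finset.sum_const, hn, ← Finset.smul_sum, smul_sub,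
      ← Nat.cast_smul_eq_nsmul ℝ, smul_smul, one_div_mul_cancel hm', one_smul, sub_sub_cancel_left,
      smul_smul, smul_smul, fst_finsetSum]
    congr 2
    field_simp
  have h3 : (fullGrad Q.obj w.x w.y).fst = gradX Q.obj w.x w.y := rfl
  unfold round smoothedGradX
  simp only
  rw [h2, h1, h3, hp]
  module

theorem round_y (hm : 0 < m) (hK : 0 < K) (w : State d₁ d₂)
    (n : Noise M K Ξ) (hn : n.1.card = m) :
    (round Q s m n w).y = w.y + (s.ηyg * s.ηyl * K) • (gradY Q.obj w.x w.y
      + ((noisePart Q s m (w.x, w.y) n).snd + (driftPart Q s m (w.x, w.y) n).snd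
        + (samplingPart Q m (w.x, w.y) n.1).snd)) := by
  have hm' : (m : ℝ) ≠ 0 := by positivity
  have hK' : (K : ℝ) ≠ 0 := by positivity
  have h1 := congrArg WithLp.snd (mean_sampleGrad_eq (Q := Q) (s := s) hm hK (w.x, w.y) n hn)
  simp only [WithLp.add_snd, WithLp.smul_snd] at h1
  have h2 : (1 / (m : ℝ)) • ∑ i ∈ n.1, (localModel Q s i (n.2 i) (w.x, w.y) K).2 - w.y
      = (s.ηyl * K) • ((1 / (m * K : ℝ)) • (∑ i ∈ n.1, ∑ k : Fin K,
          sampleGrad Q i (localModel Q s i (n.2 i) (w.x, w.y) k) (n.2 i k)).snd) := by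
    simp only [fun i => (localModel_sub_eq (Q := Q) (s := s) i (n.2 i) (w.x, w.y)).2]
    rw [Finset.sum_add_distrib, Finset.sum_const, hn, ← Finset.smul_sum, smul_add,
      ← Nat.cast_smul_eq_nsmul ℝ, smul_smul, one_div_mul_cancel hm', one_smul, add_sub_cancel_left,
      smul_smul, smul_smul, snd_finsetSum]
    congr 1
    field_simp
  have h3 : (fullGrad Q.obj w.x w.y).snd = gradY Q.obj w.x w.y := rfl
  unfold round
  simp only
  rw [h2, h1, h3]
  module

/-- Convexity of the square over steps and clients reduces this to the drift of one client.
Heterogeneity replaces its gradient by that of `Q.obj` at the cost of a factor 2 and σG². The noise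
sum is kept pathwise; its expectation is taken later. -/
theorem norm_driftPart_sq_le (h : Q.LipschitzSmooth l) (hl : 0 ≤ l) (hx : 0 ≤ s.ηxl)
    (hy : 0 ≤ s.ηyl) (hη : (s.ηxl + s.ηyl) * K * l ≤ 1 / 2) {σG : ℝ}
    (hG : Q.BoundedHeterogeneity σG) (hm : 0 < m) (hK : 0 < K) (v : Vec d₁ × Vec d₂)
    (n : Noise M K Ξ) (hn : n.1.card = m) :
    ‖driftPart Q s m v n‖ ^ 2 ≤ 16 * l ^ 2 * ((s.ηxl ^ 2 + s.ηyl ^ 2)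
        * (K / m * ∑ i ∈ n.1, ∑ j : Fin K, ‖gradNoise Q s i v j (n.2 i)‖ ^ 2)
        + K ^ 2 * (2 * (s.ηxl ^ 2 + s.ηyl ^ 2) * σG ^ 2 + 2 * s.ηxl ^ 2 * ‖gradX Q.obj v.1 v.2‖ ^ 2
          + 2 * s.ηyl ^ 2 * ‖gradY Q.obj v.1 v.2‖ ^ 2)) := by
  have hm' : (0 : ℝ) < m := by positivity
  have hK' : (0 : ℝ) < K := by positivity
  set R : Fin M → ℝ := fun i => 16 * l ^ 2 * ((s.ηxl ^ 2 + s.ηyl ^ 2)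
        * (K * ∑ j : Fin K, ‖gradNoise Q s i v j (n.2 i)‖ ^ 2)
        + K ^ 2 * (2 * (s.ηxl ^ 2 + s.ηyl ^ 2) * σG ^ 2 + 2 * s.ηxl ^ 2 * ‖gradX Q.obj v.1 v.2‖ ^ 2
          + 2 * s.ηyl ^ 2 * ‖gradY Q.obj v.1 v.2‖ ^ 2)) with hR
  have h1 : ∀ i (k : Fin K),
      ‖localGrad Q i (localModel Q s i (n.2 i) v k) - localGrad Q i v‖ ^ 2 ≤ R i := by
    intro i k
    refine (localGrad_drift_sq h hl hx hy hη (n.2 i) v k.2.le).trans ?_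
    refine mul_le_mul_of_nonneg_left (add_le_add_right ?_ _) (by positivity)
    refine mul_le_mul_of_nonneg_left ?_ (by positivity)
    have hdiff := hG i v.1 v.2
    have hfst : ‖(localGrad Q i v).fst‖ ^ 2 ≤ 2 * σG ^ 2 + 2 * ‖gradX Q.obj v.1 v.2‖ ^ 2 := by
      have h2 := norm_add_sq_le_two ((localGrad Q i v) - fullGrad Q.obj v.1 v.2).fst
        (fullGrad Q.obj v.1 v.2).fst
      rw [← WithLp.add_fst, sub_add_cancel] at h2
      have h3 := pow_le_pow_left₀ (norm_nonneg _)
        (norm_fst_le ((localGrad Q i v) - fullGrad Q.obj v.1 v.2)) 2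
      have h4 : ‖(fullGrad Q.obj v.1 v.2).fst‖ = ‖gradX Q.obj v.1 v.2‖ := rfl
      rw [h4] at h2
      exact h2.trans (add_le_add_left (mul_le_mul_of_nonneg_left (h3.trans hdiff) two_pos.le) _)
    have hsnd : ‖(localGrad Q i v).snd‖ ^ 2 ≤ 2 * σG ^ 2 + 2 * ‖gradY Q.obj v.1 v.2‖ ^ 2 := by
      have h2 := norm_add_sq_le_two ((localGrad Q i v) - fullGrad Q.obj v.1 v.2).snd
        (fullGrad Q.obj v.1 v.2).snd
      rw [← WithLp.add_snd, sub_add_cancel] at h2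
      have h3 := pow_le_pow_left₀ (norm_nonneg _)
        (norm_snd_le ((localGrad Q i v) - fullGrad Q.obj v.1 v.2)) 2
      have h4 : ‖(fullGrad Q.obj v.1 v.2).snd‖ = ‖gradY Q.obj v.1 v.2‖ := rfl
      rw [h4] at h2
      exact h2.trans (add_le_add_left (mul_le_mul_of_nonneg_left (h3.trans hdiff) two_pos.le) _)
    have h5 := mul_le_mul_of_nonneg_left hfst (sq_nonneg s.ηxl)
    have h6 := mul_le_mul_of_nonneg_left hsnd (sq_nonneg s.ηyl)
    linarith
  have h2 : ‖∑ i ∈ n.1, ∑ k : Fin K,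
      (localGrad Q i (localModel Q s i (n.2 i) v k) - localGrad Q i v)‖ ^ 2
      ≤ m * ∑ i ∈ n.1, (K * (K * R i)) := by
    refine (norm_sum_sq_le_card_mul _ _).trans ?_
    rw [hn]
    refine mul_le_mul_of_nonneg_left (Finset.sum_le_sum fun i _ => ?_) hm'.le
    refine (norm_sum_sq_le_card_mul _ _).trans ?_
    rw [Finset.card_univ, Fintype.card_fin]
    refine mul_le_mul_of_nonneg_left ?_ hK'.le
    calc _ ≤ ∑ _k : Fin K, R i := Finset.sum_le_sum fun k _ => h1 i k
      _ = _ := by simp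
  unfold driftPart
  rw [norm_smul, mul_pow, Real.norm_eq_abs, sq_abs]
  refine (mul_le_mul_of_nonneg_left h2 (sq_nonneg _)).trans (le_of_eq ?_)
  simp only [hR, ← Finset.mul_sum, Finset.sum_add_distrib, Finset.sum_const, hn, nsmul_eq_mul]
  field_simp

end Round

end FedMinimax

namespace FedMinimax

open scoped RealInnerProductSpace

/-! ### Expected descent of the potential over one round. -/

section OneRound

variable {d₁ d₂ M : ℕ} {Ξ : Type u} [MeasurableSpace Ξ]
variable {Q : Problem d₁ d₂ M Ξ} {s : Params} {K m : ℕ} {l μ σ σG ε c ηx Φstar : ℝ}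

theorem integral_affine_comb {Ω : Type*} [MeasurableSpace Ω] {P : Measure Ω}
    [IsProbabilityMeasure P] {f g h : Ω → ℝ} (hf : Integrable f P) (hg : Integrable g P)
    (hh : Integrable h P) (a b c : ℝ) :
    ∫ ω, (a + (b * f ω + (g ω + c * h ω))) ∂P
      = a + (b * ∫ ω, f ω ∂P + (∫ ω, g ω ∂P + c * ∫ ω, h ω ∂P)) := by
  have h1 : Integrable (fun ω => g ω + c * h ω) P := hg.add (hh.const_mul c)
  have h2 : Integrable (fun ω => b * f ω + (g ω + c * h ω)) P := (hf.const_mul b).add h1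
  rw [integral_add (integrable_const a) h2, integral_add (hf.const_mul b) h1,
    integral_add hg (hh.const_mul c), integral_const_mul, integral_const_mul]
  simp

/-- The squared stationarity measure `‖∇ₓ f‖² + κ ‖∇_y f‖²`. -/
noncomputable def gradMeasure (f : Vec d₁ → Vec d₂ → ℝ) (κ : ℝ) (x : Vec d₁) (y : Vec d₂) : ℝ :=
  ‖gradX f x y‖ ^ 2 + κ * ‖gradY f x y‖ ^ 2

/-- The standing assumptions on the problem and the parameters of the algorithm. -/
structure Setting (Q : Problem d₁ d₂ M Ξ) (s : Params) (m K : ℕ) (l μ σ σG ε c ηx Φstar : ℝ) :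
    Prop where
  smooth : Q.LipschitzSmooth l
  variance : Q.BoundedVariance σ
  heterogeneity : Q.BoundedHeterogeneity σG
  obj : SmoothPL Q.obj l μ Φstar
  m_pos : 0 < m
  m_le : m ≤ M
  K_pos : 0 < K
  σ_pos : 0 < σ
  ε_pos : 0 < ε
  c_pos : 0 < c
  ηx_pos : 0 < ηx
  ηx_le : ηx * (1000 * K * l) ≤ 1
  adm : Admissible l μ σ σG ε c K ηx s
  regime : m = M ∨ σG = 0 ∨ K = 1

/-- The mean squared drift of the local gradients over a round. -/
noncomputable def driftBound (Q : Problem d₁ d₂ M Ξ) (s : Params) (K : ℕ) (l σ σG : ℝ)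
    (v : Vec d₁ × Vec d₂) : ℝ :=
  16 * l ^ 2 * ((s.ηxl ^ 2 + s.ηyl ^ 2) * (K ^ 2 * σ ^ 2)
    + K ^ 2 * (2 * (s.ηxl ^ 2 + s.ηyl ^ 2) * σG ^ 2 + 2 * s.ηxl ^ 2 * ‖gradX Q.obj v.1 v.2‖ ^ 2
      + 2 * s.ηyl ^ 2 * ‖gradY Q.obj v.1 v.2‖ ^ 2))

namespace Setting

/-- The second bound on `ηxl` with p and β inserted; 12288 = 2 · 6144 and 20480000 = 256 · 80000.
The ratio μ/l on the right lets the descent absorb the drift in ‖∇ₓf‖², which it controls only with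
weight 1/κ. -/
theorem sq_ηxl_le (h : Setting Q s m K l μ σ σG ε c ηx Φstar) :
    (s.ηxl * l * K) ^ 2 * (12288 * 20480000) ≤ μ / l := by
  have h1 := h.adm.ηxl_le₂
  have hl := h.obj.l_pos
  have hη := h.ηx_pos
  have hK : (0 : ℝ) < K := by exact_mod_cast h.K_pos
  rw [h.adm.p_eq, h.adm.β_eq] at h1
  rw [le_div_iff₀ hl]
  have h2 : (ηx * K) * ((s.ηxl * l * K) ^ 2 * (12288 * 20480000) * l) ≤ (ηx * K) * μ := by
    linarith
  exact le_of_mul_le_mul_left h2 (by positivity)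

theorem sq_ηyl_le (h : Setting Q s m K l μ σ σG ε c ηx Φstar) :
    (s.ηyl * l * K) ^ 2 * 786432 ≤ 1 := by
  have h1 := h.adm.ηyl_le₂
  have hη := h.ηx_pos
  have h2 : ηx * ((s.ηyl * l * K) ^ 2 * 786432) ≤ ηx * 1 := by linarith
  exact le_of_mul_le_mul_left h2 hη

theorem κ_inv_le (h : Setting Q s m K l μ σ σG ε c ηx Φstar) : μ / l ≤ 1 :=
  (div_le_one h.obj.l_pos).2 h.obj.μ_le

theorem sum_η_le (h : Setting Q s m K l μ σ σG ε c ηx Φstar) :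
    (s.ηxl + s.ηyl) * K * l ≤ 1 / 2 := by
  have h1 := h.sq_ηxl_le.trans h.κ_inv_le
  have h2 := h.sq_ηyl_le
  have h3 : s.ηxl * l * K ≤ 1 / 4 := abs_le_of_sq_le_sq' (by linarith) (by norm_num) |>.2
  have h4 : s.ηyl * l * K ≤ 1 / 4 := abs_le_of_sq_le_sq' (by linarith) (by norm_num) |>.2
  linarith

theorem sq_mul_noise_le (h : Setting Q s m K l μ σ σG ε c ηx Φstar) {η : ℝ} (hη : 0 ≤ η)
    (hη3 : η ≤ c * ε / (K * l * √(l / μ * (σG ^ 2 + σ ^ 2)))) :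
    (η * l * K) ^ 2 * (σG ^ 2 + σ ^ 2) ≤ c ^ 2 * ε ^ 2 * (μ / l) := by
  have hl := h.obj.l_pos
  have hμ := h.obj.μ_pos
  have hK : (0 : ℝ) < K := by exact_mod_cast h.K_pos
  have hσ := h.σ_pos
  have hpos : 0 < l / μ * (σG ^ 2 + σ ^ 2) := by positivity
  rw [le_div_iff₀ (by positivity)] at hη3
  have h1 := pow_le_pow_left₀ (by positivity) hη3 2
  have h2 : (η * (K * l * √(l / μ * (σG ^ 2 + σ ^ 2)))) ^ 2
      = (η * l * K) ^ 2 * (σG ^ 2 + σ ^ 2) * (l / μ) := by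
    rw [show η * (K * l * √(l / μ * (σG ^ 2 + σ ^ 2)))
      = (η * l * K) * √(l / μ * (σG ^ 2 + σ ^ 2)) by ring, mul_pow, Real.sq_sqrt hpos.le]
    ring
  rw [h2] at h1
  have h3 := mul_le_mul_of_nonneg_right h1 (by positivity : 0 ≤ μ / l)
  have h4 : l / μ * (μ / l) = 1 := by field_simp
  calc _ = (η * l * K) ^ 2 * (σG ^ 2 + σ ^ 2) * (l / μ * (μ / l)) := by rw [h4, mul_one]
    _ ≤ _ := by linarith

theorem two_driftBound_le (h : Setting Q s m K l μ σ σG ε c ηx Φstar) (v : Vec d₁ × Vec d₂) :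
    2 * driftBound Q s K l σ σG v ≤ 128 * c ^ 2 * ε ^ 2 * (μ / l)
      + 64 * (s.ηxl * l * K) ^ 2 * ‖gradX Q.obj v.1 v.2‖ ^ 2
      + 64 * (s.ηyl * l * K) ^ 2 * ‖gradY Q.obj v.1 v.2‖ ^ 2 := by
  have h1 := h.sq_mul_noise_le h.adm.ηxl_pos.le h.adm.ηxl_le₃
  have h2 := h.sq_mul_noise_le h.adm.ηyl_pos.le h.adm.ηyl_le₃
  have h3 : 0 ≤ (s.ηxl * l * K) ^ 2 * σ ^ 2 := by positivity
  have h4 : 0 ≤ (s.ηyl * l * K) ^ 2 * σ ^ 2 := by positivity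
  unfold driftBound
  linarith

/-- Balance of descent and drift in terms of the stationarity measure. -/
theorem descent_balance (h : Setting Q s m K l μ σ σG ε c ηx Φstar) (x z : Vec d₁) (y : Vec d₂) :
    -(ηx * K / 2 * ‖smoothedGradX Q.obj l x y z‖ ^ 2)
      - ηx / 256 * K / 4 * ‖gradY Q.obj x y‖ ^ 2 - l * s.β / 2 * ‖x - z‖ ^ 2
      + 2 * (ηx * K) * driftBound Q s K l σ σG (x, y)
    ≤ -(1 / 10 ^ 7 * (ηx / 256 * K * (μ / l)) * gradMeasure Q.obj (l / μ) x y)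
      + 128 * (ηx * K) * c ^ 2 * ε ^ 2 * (μ / l) := by
  have hl := h.obj.l_pos
  have hμ := h.obj.μ_pos
  have hK : (0 : ℝ) < K := by exact_mod_cast h.K_pos
  have hη := h.ηx_pos
  have h1 := h.two_driftBound_le (x, y)
  have h2 := h.sq_ηxl_le
  have h3 := h.sq_ηyl_le
  have h4 := h.κ_inv_le
  have hgX : ‖gradX Q.obj x y‖ ^ 2
      ≤ 2 * ‖smoothedGradX Q.obj l x y z‖ ^ 2 + 8 * (l ^ 2 * ‖x - z‖ ^ 2) := by
    have e : gradX Q.obj x y = smoothedGradX Q.obj l x y z - (2 * l) • (x - z) := by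
      unfold smoothedGradX; abel
    have h5 := norm_sub_sq_le_two (smoothedGradX Q.obj l x y z) ((2 * l) • (x - z))
    rw [← e, norm_smul, mul_pow, Real.norm_eq_abs, sq_abs] at h5
    linarith
  unfold gradMeasure
  simp only at h1
  -- The proximal term is worth only (b t/160000) l²‖x - z‖² with b = ηy K and t = 1/κ. Since ∇ₓf =
  -- ∇ₓf̂ - 2l(x - z), it limits the weight of ‖∇ₓf‖² and dictates the factor 1/10⁷.
  have hβ : l * s.β / 2 * ‖x - z‖ ^ 2
      = ηx / 256 * K * (μ / l) * (l ^ 2 * ‖x - z‖ ^ 2) / 160000 := by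
    rw [h.adm.β_eq]; field_simp; ring
  rw [hβ]
  have hcancel : μ / l * (l / μ) = 1 := by field_simp
  have hκ : ηx / 256 * K * (μ / l) * (l / μ * ‖gradY Q.obj x y‖ ^ 2)
      = ηx / 256 * K * ‖gradY Q.obj x y‖ ^ 2 := by
    calc _ = ηx / 256 * K * (μ / l * (l / μ)) * ‖gradY Q.obj x y‖ ^ 2 := by ring
      _ = _ := by rw [hcancel, mul_one]
  have hκ0 : 0 < μ / l := by positivity
  generalize μ / l = t at *
  generalize hb : ηx / 256 * K = b at *
  have ha : ηx * K = 256 * b := by rw [← hb]; ring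
  have hb0 : 0 < b := by rw [← hb]; positivity
  rw [ha]
  have hG := mul_le_mul_of_nonneg_left hgX (mul_nonneg hb0.le hκ0.le)
  have q1 := mul_le_mul_of_nonneg_left h1 (by positivity : 0 ≤ 256 * b)
  have q2 := mul_le_mul_of_nonneg_left h2
    (mul_nonneg hb0.le (sq_nonneg ‖gradX Q.obj x y‖))
  have q3 := mul_le_mul_of_nonneg_left h3
    (mul_nonneg hb0.le (sq_nonneg ‖gradY Q.obj x y‖))
  have q4 := mul_le_mul_of_nonneg_left h4
    (mul_nonneg hb0.le (sq_nonneg ‖smoothedGradX Q.obj l x y z‖))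
  have p1 : 0 ≤ b * ‖gradY Q.obj x y‖ ^ 2 := by positivity
  have p2 : 0 ≤ b * ‖smoothedGradX Q.obj l x y z‖ ^ 2 := by positivity
  have p3 : 0 ≤ b * t * (l ^ 2 * ‖x - z‖ ^ 2) := by positivity
  linarith

/-- Pathwise descent of the potential over one round. -/
theorem potential_round_le (h : Setting Q s m K l μ σ σG ε c ηx Φstar) (w : State d₁ d₂) :
    ∃ q : WithLp 2 (Vec d₁ × Vec d₂), ∀ n : Noise M K Ξ, n.1.card = m →
      potential Q.obj (2 * l) (round Q s m n w).x (round Q s m n w).y (round Q s m n w).z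
        ≤ potential Q.obj (2 * l) w.x w.y w.z
          - ηx * K / 2 * ‖smoothedGradX Q.obj l w.x w.y w.z‖ ^ 2
          - ηx / 256 * K / 4 * ‖gradY Q.obj w.x w.y‖ ^ 2 - l * s.β / 2 * ‖w.x - w.z‖ ^ 2
          + ⟪q, noisePart Q s m (w.x, w.y) n⟫ + ⟪q, samplingPart Q m (w.x, w.y) n.1⟫
          + 2 * (ηx * K) * ‖driftPart Q s m (w.x, w.y) n‖ ^ 2
          + 18 * l * (ηx * K) ^ 2 * (‖noisePart Q s m (w.x, w.y) n‖ ^ 2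
            + ‖samplingPart Q m (w.x, w.y) n.1‖ ^ 2) := by
  have hK : (0 : ℝ) < K := by exact_mod_cast h.K_pos
  obtain ⟨xs, hxs⟩ := h.obj.exists_minimizer w.y w.z
  -- This vector collects the coefficients of the linear error terms. It depends on the state but
  -- not on the noise of the round.
  refine ⟨WithLp.toLp 2 (-((ηx * K) • smoothedGradX Q.obj l w.x w.y w.z),
    (ηx / 256 * K) • (gradY Q.obj w.x w.y - (2 : ℝ) • gradY Q.obj xs w.y)), fun n hn => ?_⟩
  have hx := round_x (Q := Q) (s := s) h.m_pos h.K_pos h.adm.p_eq w n hn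
  have hy := round_y (Q := Q) (s := s) h.m_pos h.K_pos w n hn
  rw [h.adm.ηx_eq] at hx
  rw [h.adm.ηy_eq] at hy
  have hz : (round Q s m n w).z = w.z + s.β • ((round Q s m n w).x - w.z) := rfl
  have hd := h.obj.potential_descent (a := ηx * K) (b := ηx / 256 * K) (β := s.β)
    (mul_pos h.ηx_pos hK) (by linarith [h.ηx_le]) (by ring) h.adm.β_eq hxs hx hy
  rw [hz]
  refine hd.trans (le_of_eq ?_)
  simp only [WithLp.prod_inner_apply, WithLp.prod_norm_sq_eq_of_L2, inner_neg_left,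
    inner_smul_left, conj_trivial, inner_add_right]
  simp only [WithLp.fst, WithLp.snd]
  ring

/-- The pathwise drift becomes the deterministic `driftBound` plus a fluctuation whose mean over the
data is nonpositive. -/
theorem round_potential_le_integrand (h : Setting Q s m K l μ σ σG ε c ηx Φstar)
    (w : State d₁ d₂) :
    ∃ q : WithLp 2 (Vec d₁ × Vec d₂), ∀ n : Noise M K Ξ, n.1.card = m →
      potential Q.obj (2 * l) (round Q s m n w).x (round Q s m n w).y (round Q s m n w).z
        ≤ potential Q.obj (2 * l) w.x w.y w.z
          - ηx * K / 2 * ‖smoothedGradX Q.obj l w.x w.y w.z‖ ^ 2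
          - ηx / 256 * K / 4 * ‖gradY Q.obj w.x w.y‖ ^ 2 - l * s.β / 2 * ‖w.x - w.z‖ ^ 2
          + 2 * (ηx * K) * (driftBound Q s K l σ σG (w.x, w.y)
            + 16 * l ^ 2 * (s.ηxl ^ 2 + s.ηyl ^ 2) * (K / m * ∑ i ∈ n.1, ∑ j : Fin K,
              ‖gradNoise Q s i (w.x, w.y) j (n.2 i)‖ ^ 2 - K ^ 2 * σ ^ 2))
          + ⟪q, samplingPart Q m (w.x, w.y) n.1⟫
          + 18 * l * (ηx * K) ^ 2 * ‖samplingPart Q m (w.x, w.y) n.1‖ ^ 2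
          + ⟪q, noisePart Q s m (w.x, w.y) n⟫
          + 18 * l * (ηx * K) ^ 2 * ‖noisePart Q s m (w.x, w.y) n‖ ^ 2 := by
  have hK : (0 : ℝ) < K := by exact_mod_cast h.K_pos
  have hη := h.ηx_pos
  obtain ⟨q, hq⟩ := h.potential_round_le w
  refine ⟨q, fun n hn => (hq n hn).trans ?_⟩
  have h1 := norm_driftPart_sq_le h.smooth h.obj.l_pos.le h.adm.ηxl_pos.le h.adm.ηyl_pos.le
    h.sum_η_le h.heterogeneity h.m_pos h.K_pos (w.x, w.y) n hn
  have h2 := mul_le_mul_of_nonneg_left h1 (by positivity : 0 ≤ 2 * (ηx * K))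
  unfold driftBound
  linarith

/-- Expected descent over the data samples, for a fixed set of clients. -/
theorem lintegral_dataLaw_le (h : Setting Q s m K l μ σ σG ε c ηx Φstar)
    (w : State d₁ d₂) :
    ∃ q : WithLp 2 (Vec d₁ × Vec d₂), ∀ S : Finset (Fin M), S.card = m →
      ∃ R : ℝ, 0 ≤ R ∧ R ≤ potential Q.obj (2 * l) w.x w.y w.z - Φstar
          - 1 / 10 ^ 7 * (ηx / 256 * K * (μ / l)) * gradMeasure Q.obj (l / μ) w.x w.y
          + 128 * (ηx * K) * c ^ 2 * ε ^ 2 * (μ / l)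
          + 18 * l * (ηx * K) ^ 2 * (σ ^ 2 / (m * K))
          + ⟪q, samplingPart Q m (w.x, w.y) S⟫
          + 18 * l * (ηx * K) ^ 2 * ‖samplingPart Q m (w.x, w.y) S‖ ^ 2 ∧
        ∫⁻ ξ, ENNReal.ofReal (potential Q.obj (2 * l) (round Q s m (S, ξ) w).x
          (round Q s m (S, ξ) w).y (round Q s m (S, ξ) w).z - Φstar) ∂(dataLaw Q K)
        ≤ ENNReal.ofReal R := by
  have hK : (0 : ℝ) < K := by exact_mod_cast h.K_pos
  have hm : (0 : ℝ) < m := by exact_mod_cast h.m_pos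
  have hη := h.ηx_pos
  have hl := h.obj.l_pos
  obtain ⟨q, hq⟩ := h.round_potential_le_integrand w
  refine ⟨q, fun S hS => ?_⟩
  have hbal := h.descent_balance w.x w.z w.y
  set v := (w.x, w.y) with hv
  have hmem := memLp_client_sum_gradNoise (K := K) h.smooth h.variance s v S
  have hA : MemLp (fun ξ : Fin M → Fin K → Ξ => noisePart Q s m v (S, ξ)) 2 (dataLaw Q K) :=
    hmem.const_smul (1 / (m * K : ℝ))
  have hqA : Integrable (fun ξ : Fin M → Fin K → Ξ => ⟪q, noisePart Q s m v (S, ξ)⟫)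
      (dataLaw Q K) := integrable_inner_of_memLp (memLp_const q) hA
  have hA2 : Integrable (fun ξ : Fin M → Fin K → Ξ => ‖noisePart Q s m v (S, ξ)‖ ^ 2)
      (dataLaw Q K) := hA.integrable_norm_pow (p := 2) two_ne_zero
  have hSq := integrable_client_sum_sq (K := K) h.smooth h.variance s v S
  have hqA0 : ∫ ξ, ⟪q, noisePart Q s m v (S, ξ)⟫ ∂(dataLaw Q K) = 0 := by
    unfold noisePart
    simp only [inner_smul_right]
    rw [integral_const_mul, integral_inner_client_sum_gradNoise h.smooth h.variance, mul_zero]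
  have hA2le : ∫ ξ, ‖noisePart Q s m v (S, ξ)‖ ^ 2 ∂(dataLaw Q K) ≤ σ ^ 2 / (m * K) := by
    unfold noisePart
    simp only [norm_smul, mul_pow]
    rw [integral_const_mul]
    have h1 := integral_norm_client_sum_gradNoise_sq_le (K := K) h.smooth h.variance s v S
    rw [hS] at h1
    refine (mul_le_mul_of_nonneg_left h1 (sq_nonneg _)).trans (le_of_eq ?_)
    rw [Real.norm_of_nonneg (by positivity)]
    field_simp
  have hSqle := integral_client_sum_sq_le (K := K) h.smooth h.variance s v S
  rw [hS] at hSqle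
  set B := potential Q.obj (2 * l) w.x w.y w.z
          - ηx * K / 2 * ‖smoothedGradX Q.obj l w.x w.y w.z‖ ^ 2
          - ηx / 256 * K / 4 * ‖gradY Q.obj w.x w.y‖ ^ 2 - l * s.β / 2 * ‖w.x - w.z‖ ^ 2 with hB
  set e := 16 * l ^ 2 * (s.ηxl ^ 2 + s.ηyl ^ 2) with he
  set D := driftBound Q s K l σ σG v with hD
  set C := ⟪q, samplingPart Q m v S⟫
    + 18 * l * (ηx * K) ^ 2 * ‖samplingPart Q m v S‖ ^ 2 with hC
  -- F is integrable and dominates the nonnegative quantity V - Φ*, so integrability of the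
  -- potential need not be known in advance.
  set F : (Fin M → Fin K → Ξ) → ℝ := fun ξ => (B + 2 * (ηx * K) * (D - e * (K ^ 2 * σ ^ 2)) + C - Φstar)
    + (2 * (ηx * K) * e * (K / m) * (∑ i ∈ S, ∑ j : Fin K, ‖gradNoise Q s i v j (ξ i)‖ ^ 2)
    + (⟪q, noisePart Q s m v (S, ξ)⟫
      + 18 * l * (ηx * K) ^ 2 * ‖noisePart Q s m v (S, ξ)‖ ^ 2)) with hF
  have hle : ∀ ξ, potential Q.obj (2 * l) (round Q s m (S, ξ) w).x
          (round Q s m (S, ξ) w).y (round Q s m (S, ξ) w).z - Φstar ≤ F ξ := fun ξ => by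
    have h1 := hq (S, ξ) hS
    simp only [hF, hC]
    simp only at h1
    linarith
  have hF0 : ∀ ξ, 0 ≤ F ξ := fun ξ =>
    le_trans (sub_nonneg.2 (h.obj.le_potential _ _ _)) (hle ξ)
  have hFint : Integrable F (dataLaw Q K) :=
    (integrable_const _).add ((hSq.const_mul _).add (hqA.add (hA2.const_mul _)))
  refine ⟨∫ ξ, F ξ ∂(dataLaw Q K), integral_nonneg hF0, ?_, ?_⟩
  · have hFeq : ∫ ξ, F ξ ∂(dataLaw Q K) = (B + 2 * (ηx * K) * (D - e * (K ^ 2 * σ ^ 2)) + C - Φstar)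
        + (2 * (ηx * K) * e * (K / m)
            * ∫ ξ, (∑ i ∈ S, ∑ j : Fin K, ‖gradNoise Q s i v j (ξ i)‖ ^ 2) ∂(dataLaw Q K)
          + (0 + 18 * l * (ηx * K) ^ 2
            * ∫ ξ, ‖noisePart Q s m v (S, ξ)‖ ^ 2 ∂(dataLaw Q K))) := by
      rw [← hqA0]
      exact integral_affine_comb hSq hqA hA2 _ _ _
    rw [hFeq]
    have h1 := mul_le_mul_of_nonneg_left hSqle
      (by positivity : 0 ≤ 2 * (ηx * K) * e * (K / m))
    have h2 := mul_le_mul_of_nonneg_left hA2le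
      (by positivity : 0 ≤ 18 * l * (ηx * K) ^ 2)
    have h3 : 2 * (ηx * K) * e * (K / m) * (m * (K * σ ^ 2))
        = 2 * (ηx * K) * (e * (K ^ 2 * σ ^ 2)) := by field_simp
    rw [h3] at h1
    linarith
  · rw [ofReal_integral_eq_lintegral_ofReal hFint (ae_of_all _ hF0)]
    exact lintegral_mono fun ξ => ENNReal.ofReal_le_ofReal (hle ξ)

theorem sum_inner_samplingPart (h : Setting Q s m K l μ σ σG ε c ηx Φstar) (v : Vec d₁ × Vec d₂)
    (q : WithLp 2 (Vec d₁ × Vec d₂)) :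
    ∑ S ∈ Finset.powersetCard m (Finset.univ : Finset (Fin M)), ⟪q, samplingPart Q m v S⟫ = 0 := by
  unfold samplingPart
  simp only [inner_smul_right, inner_sum]
  rw [← Finset.mul_sum, sum_powersetCard_sum_eq_zero, mul_zero]
  rw [← inner_sum]
  have h1 : ∑ i, (localGrad Q i v - fullGrad Q.obj v.1 v.2) = 0 :=
    sum_fullGrad_sub_obj h.smooth (h.m_pos.trans_le h.m_le) v.1 v.2
  rw [h1, inner_zero_right]

/-- The general bound is σG²/m. The factor 1/K comes for free in each regime: the sampling error
vanishes for full participation or homogeneous data, and otherwise K = 1. -/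
theorem sum_norm_samplingPart_sq_le (h : Setting Q s m K l μ σ σG ε c ηx Φstar)
    (v : Vec d₁ × Vec d₂) :
    ∑ S ∈ Finset.powersetCard m (Finset.univ : Finset (Fin M)), ‖samplingPart Q m v S‖ ^ 2
      ≤ (Finset.powersetCard m (Finset.univ : Finset (Fin M))).card * (σG ^ 2 / (m * K)) := by
  have hK : (0 : ℝ) < K := by exact_mod_cast h.K_pos
  have hm : (0 : ℝ) < m := by exact_mod_cast h.m_pos
  have h0 : ∑ i, (localGrad Q i v - fullGrad Q.obj v.1 v.2) = 0 :=
    sum_fullGrad_sub_obj h.smooth (h.m_pos.trans_le h.m_le) v.1 v.2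
  have h1 := sum_powersetCard_norm_sum_sq_le m h0 (G := σG ^ 2)
    fun i => h.heterogeneity i v.1 v.2
  have h2 : ∑ S ∈ Finset.powersetCard m (Finset.univ : Finset (Fin M)), ‖samplingPart Q m v S‖ ^ 2
      ≤ (Finset.powersetCard m (Finset.univ : Finset (Fin M))).card * (σG ^ 2 / m) := by
    unfold samplingPart
    simp only [norm_smul, mul_pow]
    rw [← Finset.mul_sum]
    refine (mul_le_mul_of_nonneg_left h1 (sq_nonneg _)).trans (le_of_eq ?_)
    rw [Real.norm_of_nonneg (by positivity)]
    field_simp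
  rcases h.regime with hM | hG | hK1
  · subst hM
    have h3 : ∀ S ∈ Finset.powersetCard m (Finset.univ : Finset (Fin m)),
        ‖samplingPart Q m v S‖ ^ 2 = 0 := fun S hS => by
      have hS' : S = Finset.univ := by
        rw [← Finset.card_eq_iff_eq_univ, Fintype.card_fin]
        exact (Finset.mem_powersetCard.1 hS).2
      unfold samplingPart
      rw [hS', h0]; simp
    rw [Finset.sum_eq_zero h3]
    positivity
  · simpa [hG] using h2
  · simpa [hK1] using h2

/-- Expected descent of the potential over one round. -/
theorem lintegral_roundLaw_le (h : Setting Q s m K l μ σ σG ε c ηx Φstar) (w : State d₁ d₂) :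
    ∫⁻ n, ENNReal.ofReal (potential Q.obj (2 * l) (round Q s m n w).x
          (round Q s m n w).y (round Q s m n w).z - Φstar) ∂(roundLaw Q m K)
      + ENNReal.ofReal (1 / 10 ^ 7 * (ηx / 256 * K * (μ / l)) * gradMeasure Q.obj (l / μ) w.x w.y)
      ≤ ENNReal.ofReal (potential Q.obj (2 * l) w.x w.y w.z - Φstar)
        + ENNReal.ofReal (128 * (ηx * K) * c ^ 2 * ε ^ 2 * (μ / l)
          + 18 * l * (ηx * K) ^ 2 * ((σ ^ 2 + σG ^ 2) / (m * K))) := by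
  have hK : (0 : ℝ) < K := by exact_mod_cast h.K_pos
  have hm : (0 : ℝ) < m := by exact_mod_cast h.m_pos
  have hη := h.ηx_pos
  have hl := h.obj.l_pos
  have hμ := h.obj.μ_pos
  obtain ⟨q, hq⟩ := h.lintegral_dataLaw_le w
  set PS := Finset.powersetCard m (Finset.univ : Finset (Fin M)) with hPS
  have hcard : (0 : ℝ) < PS.card := by
    rw [hPS, Finset.card_powersetCard, Finset.card_univ, Fintype.card_fin]
    exact_mod_cast Nat.choose_pos h.m_le
  set g := 1 / 10 ^ 7 * (ηx / 256 * K * (μ / l)) * gradMeasure Q.obj (l / μ) w.x w.y with hg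
  have hg0 : 0 ≤ g := by rw [hg]; unfold gradMeasure; positivity
  set V := potential Q.obj (2 * l) w.x w.y w.z - Φstar with hV
  have hV0 : 0 ≤ V := sub_nonneg.2 (h.obj.le_potential _ _ _)
  set N₁ := 128 * (ηx * K) * c ^ 2 * ε ^ 2 * (μ / l) with hN₁
  set R : Finset (Fin M) → ℝ := fun S => V - g + N₁ + 18 * l * (ηx * K) ^ 2 * (σ ^ 2 / (m * K))
    + (⟪q, samplingPart Q m (w.x, w.y) S⟫
      + 18 * l * (ηx * K) ^ 2 * ‖samplingPart Q m (w.x, w.y) S‖ ^ 2) with hR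
  have hR0 : ∀ S : Finset (Fin M), S.card = m → 0 ≤ R S := fun S hS => by
    obtain ⟨R', h1, h2, -⟩ := hq S hS
    simp only [hR]
    linarith
  have hle : ∫⁻ n, ENNReal.ofReal (potential Q.obj (2 * l) (round Q s m n w).x
          (round Q s m n w).y (round Q s m n w).z - Φstar) ∂(roundLaw Q m K)
      ≤ ENNReal.ofReal ((PS.card : ℝ)⁻¹ * ∑ S ∈ PS, R S) := by
    -- This half of Tonelli's theorem requires no measurability.
    refine (lintegral_prod_le _).trans ?_
    rw [← lintegral_ofReal_uniformOn_card h.m_le hR0, lintegral_uniformOn_card,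
      lintegral_uniformOn_card]
    refine mul_le_mul_right (Finset.sum_le_sum fun S hS => ?_) _
    obtain ⟨R', h1, h2, h3⟩ := hq S (Finset.mem_powersetCard.1 hS).2
    refine h3.trans (ENNReal.ofReal_le_ofReal ?_)
    simp only [hR]
    linarith
  have hsum0 : 0 ≤ (PS.card : ℝ)⁻¹ * ∑ S ∈ PS, R S :=
    mul_nonneg (by positivity)
      (Finset.sum_nonneg fun S hS => hR0 S (Finset.mem_powersetCard.1 hS).2)
  have hsum : (PS.card : ℝ)⁻¹ * ∑ S ∈ PS, R S
      ≤ V - g + (N₁ + 18 * l * (ηx * K) ^ 2 * ((σ ^ 2 + σG ^ 2) / (m * K))) := by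
    have e : ∑ S ∈ PS, R S = PS.card * (V - g + N₁ + 18 * l * (ηx * K) ^ 2 * (σ ^ 2 / (m * K)))
        + (∑ S ∈ PS, ⟪q, samplingPart Q m (w.x, w.y) S⟫
          + 18 * l * (ηx * K) ^ 2 * ∑ S ∈ PS, ‖samplingPart Q m (w.x, w.y) S‖ ^ 2) := by
      rw [Finset.mul_sum, ← Finset.sum_add_distrib, ← nsmul_eq_mul, ← Finset.sum_const,
        ← Finset.sum_add_distrib]
    rw [e, h.sum_inner_samplingPart, zero_add, mul_add, inv_mul_cancel_left₀ hcard.ne']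
    have h1 := mul_le_mul_of_nonneg_left (h.sum_norm_samplingPart_sq_le (w.x, w.y))
      (by positivity : 0 ≤ (PS.card : ℝ)⁻¹ * (18 * l * (ηx * K) ^ 2))
    have h2 : (PS.card : ℝ)⁻¹ * (18 * l * (ηx * K) ^ 2) * (PS.card * (σG ^ 2 / (m * K)))
        = 18 * l * (ηx * K) ^ 2 * (σG ^ 2 / (m * K)) := by field_simp
    rw [← hPS, h2] at h1
    rw [add_div]
    linarith
  refine (add_le_add_left hle _).trans ?_
  rw [← ENNReal.ofReal_add hsum0 hg0, ← ENNReal.ofReal_add hV0 (by positivity)]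
  exact ENNReal.ofReal_le_ofReal (by linarith)

end Setting

end OneRound

end FedMinimax

namespace FedMinimax

open scoped RealInnerProductSpace

/-! ### The iterates as a Markov chain, telescoping, and the stationary point. -/

section Chain

variable {d₁ d₂ M : ℕ} {Ξ : Type u} [MeasurableSpace Ξ]
variable {Q : Problem d₁ d₂ M Ξ} {s : Params} {K m : ℕ} {l μ σ σG ε c ηx Φstar : ℝ}

instance : MeasurableSpace (State d₁ d₂) :=
  MeasurableSpace.comap (fun w => (w.x, w.y, w.z)) inferInstance

theorem measurable_state_triple : Measurable fun w : State d₁ d₂ => (w.x, w.y, w.z) :=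
  comap_measurable _

theorem measurable_state_x : Measurable fun w : State d₁ d₂ => w.x :=
  measurable_state_triple.fst

theorem measurable_state_y : Measurable fun w : State d₁ d₂ => w.y :=
  measurable_state_triple.snd.fst

theorem measurable_state_z : Measurable fun w : State d₁ d₂ => w.z :=
  measurable_state_triple.snd.snd

theorem measurable_state_xy : Measurable fun w : State d₁ d₂ => (w.x, w.y) :=
  measurable_state_x.prodMk measurable_state_y

theorem measurable_state_mk {α : Type*} [MeasurableSpace α] {g : α → State d₁ d₂}
    (hx : Measurable fun a => (g a).x) (hy : Measurable fun a => (g a).y)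
    (hz : Measurable fun a => (g a).z) : Measurable g :=
  measurable_comap_iff.2 (hx.prodMk (hy.prodMk hz))

theorem measurable_round (Q : Problem d₁ d₂ M Ξ) (s : Params) (m : ℕ) :
    Measurable fun q : Noise M K Ξ × State d₁ d₂ => round Q s m q.1 q.2 := by
  have hx : Measurable fun q : Noise M K Ξ × State d₁ d₂ => q.2.x :=
    measurable_state_x.comp measurable_snd
  have hy : Measurable fun q : Noise M K Ξ × State d₁ d₂ => q.2.y :=
    measurable_state_y.comp measurable_snd
  have hz : Measurable fun q : Noise M K Ξ × State d₁ d₂ => q.2.z :=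
    measurable_state_z.comp measurable_snd
  have hlm : ∀ i, Measurable fun q : Noise M K Ξ × State d₁ d₂ =>
      localModel Q s i (q.1.2 i) (q.2.x, q.2.y) K := fun i =>
    (measurable_localModel s i K).comp
      (((measurable_pi_apply i).comp (measurable_snd.comp measurable_fst)).prodMk (hx.prodMk hy))
  have hset : ∀ i, MeasurableSet {q : Noise M K Ξ × State d₁ d₂ | i ∈ q.1.1} := fun i =>
    (measurable_fst.comp measurable_fst)
      (MeasurableSet.of_discrete (s := {S : Finset (Fin M) | i ∈ S}))
  have hsum1 : Measurable fun q : Noise M K Ξ × State d₁ d₂ =>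
      ∑ i ∈ q.1.1, (localModel Q s i (q.1.2 i) (q.2.x, q.2.y) K).1 := by
    have e : ∀ q : Noise M K Ξ × State d₁ d₂,
        ∑ i ∈ q.1.1, (localModel Q s i (q.1.2 i) (q.2.x, q.2.y) K).1
          = ∑ i, if i ∈ q.1.1 then (localModel Q s i (q.1.2 i) (q.2.x, q.2.y) K).1 else 0 :=
      fun q => by rw [← Finset.sum_filter]; simp
    simp only [e]
    exact Finset.measurable_sum _ fun i _ => (hlm i).fst.ite (hset i) measurable_const
  have hsum2 : Measurable fun q : Noise M K Ξ × State d₁ d₂ =>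
      ∑ i ∈ q.1.1, (localModel Q s i (q.1.2 i) (q.2.x, q.2.y) K).2 := by
    have e : ∀ q : Noise M K Ξ × State d₁ d₂,
        ∑ i ∈ q.1.1, (localModel Q s i (q.1.2 i) (q.2.x, q.2.y) K).2
          = ∑ i, if i ∈ q.1.1 then (localModel Q s i (q.1.2 i) (q.2.x, q.2.y) K).2 else 0 :=
      fun q => by rw [← Finset.sum_filter]; simp
    simp only [e]
    exact Finset.measurable_sum _ fun i _ => (hlm i).snd.ite (hset i) measurable_const
  have hx' : Measurable fun q : Noise M K Ξ × State d₁ d₂ => (round Q s m q.1 q.2).x :=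
    (hx.add (((hsum1.const_smul (1 / (m : ℝ))).sub hx).const_smul s.ηxg)).sub
      ((hx.sub hz).const_smul (s.ηxl * s.ηxg * K * s.p))
  refine measurable_state_mk hx' ?_ ?_
  · exact hy.add (((hsum2.const_smul (1 / (m : ℝ))).sub hy).const_smul s.ηyg)
  · exact hz.add ((hx'.sub hz).const_smul s.β)

/-- The state entering round t is a function of the noise of rounds before t, hence independent of
`noise t`. -/
theorem measurable_fessGDA_past {Ω : Type v} {noise : ℕ → Ω → Noise M K Ξ} (w₀ : State d₁ d₂) (t : ℕ) :
    Measurable[⨆ j ∈ Set.Iio t, MeasurableSpace.comap (noise j) inferInstance]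
      (fessGDA Q s m w₀ noise t) := by
  induction t with
  | zero => exact measurable_const
  | succ t ih =>
    have h1 : Measurable[⨆ j ∈ Set.Iio (t + 1), MeasurableSpace.comap (noise j) inferInstance]
        (fessGDA Q s m w₀ noise t) :=
      ih.mono (biSup_mono fun j hj => lt_trans hj (Nat.lt_succ_self t)) le_rfl
    have h2 : Measurable[⨆ j ∈ Set.Iio (t + 1), MeasurableSpace.comap (noise j) inferInstance]
        (noise t) :=
      (comap_measurable (noise t)).mono
        (le_biSup (fun j => MeasurableSpace.comap (noise j) inferInstance)
          (Set.mem_Iio.2 (Nat.lt_succ_self t))) le_rfl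
    exact (measurable_round Q s m).comp (h2.prodMk h1)

variable {Ω : Type v} [MeasurableSpace Ω] {P : Measure Ω} {noise : ℕ → Ω → Noise M K Ξ}

theorem measurable_fessGDA (hnoise : ∀ t, Measurable (noise t)) (w₀ : State d₁ d₂) (t : ℕ) :
    Measurable (fessGDA Q s m w₀ noise t) :=
  (measurable_fessGDA_past w₀ t).mono
    (iSup₂_le fun j _ => (hnoise j).comap_le) le_rfl

theorem indepFun_fessGDA_noise (hN : IsRoundNoise Q m K P noise) (w₀ : State d₁ d₂) (t : ℕ) :
    IndepFun (fessGDA Q s m w₀ noise t) (noise t) P := by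
  have h1 := indep_iSup_of_disjoint (fun j => (hN.measurable j).comap_le) hN.indep
    (S := Set.Iio t) (T := {t}) (by simp)
  rw [IndepFun_iff_Indep]
  refine indep_of_indep_of_le_left (indep_of_indep_of_le_right h1 ?_) ?_
  · simp
  · exact (measurable_fessGDA_past w₀ t).comap_le

/-- The Markov property: by independence the joint law of state and fresh noise is a product, so the
round may be averaged with the state frozen. -/
theorem lintegral_fessGDA_succ [IsProbabilityMeasure P] (hN : IsRoundNoise Q m K P noise)
    (w₀ : State d₁ d₂) (t : ℕ) {F : State d₁ d₂ → ENNReal} (hF : Measurable F) :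
    ∫⁻ ω, F (fessGDA Q s m w₀ noise (t + 1) ω) ∂P
      = ∫⁻ ω, ∫⁻ n, F (round Q s m n (fessGDA Q s m w₀ noise t ω)) ∂(roundLaw Q m K) ∂P := by
  have hw := measurable_fessGDA (Q := Q) (s := s) (m := m) hN.measurable w₀ t
  have hn := hN.measurable t
  have h1 := (indepFun_iff_map_prod_eq_prod_map_map hw.aemeasurable hn.aemeasurable).1
    (indepFun_fessGDA_noise (s := s) hN w₀ t)
  have hG : Measurable fun q : State d₁ d₂ × Noise M K Ξ => F (round Q s m q.2 q.1) :=
    hF.comp ((measurable_round Q s m).comp measurable_swap)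
  have hp : IsProbabilityMeasure (P.map (noise t)) := Measure.isProbabilityMeasure_map hn.aemeasurable
  have hH : Measurable fun w => ∫⁻ n, F (round Q s m n w) ∂(P.map (noise t)) :=
    Measurable.lintegral_prod_right' (f := fun q : State d₁ d₂ × Noise M K Ξ =>
      F (round Q s m q.2 q.1)) hG
  calc ∫⁻ ω, F (fessGDA Q s m w₀ noise (t + 1) ω) ∂P
      = ∫⁻ q, F (round Q s m q.2 q.1)
          ∂(P.map fun ω => (fessGDA Q s m w₀ noise t ω, noise t ω)) :=
        (lintegral_map (f := fun q : State d₁ d₂ × Noise M K Ξ => F (round Q s m q.2 q.1)) hG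
          (g := fun ω => (fessGDA Q s m w₀ noise t ω, noise t ω)) (hw.prodMk hn)).symm
    _ = ∫⁻ w, ∫⁻ n, F (round Q s m n w) ∂(P.map (noise t))
          ∂(P.map (fessGDA Q s m w₀ noise t)) := by
        rw [h1, lintegral_prod _ hG.aemeasurable]
    _ = ∫⁻ ω, ∫⁻ n, F (round Q s m n (fessGDA Q s m w₀ noise t ω)) ∂(P.map (noise t)) ∂P :=
        lintegral_map (f := fun w => ∫⁻ n, F (round Q s m n w) ∂(P.map (noise t))) hH hw
    _ = _ := by rw [hN.law]

namespace Setting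

theorem measurable_potential_state (h : Setting Q s m K l μ σ σG ε c ηx Φstar) :
    Measurable fun w : State d₁ d₂ =>
      ENNReal.ofReal (potential Q.obj (2 * l) w.x w.y w.z - Φstar) :=
  ((h.obj.measurable_potential.comp measurable_state_triple).sub_const Φstar).ennreal_ofReal

theorem continuous_gradMeasure (h : Setting Q s m K l μ σ σG ε c ηx Φstar) (κ : ℝ) :
    Continuous fun v : Vec d₁ × Vec d₂ => gradMeasure Q.obj κ v.1 v.2 := by
  have hX : Continuous fun v : Vec d₁ × Vec d₂ => gradX Q.obj v.1 v.2 :=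
    continuous_of_norm_sub_le fun v v' => h.obj.lipX v.1 v.2 v'.1 v'.2
  have hY : Continuous fun v : Vec d₁ × Vec d₂ => gradY Q.obj v.1 v.2 :=
    continuous_of_norm_sub_le fun v v' => h.obj.lipY v.1 v.2 v'.1 v'.2
  unfold gradMeasure
  exact (hX.norm.pow 2).add (continuous_const.mul (hY.norm.pow 2))

theorem measurable_gradMeasure (h : Setting Q s m K l μ σ σG ε c ηx Φstar) (κ : ℝ) :
    Measurable fun v : Vec d₁ × Vec d₂ => gradMeasure Q.obj κ v.1 v.2 :=
  (h.continuous_gradMeasure κ).measurable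

theorem measurable_gradMeasure_state (h : Setting Q s m K l μ σ σG ε c ηx Φstar) (κ : ℝ) :
    Measurable fun w : State d₁ d₂ => gradMeasure Q.obj κ w.x w.y := by
  have := (h.measurable_gradMeasure κ).comp measurable_state_xy
  exact this

theorem gradMeasure_nonneg (h : Setting Q s m K l μ σ σG ε c ηx Φstar) (x : Vec d₁) (y : Vec d₂) :
    0 ≤ gradMeasure Q.obj (l / μ) x y := by
  have hl := h.obj.l_pos
  have hμ := h.obj.μ_pos
  unfold gradMeasure; positivity

/-- Telescoping of the expected descent. -/
theorem lintegral_telescope [IsProbabilityMeasure P] (h : Setting Q s m K l μ σ σG ε c ηx Φstar)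
    (hN : IsRoundNoise Q m K P noise) (w₀ : State d₁ d₂) (T : ℕ) :
    ∫⁻ ω, ENNReal.ofReal (potential Q.obj (2 * l) (fessGDA Q s m w₀ noise T ω).x
        (fessGDA Q s m w₀ noise T ω).y (fessGDA Q s m w₀ noise T ω).z - Φstar) ∂P
      + ∑ t ∈ Finset.range T, ∫⁻ ω, ENNReal.ofReal (1 / 10 ^ 7 * (ηx / 256 * K * (μ / l))
        * gradMeasure Q.obj (l / μ) (fessGDA Q s m w₀ noise t ω).x
          (fessGDA Q s m w₀ noise t ω).y) ∂P
      ≤ ENNReal.ofReal (potential Q.obj (2 * l) w₀.x w₀.y w₀.z - Φstar)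
        + T * ENNReal.ofReal (128 * (ηx * K) * c ^ 2 * ε ^ 2 * (μ / l)
          + 18 * l * (ηx * K) ^ 2 * ((σ ^ 2 + σG ^ 2) / (m * K))) := by
  induction T with
  | zero => simp [fessGDA]
  | succ T ih =>
    have hw := measurable_fessGDA (Q := Q) (s := s) (m := m) hN.measurable w₀ T
    have hS : Measurable fun ω => ENNReal.ofReal (1 / 10 ^ 7 * (ηx / 256 * K * (μ / l))
        * gradMeasure Q.obj (l / μ) (fessGDA Q s m w₀ noise T ω).x
          (fessGDA Q s m w₀ noise T ω).y) :=
      (((h.measurable_gradMeasure_state (l / μ)).comp hw).const_mul _).ennreal_ofReal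
    have hstep := lintegral_mono (μ := P) fun ω =>
      h.lintegral_roundLaw_le (fessGDA Q s m w₀ noise T ω)
    rw [lintegral_add_right _ hS, lintegral_add_right _ measurable_const, lintegral_const,
      measure_univ, mul_one, ← lintegral_fessGDA_succ hN w₀ T h.measurable_potential_state] at hstep
    rw [Finset.sum_range_succ]
    push_cast
    rw [add_mul, one_mul]
    calc _ = (∫⁻ ω, ENNReal.ofReal (potential Q.obj (2 * l) (fessGDA Q s m w₀ noise (T + 1) ω).x
              (fessGDA Q s m w₀ noise (T + 1) ω).y (fessGDA Q s m w₀ noise (T + 1) ω).z - Φstar) ∂P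
            + ∫⁻ ω, ENNReal.ofReal (1 / 10 ^ 7 * (ηx / 256 * K * (μ / l))
              * gradMeasure Q.obj (l / μ) (fessGDA Q s m w₀ noise T ω).x
                (fessGDA Q s m w₀ noise T ω).y) ∂P)
            + ∑ t ∈ Finset.range T, ∫⁻ ω, ENNReal.ofReal (1 / 10 ^ 7 * (ηx / 256 * K * (μ / l))
              * gradMeasure Q.obj (l / μ) (fessGDA Q s m w₀ noise t ω).x
                (fessGDA Q s m w₀ noise t ω).y) ∂P := by ring
      _ ≤ _ := add_le_add_left hstep _
      _ = _ := by rw [add_right_comm]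
      _ ≤ _ := add_le_add_left ih _
      _ = _ := by rw [add_assoc]

/-- Returns from extended nonnegative to real integrals. The telescoped bound is finite, and this is
what gives integrability of the gradients along the iterates. -/
theorem integrable_and_sum_le [IsProbabilityMeasure P]
    (h : Setting Q s m K l μ σ σG ε c ηx Φstar) (hN : IsRoundNoise Q m K P noise)
    (w₀ : State d₁ d₂) (T : ℕ) :
    (∀ t < T, Integrable (fun ω => gradMeasure Q.obj (l / μ) (fessGDA Q s m w₀ noise t ω).x
      (fessGDA Q s m w₀ noise t ω).y) P) ∧
    1 / 10 ^ 7 * (ηx / 256 * K * (μ / l)) * ∑ t ∈ Finset.range T,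
      ∫ ω, gradMeasure Q.obj (l / μ) (fessGDA Q s m w₀ noise t ω).x
        (fessGDA Q s m w₀ noise t ω).y ∂P
      ≤ (potential Q.obj (2 * l) w₀.x w₀.y w₀.z - Φstar)
        + T * (128 * (ηx * K) * c ^ 2 * ε ^ 2 * (μ / l)
          + 18 * l * (ηx * K) ^ 2 * ((σ ^ 2 + σG ^ 2) / (m * K))) := by
  have hl := h.obj.l_pos
  have hμ := h.obj.μ_pos
  have hη := h.ηx_pos
  have hK : (0 : ℝ) < K := by exact_mod_cast h.K_pos
  have htel := le_trans le_add_self (h.lintegral_telescope hN w₀ T)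
  set γ := 1 / 10 ^ 7 * (ηx / 256 * K * (μ / l)) with hγ
  have hγ0 : 0 < γ := by rw [hγ]; positivity
  set N := 128 * (ηx * K) * c ^ 2 * ε ^ 2 * (μ / l)
    + 18 * l * (ηx * K) ^ 2 * ((σ ^ 2 + σG ^ 2) / (m * K)) with hN'
  have hN0 : 0 ≤ N := by rw [hN']; positivity
  have hV0 : 0 ≤ potential Q.obj (2 * l) w₀.x w₀.y w₀.z - Φstar :=
    sub_nonneg.2 (h.obj.le_potential _ _ _)
  rw [← ENNReal.ofReal_natCast, ← ENNReal.ofReal_mul (by positivity),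
    ← ENNReal.ofReal_add hV0 (by positivity)] at htel
  set g : ℕ → Ω → ℝ := fun t ω => gradMeasure Q.obj (l / μ) (fessGDA Q s m w₀ noise t ω).x
      (fessGDA Q s m w₀ noise t ω).y with hg
  have hg0 : ∀ t ω, 0 ≤ γ * g t ω := fun t ω =>
    mul_nonneg hγ0.le (h.gradMeasure_nonneg _ _)
  have hgm : ∀ t, Measurable fun ω => γ * g t ω := fun t =>
    ((h.measurable_gradMeasure_state (l / μ)).comp
      (measurable_fessGDA hN.measurable w₀ t)).const_mul γ
  have hint : ∀ t ∈ Finset.range T, Integrable (fun ω => γ * g t ω) P := fun t ht => by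
    refine ⟨(hgm t).aestronglyMeasurable, ?_⟩
    rw [hasFiniteIntegral_iff_ofReal (ae_of_all _ (hg0 t))]
    refine lt_of_le_of_lt ?_ (htel.trans_lt ENNReal.ofReal_lt_top)
    exact Finset.single_le_sum (f := fun t => ∫⁻ ω, ENNReal.ofReal (γ * g t ω) ∂P)
      (fun _ _ => zero_le) ht
  refine ⟨fun t ht => ?_, ?_⟩
  · have h1 := (hint t (Finset.mem_range.2 ht)).const_mul γ⁻¹
    simpa only [inv_mul_cancel_left₀ hγ0.ne'] using h1
  · have h1 : ∑ t ∈ Finset.range T, ∫⁻ ω, ENNReal.ofReal (γ * g t ω) ∂P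
        = ENNReal.ofReal (γ * ∑ t ∈ Finset.range T, ∫ ω, g t ω ∂P) := by
      rw [Finset.mul_sum, ENNReal.ofReal_sum_of_nonneg]
      · refine Finset.sum_congr rfl fun t ht => ?_
        rw [← ofReal_integral_eq_lintegral_ofReal (hint t ht) (ae_of_all _ (hg0 t)),
          integral_const_mul]
      · intro t _
        rw [← integral_const_mul]
        exact integral_nonneg (hg0 t)
    have htel' : ∑ t ∈ Finset.range T, ∫⁻ ω, ENNReal.ofReal (γ * g t ω) ∂P ≤ _ := htel
    rw [h1] at htel'
    exact (ENNReal.ofReal_le_ofReal_iff (by positivity)).1 htel'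

end Setting

theorem stationarityY_eq (f : Vec d₁ → Vec d₂ → ℝ) (hl : 0 < l) (x : Vec d₁) (y : Vec d₂) :
    stationarityY f l x y = ‖gradY f x y‖ := by
  unfold stationarityY
  rw [id, add_sub_cancel_left, norm_smul, Real.norm_of_nonneg (by positivity)]
  field_simp

/-- A mean-square bound on the iterates yields a stationary point with positive probability. -/
theorem findsStationary_of_mean_le [IsProbabilityMeasure P] {f : Vec d₁ → Vec d₂ → ℝ} {κ : ℝ}
    (hl : 0 < l) (hκ : 0 < κ) (hε : 0 < ε) {T : ℕ} (hT : 0 < T) {w : ℕ → Ω → State d₁ d₂}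
    (hint : ∀ t < T, Integrable (fun ω => gradMeasure f κ (w t ω).x (w t ω).y) P)
    (hmean : (1 / (T : ℝ)) * ∑ t ∈ Finset.range T,
      ∫ ω, gradMeasure f κ (w t ω).x (w t ω).y ∂P ≤ ε ^ 2) :
    FindsStationary P f l κ ε T w := by
  have hT' : (0 : ℝ) < T := by exact_mod_cast hT
  unfold FindsStationary IsStationary
  simp only [stationarityY_eq f hl]
  refine ⟨hint, hmean, ?_⟩
  obtain ⟨t, ht, hle⟩ : ∃ t ∈ Finset.range T,
      ∫ ω, gradMeasure f κ (w t ω).x (w t ω).y ∂P ≤ ε ^ 2 := by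
    by_contra! hc
    have h1 : ∑ _t ∈ Finset.range T, ε ^ 2 < ∑ t ∈ Finset.range T,
        ∫ ω, gradMeasure f κ (w t ω).x (w t ω).y ∂P :=
      Finset.sum_lt_sum_of_nonempty (Finset.nonempty_range_iff.2 hT.ne') hc
    rw [Finset.sum_const, Finset.card_range, nsmul_eq_mul] at h1
    rw [one_div, inv_mul_le_iff₀ hT'] at hmean
    linarith
  refine ⟨t, Finset.mem_range.1 ht, ?_⟩
  have hi := hint t (Finset.mem_range.1 ht)
  -- A function does not exceed its mean on a set of positive probability.
  have hpos := measure_le_integral_pos hi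
  refine hpos.trans_le (measure_mono fun ω hω => ?_)
  have hω' : ‖gradX f (w t ω).x (w t ω).y‖ ^ 2 + κ * ‖gradY f (w t ω).x (w t ω).y‖ ^ 2 ≤ ε ^ 2 :=
    (show gradMeasure f κ (w t ω).x (w t ω).y ≤ _ from hω).trans hle
  refine ⟨?_, ?_⟩
  · refine le_of_sq_le_sq ?_ hε.le
    have : 0 ≤ κ * ‖gradY f (w t ω).x (w t ω).y‖ ^ 2 := by positivity
    linarith
  · rw [le_div_iff₀ (Real.sqrt_pos.2 hκ)]
    refine le_of_sq_le_sq ?_ hε.le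
    rw [mul_pow, Real.sq_sqrt hκ.le]
    linarith [sq_nonneg ‖gradX f (w t ω).x (w t ω).y‖]

end Chain

end FedMinimax

namespace FedMinimax

/-! ### Balancing step size, number of rounds and noise. -/

section Parameters

/-- The factor in the number of rounds. -/
noncomputable def roundFactor (l σ σG Δ : ℝ) : ℝ :=
  1000 * Δ * l * (512 * 10 ^ 7) + 324 * l * (σ ^ 2 + σG ^ 2) ^ 2 * Δ / σ ^ 2 * (1024 * 10 ^ 7) ^ 2
    + Δ * σ ^ 2 * l * (512 * 10 ^ 7) ^ 2

theorem roundFactor_pos {l σ σG Δ : ℝ} (hl : 0 < l) (hσ : 0 < σ) (hΔ : 0 < Δ) :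
    0 < roundFactor l σ σG Δ := by
  unfold roundFactor; positivity

/-- The step size and the number of rounds balance the initial gap and the noise. -/
theorem gap_add_noise_le {l μ σ σG Δ ε m K T X : ℝ} (hl : 0 < l) (hμ : 0 < μ) (hσ : 0 < σ)
    (hΔ : 0 < Δ) (hε : 0 < ε) (hm : 0 < m) (hK : 0 < K) (hT : 0 < T) (hX : 0 < X)
    (hX1 : X ^ 2 * (σ ^ 2 * (K * T * l)) ≤ m * Δ)
    (hX2 : X * (1000 * K * l) = 1 ∨ X ^ 2 * (σ ^ 2 * (K * T * l)) = m * Δ)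
    (hT1 : roundFactor l σ σG Δ * ((l / μ) / ε ^ 2) ≤ T)
    (hT2 : roundFactor l σ σG Δ * ((l / μ) ^ 2 / (m * ε ^ 4)) ≤ K * T) :
    Δ + T * (128 * (X * K) * (1 / 10 ^ 7) ^ 2 * ε ^ 2 * (μ / l)
      + 18 * l * (X * K) ^ 2 * ((σ ^ 2 + σG ^ 2) / (m * K)))
    ≤ 1 / 10 ^ 7 * (X / 256 * K * (μ / l)) * (T * ε ^ 2) := by
  set A := roundFactor l σ σG Δ with hA
  set ν := σ ^ 2 + σG ^ 2 with hν
  have hν0 : 0 < ν := by rw [hν]; positivity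
  -- The three summands of `roundFactor` serve the gap with X = 1/(1000Kl), the noise, and the gap
  -- with the other value of X.
  have hA1 : 1000 * Δ * l * (512 * 10 ^ 7) ≤ A := by
    have h1 : 0 ≤ 324 * l * ν ^ 2 * Δ / σ ^ 2 * (1024 * 10 ^ 7) ^ 2 := by positivity
    have h2 : 0 ≤ Δ * σ ^ 2 * l * (512 * 10 ^ 7) ^ 2 := by positivity
    rw [hA]; unfold roundFactor; linarith
  have hA2 : 324 * l * ν ^ 2 * Δ / σ ^ 2 * (1024 * 10 ^ 7) ^ 2 ≤ A := by
    have h1 : 0 ≤ 1000 * Δ * l * (512 * 10 ^ 7) := by positivity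
    have h2 : 0 ≤ Δ * σ ^ 2 * l * (512 * 10 ^ 7) ^ 2 := by positivity
    rw [hA]; unfold roundFactor; linarith
  have hA3 : Δ * σ ^ 2 * l * (512 * 10 ^ 7) ^ 2 ≤ A := by
    have h1 : 0 ≤ 1000 * Δ * l * (512 * 10 ^ 7) := by positivity
    have h2 : 0 ≤ 324 * l * ν ^ 2 * Δ / σ ^ 2 * (1024 * 10 ^ 7) ^ 2 := by positivity
    rw [hA]; unfold roundFactor; linarith
  clear_value A
  have hT1' : A * l ≤ T * ε ^ 2 * μ := by
    have e : A * ((l / μ) / ε ^ 2) = A * l / (ε ^ 2 * μ) := by field_simp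
    rw [e, div_le_iff₀ (by positivity)] at hT1
    linarith
  have hT2' : A * l ^ 2 ≤ K * T * (m * ε ^ 4 * μ ^ 2) := by
    have e : A * ((l / μ) ^ 2 / (m * ε ^ 4)) = A * l ^ 2 / (m * ε ^ 4 * μ ^ 2) := by field_simp
    rwa [e, div_le_iff₀ (by positivity)] at hT2
  -- The available descent has factor 1/(256 · 10⁷). Half of it, 1/(512 · 10⁷), pays for Δ, a
  -- quarter for the stochastic noise, and 128/10¹⁴ for the drift fits into the last quarter.
  have hgap : Δ * l * (512 * 10 ^ 7) ≤ X * K * μ * T * ε ^ 2 := by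
    rcases hX2 with hX2 | hX2
    · have h1 := mul_le_mul_of_nonneg_right hA1 hl.le
      have h2 := mul_le_mul_of_nonneg_left (h1.trans hT1') (by positivity : 0 ≤ X * K)
      have h3 : X * K * (1000 * Δ * l * (512 * 10 ^ 7) * l)
          = X * (1000 * K * l) * (Δ * l * (512 * 10 ^ 7)) := by ring
      rw [h3, hX2] at h2
      linarith
    · refine le_of_sq_le_sq ?_ (by positivity)
      have h1 := mul_le_mul_of_nonneg_right hA3 (sq_nonneg l)
      have h2 := mul_le_mul_of_nonneg_left (h1.trans hT2') hΔ.le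
      have h3 : Δ * (K * T * (m * ε ^ 4 * μ ^ 2))
          = (X * K * μ * T * ε ^ 2) ^ 2 * (σ ^ 2 * l) := by
        calc _ = (m * Δ) * (K * T * (ε ^ 4 * μ ^ 2)) := by ring
          _ = _ := by rw [← hX2]; ring
      rw [h3] at h2
      have h4 : (Δ * l * (512 * 10 ^ 7)) ^ 2 * (σ ^ 2 * l)
          ≤ (X * K * μ * T * ε ^ 2) ^ 2 * (σ ^ 2 * l) := by linarith
      exact le_of_mul_le_mul_right h4 (by positivity)
  -- Only X² is controlled, by mΔ/(σ²KTl), so squares are compared; the lower bound on KT then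
  -- suffices.
  have hnoise : 18 * l ^ 2 * ν * X * (1024 * 10 ^ 7) ≤ ε ^ 2 * m * μ := by
    refine le_of_sq_le_sq ?_ (by positivity)
    have h1 : 324 * l * ν ^ 2 * Δ * (1024 * 10 ^ 7) ^ 2 ≤ A * σ ^ 2 := by
      rw [div_mul_eq_mul_div, div_le_iff₀ (by positivity)] at hA2
      linarith
    have h2 := mul_le_mul_of_nonneg_right h1 (by positivity : 0 ≤ l ^ 3 * m)
    have h3 := mul_le_mul_of_nonneg_left hT2' (by positivity : 0 ≤ σ ^ 2 * l * m)
    have h4 := mul_le_mul_of_nonneg_left hX1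
      (by positivity : 0 ≤ 324 * l ^ 4 * ν ^ 2 * (1024 * 10 ^ 7) ^ 2)
    have h5 : (18 * l ^ 2 * ν * X * (1024 * 10 ^ 7)) ^ 2 * (σ ^ 2 * (K * T * l))
        ≤ (ε ^ 2 * m * μ) ^ 2 * (σ ^ 2 * (K * T * l)) := by linarith
    exact le_of_mul_le_mul_right h5 (by positivity)
  have e1 : T * (18 * l * (X * K) ^ 2 * (ν / (m * K)))
      = T * X * K * (18 * l ^ 2 * ν * X * (1024 * 10 ^ 7)) / (m * l * (1024 * 10 ^ 7)) := by
    field_simp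
  have h1 : T * (18 * l * (X * K) ^ 2 * (ν / (m * K)))
      ≤ X * K * (μ / l) * (T * ε ^ 2) / (1024 * 10 ^ 7) := by
    rw [e1]
    have h2 := mul_le_mul_of_nonneg_left hnoise (by positivity : 0 ≤ T * X * K)
    calc _ ≤ T * X * K * (ε ^ 2 * m * μ) / (m * l * (1024 * 10 ^ 7)) :=
          div_le_div_of_nonneg_right h2 (by positivity)
      _ = _ := by field_simp
  have h2 : Δ ≤ X * K * (μ / l) * (T * ε ^ 2) / (512 * 10 ^ 7) := by
    have e : X * K * (μ / l) * (T * ε ^ 2) / (512 * 10 ^ 7)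
        = X * K * μ * T * ε ^ 2 / (l * (512 * 10 ^ 7)) := by field_simp
    rw [e, le_div_iff₀ (by positivity)]
    linarith
  have h3 : 0 ≤ X * K * (μ / l) * (T * ε ^ 2) := by positivity
  linarith

theorem sq_div_mul_sqrt {m Δ σ N : ℝ} (hm : 0 < m) (hΔ : 0 < Δ) (hσ : 0 < σ) (hN : 0 < N) :
    (√(m * Δ) / (σ * √N)) ^ 2 * (σ ^ 2 * N) = m * Δ := by
  rw [div_pow, mul_pow, Real.sq_sqrt (by positivity), Real.sq_sqrt hN.le]
  field_simp

end Parameters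

/-! ### Assembly and choice of K and T. -/

section Main

variable {d₁ d₂ M : ℕ} {Ξ : Type u} [MeasurableSpace Ξ] {Q : Problem d₁ d₂ M Ξ}
  {l μ σ σG Δ ε Φstar : ℝ} {m K T : ℕ} {w₀ : State d₁ d₂}

/-- Convergence of FESS-GDA for any sufficiently large numbers of local steps and rounds. -/
theorem findsStationary_fessGDA (hL : Q.LipschitzSmooth l) (hV : Q.BoundedVariance σ)
    (hG : Q.BoundedHeterogeneity σG) (hΦ : ∀ x, Φstar ≤ maxVal Q.obj x) (hl : 0 < l) (hσ : 0 < σ)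
    (hΔ : 0 < Δ) (hμ : 0 < μ) (hμl : μ ≤ l) (hPL : PLInY Q.obj μ)
    (hpot : potential Q.obj (2 * l) w₀.x w₀.y w₀.z - Φstar ≤ Δ) (hm : 1 ≤ m) (hmM : m ≤ M)
    (hε : 0 < ε) (hregime : m = M ∨ σG = 0 ∨ K = 1) (hK : 1 ≤ K) (hT : 1 ≤ T)
    (hT1 : roundFactor l σ σG Δ * ((l / μ) / ε ^ 2) ≤ T)
    (hT2 : roundFactor l σ σG Δ * ((l / μ) ^ 2 / (m * ε ^ 4)) ≤ K * T) {s : Params}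
    (hs : Admissible l μ σ σG ε (1 / 10 ^ 7) K
      (min (1 / (1000 * K * l)) (√(m * Δ) / (σ * √(K * T * l)))) s)
    {Ω : Type v} [MeasurableSpace Ω] {P : Measure Ω} [IsProbabilityMeasure P]
    {noise : ℕ → Ω → Noise M K Ξ} (hN : IsRoundNoise Q m K P noise) :
    FindsStationary P Q.obj l (l / μ) ε T (fessGDA Q s m w₀ noise) := by
  have hm' : (0 : ℝ) < m := by exact_mod_cast hm
  have hK' : (0 : ℝ) < K := by exact_mod_cast hK
  have hT' : (0 : ℝ) < T := by exact_mod_cast hT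
  set X := min (1 / (1000 * K * l)) (√(m * Δ) / (σ * √(K * T * l))) with hX
  have hsq := sq_div_mul_sqrt hm' hΔ hσ (by positivity : 0 < (K : ℝ) * T * l)
  have hX0 : 0 < X := lt_min (by positivity) (by positivity)
  have hXl : X * (1000 * K * l) ≤ 1 := by
    have h1 : X ≤ 1 / (1000 * K * l) := min_le_left _ _
    rwa [le_div_iff₀ (by positivity)] at h1
  have hX1 : X ^ 2 * (σ ^ 2 * (K * T * l)) ≤ m * Δ := by
    rw [← hsq]
    exact mul_le_mul_of_nonneg_right (pow_le_pow_left₀ hX0.le (min_le_right _ _) 2) (by positivity)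
  -- Paying for Δ needs a step size that is not too small, so it matters that the minimum is
  -- attained by one of its entries.
  have hX2 : X * (1000 * K * l) = 1 ∨ X ^ 2 * (σ ^ 2 * (K * T * l)) = m * Δ := by
    rcases min_choice (1 / (1000 * K * l)) (√(m * Δ) / (σ * √(K * T * l))) with h1 | h1
    · left
      rw [hX, h1]
      field_simp
    · right
      rw [hX, h1, hsq]
  have hset : Setting Q s m K l μ σ σG ε (1 / 10 ^ 7) X Φstar :=
    { smooth := hL
      variance := hV
      heterogeneity := hG
      obj := smoothPL_obj hL (by omega) hl hμ hμl hPL hΦ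
      m_pos := hm
      m_le := hmM
      K_pos := hK
      σ_pos := hσ
      ε_pos := hε
      c_pos := by norm_num
      ηx_pos := hX0
      ηx_le := hXl
      adm := hs
      regime := hregime }
  obtain ⟨hint, hsum⟩ := hset.integrable_and_sum_le hN w₀ T
  refine findsStationary_of_mean_le hl (by positivity) hε hT hint ?_
  have hbal := gap_add_noise_le (σG := σG) hl hμ hσ hΔ hε hm' hK' hT' hX0 hX1 hX2 hT1 hT2
  rw [one_div, inv_mul_le_iff₀ hT']
  exact le_of_mul_le_mul_left ((hsum.trans (add_le_add_left hpot _)).trans hbal) (by positivity)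

end Main

end FedMinimax

open FedMinimax in
theorem theorem1 :
    ∃ c : ℝ, 0 < c ∧
    -- smoothness, noise level, heterogeneity and initial potential gap
    ∀ l σ σG Δ : ℝ, 0 < l → 0 < σ → 0 ≤ σG → 0 < Δ →
    ∃ C : ℝ, 0 < C ∧
    ∀ (d₁ d₂ M : ℕ) (Ξ : Type u) [MeasurableSpace Ξ] (Q : Problem d₁ d₂ M Ξ)
      (μ Φstar ε : ℝ) (m : ℕ) (w₀ : State d₁ d₂),
      Q.LipschitzSmooth l → Q.BoundedVariance σ → Q.BoundedHeterogeneity σG →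
      (∀ x, Φstar ≤ maxVal Q.obj x) →
      0 < μ → μ ≤ l → PLInY Q.obj μ →
      potential Q.obj (2 * l) w₀.x w₀.y w₀.z - Φstar ≤ Δ →
      1 ≤ m → m ≤ M → 0 < ε → m * ε ^ 2 ≤ l / μ →
      -- full participation or homogeneous data
      ((m = M ∨ σG = 0) →
        ∃ K T : ℕ, 1 ≤ K ∧ 1 ≤ T ∧
          -- `K = Θ(κ m⁻¹ ε⁻²)`
          (K : ℝ) ≤ C * ((l / μ) / (m * ε ^ 2)) ∧ (l / μ) / (m * ε ^ 2) ≤ C * K ∧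
          -- per-client samples and communication rounds
          (K * T : ℝ) ≤ C * ((l / μ) ^ 2 / (m * ε ^ 4)) ∧
          (T : ℝ) ≤ C * ((l / μ) / ε ^ 2) ∧
          ∀ s : Params,
            Admissible l μ σ σG ε c K
              (min (1 / (1000 * K * l)) (√(m * Δ) / (σ * √(K * T * l)))) s →
            ∀ (Ω : Type v) [MeasurableSpace Ω] (P : Measure Ω) [IsProbabilityMeasure P]
              (noise : ℕ → Ω → Noise M K Ξ), IsRoundNoise Q m K P noise →
              FindsStationary P Q.obj l (l / μ) ε T (fessGDA Q s m w₀ noise)) ∧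
      -- partial participation and heterogeneous data
      (m < M → 0 < σG →
        ∃ K T : ℕ, 1 ≤ K ∧ 1 ≤ T ∧
          -- `K = O(1)`
          (K : ℝ) ≤ C ∧
          -- per-client samples and communication rounds
          (K * T : ℝ) ≤ C * ((l / μ) ^ 2 / (m * ε ^ 4)) ∧
          (T : ℝ) ≤ C * ((l / μ) ^ 2 / (m * ε ^ 4)) ∧
          ∀ s : Params,
            Admissible l μ σ σG ε c K
              (min (1 / (1000 * K * l)) (√(m * Δ) / (σ * √(T * l) * K))) s →
            ∀ (Ω : Type v) [MeasurableSpace Ω] (P : Measure Ω) [IsProbabilityMeasure P]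
              (noise : ℕ → Ω → Noise M K Ξ), IsRoundNoise Q m K P noise →
              FindsStationary P Q.obj l (l / μ) ε T (fessGDA Q s m w₀ noise)) := by
  -- With c = 1/10⁷ the drift contribution 128c² stays below a quarter of the descent factor 1/(256
  -- · 10⁷).
  refine ⟨1 / 10 ^ 7, by norm_num, fun l σ σG Δ hl hσ _ hΔ => ?_⟩
  have hA := roundFactor_pos (σG := σG) hl hσ hΔ
  refine ⟨2 * (roundFactor l σ σG Δ + 1), by positivity, ?_⟩
  intro d₁ d₂ M Ξ _ Q μ Φstar ε m w₀ hL hV hG hΦ hμ hμl hPL hpot hm hmM hε hmε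
  set A := roundFactor l σ σG Δ with hAdef
  have hm' : (1 : ℝ) ≤ m := by exact_mod_cast hm
  have hm0 : (0 : ℝ) < m := by linarith
  have hκ : 0 < l / μ := by positivity
  set κ := l / μ with hκdef
  -- This is where mε² ≤ κ enters: the quantities inside the ceilings are bounded below, so rounding
  -- up costs only a constant factor, which C = 2(A + 1) covers.
  have hr1 : 1 ≤ κ / (m * ε ^ 2) := by rwa [one_le_div (by positivity)]
  have hq1 : 1 ≤ κ / ε ^ 2 := by
    rw [one_le_div (by positivity)]
    exact le_trans (le_mul_of_one_le_left (by positivity) hm') hmε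
  have hmul : κ ^ 2 / (m * ε ^ 4) = κ / (m * ε ^ 2) * (κ / ε ^ 2) := by field_simp
  constructor
  · intro hcase
    have hKle : (⌈κ / (m * ε ^ 2)⌉₊ : ℝ) ≤ 2 * (κ / (m * ε ^ 2)) := by
      have := Nat.ceil_lt_add_one (a := κ / (m * ε ^ 2)) (by positivity)
      linarith
    have hKge : κ / (m * ε ^ 2) ≤ (⌈κ / (m * ε ^ 2)⌉₊ : ℝ) := Nat.le_ceil _
    have hTle : (⌈A * (κ / ε ^ 2)⌉₊ : ℝ) ≤ (A + 1) * (κ / ε ^ 2) := by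
      have := Nat.ceil_lt_add_one (a := A * (κ / ε ^ 2)) (by positivity)
      linarith
    have hTge : A * (κ / ε ^ 2) ≤ (⌈A * (κ / ε ^ 2)⌉₊ : ℝ) := Nat.le_ceil _
    have hK1 : 1 ≤ ⌈κ / (m * ε ^ 2)⌉₊ := Nat.one_le_ceil_iff.2 (by positivity)
    have hT1 : 1 ≤ ⌈A * (κ / ε ^ 2)⌉₊ := Nat.one_le_ceil_iff.2 (by positivity)
    -- K is the largest order compatible with KT of order κ²/(mε⁴) while T stays of order κ/ε².
    refine ⟨⌈κ / (m * ε ^ 2)⌉₊, ⌈A * (κ / ε ^ 2)⌉₊, hK1, hT1, ?_, ?_, ?_, ?_, ?_⟩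
    · nlinarith
    · nlinarith
    · rw [hmul]
      calc _ ≤ 2 * (κ / (m * ε ^ 2)) * ((A + 1) * (κ / ε ^ 2)) :=
            mul_le_mul hKle hTle (by positivity) (by positivity)
        _ = _ := by ring
    · have : 0 ≤ (A + 1) * (κ / ε ^ 2) := by positivity
      linarith
    · intro s hs Ω _ P _ noise hN
      refine findsStationary_fessGDA hL hV hG hΦ hl hσ hΔ hμ hμl hPL hpot hm hmM hε
        (hcase.imp id Or.inl) hK1 hT1 hTge ?_ hs hN
      rw [← hκdef, hmul]
      calc A * (κ / (m * ε ^ 2) * (κ / ε ^ 2)) = κ / (m * ε ^ 2) * (A * (κ / ε ^ 2)) := by ring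
        _ ≤ _ := mul_le_mul hKge hTge (by positivity) (by positivity)
  · intro _ _
    have hQ1 : 1 ≤ κ ^ 2 / (m * ε ^ 4) := by
      rw [hmul]; exact one_le_mul_of_one_le_of_one_le hr1 hq1
    have hTle : (⌈A * (κ ^ 2 / (m * ε ^ 4))⌉₊ : ℝ) ≤ (A + 1) * (κ ^ 2 / (m * ε ^ 4)) := by
      have := Nat.ceil_lt_add_one (a := A * (κ ^ 2 / (m * ε ^ 4))) (by positivity)
      linarith
    have hTge : A * (κ ^ 2 / (m * ε ^ 4)) ≤ (⌈A * (κ ^ 2 / (m * ε ^ 4))⌉₊ : ℝ) := Nat.le_ceil _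
    have hT1 : 1 ≤ ⌈A * (κ ^ 2 / (m * ε ^ 4))⌉₊ := Nat.one_le_ceil_iff.2 (by positivity)
    have hbound : (⌈A * (κ ^ 2 / (m * ε ^ 4))⌉₊ : ℝ) ≤ 2 * (A + 1) * (κ ^ 2 / (m * ε ^ 4)) := by
      have : 0 ≤ (A + 1) * (κ ^ 2 / (m * ε ^ 4)) := by positivity
      linarith
    -- Client sampling error is not reduced by further local steps, so K = 1 and T carries the whole
    -- sample complexity.
    refine ⟨1, ⌈A * (κ ^ 2 / (m * ε ^ 4))⌉₊, le_rfl, hT1, ?_, ?_, hbound, ?_⟩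
    · push_cast; linarith
    · simpa using hbound
    · intro s hs Ω _ P _ noise hN
      -- For K = 1 the two prescribed formulas for the step size agree.
      have e : σ * √(((1 : ℕ) : ℝ) * (⌈A * (κ ^ 2 / (m * ε ^ 4))⌉₊ : ℝ) * l)
          = σ * √((⌈A * (κ ^ 2 / (m * ε ^ 4))⌉₊ : ℝ) * l) * ((1 : ℕ) : ℝ) := by simp
      rw [← e] at hs
      refine findsStationary_fessGDA hL hV hG hΦ hl hσ hΔ hμ hμl hPL hpot hm hmM hε
        (Or.inr (Or.inr rfl)) le_rfl hT1 ?_ (by simpa using hTge) hs hN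
      refine le_trans (mul_le_mul_of_nonneg_left ?_ hA.le) hTge
      rw [hmul]
      exact le_mul_of_one_le_left (by positivity) hr1
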